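/- Setting. Let $d\ge 1$, let $\lambda_d$ be Lebesgue measure on $\mathbb R^d$ and $B_\varepsilon=\{x:\|x\|<\varepsilon\}$. Let $(\Omega,\mathcal A,\mathbb P)$ be a probability space on which the translation group $\mathbb R^d$ acts measurably and preserving $\mathbb P$. A random complex measure $\Phi$ is a random element of the space of locally finite complex measures $\mu_1-\mu_2+i(\mu_3-\mu_4)$ on $\mathbb R^d$ ($\mu_j$ locally finite measures), with the $\sigma$-field generated by the evaluations $\mu\mapsto\mu(B)$ at bounded Borel sets $B$. It is invariant if $\Phi(x\cdot\omega,x+B)=\Phi(\omega,B)$ for all $x\in\mathbb R^d$, $\omega\in\Omega$ and bounded Borel $B$, and locally square-integrable if $\mathbb E[|\Phi|(B_1)^2]<\infty$, where $|\Phi|$ is the total variation measure. Write $\hat f(k)=\int e^{-i\langle k,x\rangle}f(x)\,dx$, $(f\star g)(y)=\int f(x)\overline{g(x-y)}\,dx$, $f_r(x)=f(x/r)$ for $r>0$, and $\mathbb V[X]=\mathbb E|X|^2-|\mathbb E X|^2$ for complex $X$. For $\Phi$ invariant and locally square-integrable with intensity $\gamma=\mathbb E[\Phi([0,1)^d)]$,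 let $\beta_\Phi=\alpha_\Phi-|\gamma|^2\lambda_d$ be its covariance measure, where $\alpha_\Phi(B)=\mathbb E\big[\iint \mathbf 1\{x\in[0,1)^d,\,x-y\in B\}\,\Phi(dx)\,\overline{\Phi}(dy)\big]$ for bounded Borel $B$, and let the Bartlett spectral measure $\hat\beta_\Phi$ be the Fourier transform of $\beta_\Phi$, i.e. the locally finite measure with $\beta_\Phi(f\star g)=\int\hat f\,\overline{\hat g}\,d\hat\beta_\Phi$ for all bounded, compactly supported measurable $f,g:\mathbb R^d\to\mathbb C$. For $p\in[-d,\infty)$, $\Phi$ is called $p$-uniform if $\hat\beta_\Phi(B_\varepsilon)/\varepsilon^d=O(\varepsilon^p)$ as $\varepsilon\to0$, and beyond $p$-uniform if this holds with $o$ instead of $O$. A function $f\in L^1(\mathbb R^d,\mathbb C)$ is Fourier-smooth with exponent $q\in[-d,\infty)$ if there is $c>0$ with $|\hat f(k)|\le c(1+\|k\|)^{-(d+q)/2}$ for all $k\in\mathbb R^d$ and if, in the case $q\le0$, also $\int_{\mathbb R^d\setminus B_2}\sup_{s\in B_1}|\hat f(r(k+s))|^2\,dk=O(r^{-(d+q)})$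 as $r\to\infty$. Theorem. Let $p\in[-d,\infty)$, let $\Phi$ be a locally square-integrable invariant random complex measure, and let $f\in L^1(\mathbb R^d,\mathbb C)$ be Fourier-smooth with exponent $p+\vartheta$ for some $\vartheta>0$. Then for every $r>0$ the integral $\Phi(f_r)$ is almost surely well defined (that is, $f_r$ is $|\Phi|$-integrable) and square-integrable. If $\Phi$ is $p$-uniform, then $$\frac{\mathbb V[\Phi(f_r)]}{r^d}=O(r^{-p})\quad\text{as } r\to\infty,$$ and if $\Phi$ is beyond $p$-uniform, then $\mathbb V[\Phi(f_r)]/r^d=o(r^{-p})$ as $r\to\infty$. If moreover $\int f\,d\lambda_d\neq0$, then the converses hold: $\mathbb V[\Phi(f_r)]/r^d=O(r^{-p})$ implies that $\Phi$ is $p$-uniform, and $\mathbb V[\Phi(f_r)]/r^d=o(r^{-p})$ implies that $\Phi$ is beyond $p$-uniform. -/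

import Mathlib

open MeasureTheory Filter Topology Asymptotics
open scoped ENNReal NNReal ComplexConjugate

noncomputable section

/-- `ℝ^d` with its Euclidean structure. -/
abbrev Rd (d : ℕ) : Type := EuclideanSpace ℝ (Fin d)

/-! ### Locally finite complex measures -/

/-- A locally (absolutely) finite complex measure on `ℝ^d`, that is, an object
`μ₁ - μ₂ + i (μ₃ - μ₄)` with locally finite measures `μ₁, …, μ₄`, stored by the Jordan
decompositions of its real and imaginary part. Two such measures that agree on all bounded Borel
sets have the same Jordan decompositions, and every `μ₁ - μ₂ + i (μ₃ - μ₄)` is of this form, see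
`LocComplexMeasure.exists_eval_eq`. -/
structure LocComplexMeasure (d : ℕ) where
  rePos : Measure (Rd d)
  reNeg : Measure (Rd d)
  imPos : Measure (Rd d)
  imNeg : Measure (Rd d)
  locFinite_rePos : IsLocallyFiniteMeasure rePos
  locFinite_reNeg : IsLocallyFiniteMeasure reNeg
  locFinite_imPos : IsLocallyFiniteMeasure imPos
  locFinite_imNeg : IsLocallyFiniteMeasure imNeg
  singular_re : rePos ⟂ₘ reNeg
  singular_im : imPos ⟂ₘ imNeg

namespace LocComplexMeasure

variable {d : ℕ}

/-- The value `μ(B)`, meaningful for bounded Borel sets `B`. -/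
def eval (μ : LocComplexMeasure d) (B : Set (Rd d)) : ℂ :=
  ((μ.rePos.real B - μ.reNeg.real B : ℝ) : ℂ) +
    Complex.I * ((μ.imPos.real B - μ.imNeg.real B : ℝ) : ℂ)

/-- The total variation measure `|μ|`: the smallest measure `ν` with `|μ(B)| ≤ ν(B)` for all
bounded Borel sets `B`. -/
def variation (μ : LocComplexMeasure d) : Measure (Rd d) :=
  sInf {ν : Measure (Rd d) |
    ∀ B : Set (Rd d), MeasurableSet B → Bornology.IsBounded B → ‖μ.eval B‖ₑ ≤ ν B}

/-- The integral `μ(f) = ∫ f dμ`, meaningful for functions `f` that are `|μ|`-integrable. -/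
def integral (μ : LocComplexMeasure d) (f : Rd d → ℂ) : ℂ :=
  ((∫ x, f x ∂μ.rePos) - ∫ x, f x ∂μ.reNeg) +
    Complex.I * ((∫ x, f x ∂μ.imPos) - ∫ x, f x ∂μ.imNeg)

/-- The sigma field generated by the evaluations `μ ↦ μ(B)` at bounded Borel sets `B`. -/
instance : MeasurableSpace (LocComplexMeasure d) :=
  ⨆ (B : Set (Rd d)) (_ : MeasurableSet B) (_ : Bornology.IsBounded B),
    MeasurableSpace.comap (fun μ : LocComplexMeasure d => μ.eval B) inferInstance

/-- Jordan decomposition of a difference of two locally finite measures. -/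
theorem exists_jordan (μ₁ μ₂ : Measure (Rd d)) [IsLocallyFiniteMeasure μ₁]
    [IsLocallyFiniteMeasure μ₂] :
    ∃ ν₁ ν₂ : Measure (Rd d), IsLocallyFiniteMeasure ν₁ ∧ IsLocallyFiniteMeasure ν₂ ∧
      ν₁ ⟂ₘ ν₂ ∧ ∀ B : Set (Rd d), MeasurableSet B → Bornology.IsBounded B →
        ν₁.real B - ν₂.real B = μ₁.real B - μ₂.real B := by
  set τ := μ₁ + μ₂ with hτ
  have h₁ : μ₁ ≪ τ := Measure.AbsolutelyContinuous.rfl.add_right _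
  have h₂ : μ₂ ≪ τ := by
    rw [hτ, add_comm]; exact Measure.AbsolutelyContinuous.rfl.add_right _
  set a := μ₁.rnDeriv τ with ha
  set b := μ₂.rnDeriv τ with hb
  have ma : Measurable a := Measure.measurable_rnDeriv _ _
  have mb : Measurable b := Measure.measurable_rnDeriv _ _
  have e₁ : τ.withDensity a = μ₁ := Measure.withDensity_rnDeriv_eq _ _ h₁
  have e₂ : τ.withDensity b = μ₂ := Measure.withDensity_rnDeriv_eq _ _ h₂
  have l₁ : τ.withDensity (fun x => a x - b x) ≤ μ₁ := by
    rw [← e₁]; exact withDensity_mono (ae_of_all _ fun x => tsub_le_self)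
  have l₂ : τ.withDensity (fun x => b x - a x) ≤ μ₂ := by
    rw [← e₂]; exact withDensity_mono (ae_of_all _ fun x => tsub_le_self)
  refine ⟨τ.withDensity (fun x => a x - b x), τ.withDensity (fun x => b x - a x),
    Measure.isLocallyFiniteMeasure_of_le l₁, Measure.isLocallyFiniteMeasure_of_le l₂, ?_, ?_⟩
  · have hS : MeasurableSet {x | a x ≤ b x} := measurableSet_le ma mb
    refine ⟨{x | a x ≤ b x}, hS, ?_, ?_⟩
    · rw [withDensity_apply _ hS]
      refine (setLIntegral_congr_fun hS fun x hx => ?_).trans lintegral_zero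
      exact tsub_eq_zero_of_le hx
    · rw [withDensity_apply _ hS.compl]
      refine (setLIntegral_congr_fun hS.compl fun x hx => ?_).trans lintegral_zero
      exact tsub_eq_zero_of_le (le_of_lt (not_le.1 (show ¬ a x ≤ b x from hx)))
  · intro B hB hBb
    have f₁ : μ₁ B ≠ ∞ := hBb.measure_lt_top.ne
    have f₂ : μ₂ B ≠ ∞ := hBb.measure_lt_top.ne
    have g₁ : τ.withDensity (fun x => a x - b x) B ≠ ∞ := ne_top_of_le_ne_top f₁ (l₁ B)
    have g₂ : τ.withDensity (fun x => b x - a x) B ≠ ∞ := ne_top_of_le_ne_top f₂ (l₂ B)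
    have key : τ.withDensity (fun x => a x - b x) B + μ₂ B =
        τ.withDensity (fun x => b x - a x) B + μ₁ B := by
      conv_lhs => rw [← e₂]
      conv_rhs => rw [← e₁]
      rw [withDensity_apply _ hB, withDensity_apply _ hB, withDensity_apply _ hB,
        withDensity_apply _ hB, ← lintegral_add_right _ mb, ← lintegral_add_right _ ma]
      refine lintegral_congr fun x => ?_
      rcases le_total (a x) (b x) with h | h
      · rw [tsub_eq_zero_of_le h, zero_add, tsub_add_cancel_of_le h]
      · rw [tsub_eq_zero_of_le h, zero_add, tsub_add_cancel_of_le h]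
    have key' := congrArg ENNReal.toReal key
    rw [ENNReal.toReal_add g₁ f₂, ENNReal.toReal_add g₂ f₁] at key'
    simp only [Measure.real]
    linarith

/-- Every `μ₁ - μ₂ + i (μ₃ - μ₄)` with locally finite `μ₁, …, μ₄` is a `LocComplexMeasure`. -/
theorem exists_eval_eq (μ₁ μ₂ μ₃ μ₄ : Measure (Rd d)) [IsLocallyFiniteMeasure μ₁]
    [IsLocallyFiniteMeasure μ₂] [IsLocallyFiniteMeasure μ₃] [IsLocallyFiniteMeasure μ₄] :
    ∃ μ : LocComplexMeasure d, ∀ B : Set (Rd d), MeasurableSet B → Bornology.IsBounded B →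
      μ.eval B = ((μ₁.real B - μ₂.real B : ℝ) : ℂ) +
        Complex.I * ((μ₃.real B - μ₄.real B : ℝ) : ℂ) := by
  obtain ⟨a, b, ha, hb, hab, h⟩ := exists_jordan μ₁ μ₂
  obtain ⟨a', b', ha', hb', hab', h'⟩ := exists_jordan μ₃ μ₄
  refine ⟨⟨a, b, a', b', ha, hb, ha', hb', hab, hab'⟩, fun B hB hBb => ?_⟩
  simp only [eval]
  rw [h B hB hBb, h' B hB hBb]

end LocComplexMeasure

/-! ### Fourier transforms -/

/-- The Fourier transform `f̂(k) = ∫ e^{-i⟨k,x⟩} f(x) dx`. -/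
def fourierHat {d : ℕ} (f : Rd d → ℂ) (k : Rd d) : ℂ :=
  ∫ x, Complex.exp (-(Complex.I * ((inner ℝ k x : ℝ) : ℂ))) * f x

/-- The tilted convolution `(f ⋆ g)(y) = ∫ f(x) conj(g(x - y)) dx`. -/
def tiltedConv {d : ℕ} (f g : Rd d → ℂ) (y : Rd d) : ℂ :=
  ∫ x, f x * conj (g (x - y))

/-- The test functions of the definition of `μ̂`: measurable, bounded, compactly supported. -/
def IsTestFunction {d : ℕ} (f : Rd d → ℂ) : Prop :=
  Measurable f ∧ (∃ C : ℝ, ∀ x, ‖f x‖ ≤ C) ∧ HasCompactSupport f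

/-- The measure `ν` is the Fourier transform `μ̂` of the (positive semi-definite) locally finite
complex measure `μ`: it is the locally finite measure with `μ(f ⋆ g) = ∫ f̂ conj(ĝ) dν` for all
bounded, compactly supported `f` and `g`. -/
structure IsFourierTransform {d : ℕ} (μ : LocComplexMeasure d) (ν : Measure (Rd d)) : Prop where
  locFinite : IsLocallyFiniteMeasure ν
  integrable : ∀ f g : Rd d → ℂ, IsTestFunction f → IsTestFunction g →
    Integrable (fun k => fourierHat f k * conj (fourierHat g k)) ν
  integral_eq : ∀ f g : Rd d → ℂ, IsTestFunction f → IsTestFunction g →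
    μ.integral (tiltedConv f g) = ∫ k, fourierHat f k * conj (fourierHat g k) ∂ν

/-! ### Random complex measures and their second order characteristics -/

/-- The half-open unit cube `[0,1)^d`. -/
def unitCube (d : ℕ) : Set (Rd d) := {x | ∀ i, 0 ≤ x i ∧ x i < 1}

section Random

variable {d : ℕ} {Ω : Type*} [MeasurableSpace Ω]

/-- Invariance with respect to translations: `Φ(x·ω, x + B) = Φ(ω, B)`, where `ℝ^d` acts on the
probability space by `x +ᵥ ω`. -/
def IsInvariantRCM [AddAction (Rd d) Ω] (Φ : Ω → LocComplexMeasure d) : Prop :=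
  ∀ (x : Rd d) (ω : Ω) (B : Set (Rd d)), MeasurableSet B → Bornology.IsBounded B →
    (Φ (x +ᵥ ω)).eval ((fun y => x + y) '' B) = (Φ ω).eval B

/-- Local square-integrability: `E[|Φ|(B_1)²] < ∞`. -/
def IsLocallySquareIntegrable (P : Measure Ω) (Φ : Ω → LocComplexMeasure d) : Prop :=
  ∫⁻ ω, (Φ ω).variation (Metric.ball 0 1) ^ 2 ∂P < ∞

/-- The intensity `γ`, which satisfies `E[Φ] = γ λ_d` for invariant `Φ`. -/
def intensity (P : Measure Ω) (Φ : Ω → LocComplexMeasure d) : ℂ :=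
  ∫ ω, (Φ ω).eval (unitCube d) ∂P

/-- The reduced second moment measure
`α_Φ(B) = E[∬ 1{x ∈ [0,1)^d, x - y ∈ B} Φ(dx) conj(Φ)(dy)]` at bounded Borel sets `B`. -/
def reducedSecondMoment (P : Measure Ω) (Φ : Ω → LocComplexMeasure d) (B : Set (Rd d)) : ℂ :=
  ∫ ω, (Φ ω).integral (fun x => (unitCube d).indicator
    (fun x => conj ((Φ ω).integral fun y => B.indicator (fun _ => (1 : ℂ)) (x - y))) x) ∂P

/-- `β` is the covariance measure `β_Φ = α_Φ - |γ|² λ_d`. -/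
def IsCovarianceMeasure (P : Measure Ω) (Φ : Ω → LocComplexMeasure d)
    (β : LocComplexMeasure d) : Prop :=
  ∀ B : Set (Rd d), MeasurableSet B → Bornology.IsBounded B →
    β.eval B = reducedSecondMoment P Φ B -
      ((‖intensity P Φ‖ ^ 2 * (volume : Measure (Rd d)).real B : ℝ) : ℂ)

/-- `ν` is the Bartlett spectral measure of `Φ`, the Fourier transform of the covariance
measure. -/
def IsBartlettSpectralMeasure (P : Measure Ω) (Φ : Ω → LocComplexMeasure d)
    (ν : Measure (Rd d)) : Prop :=
  ∃ β : LocComplexMeasure d, IsCovarianceMeasure P Φ β ∧ IsFourierTransform β ν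

/-- `Φ` is `p`-uniform: its Bartlett spectral measure `ν` exists and satisfies
`ν(B_ε) / ε^d = O(ε^p)` as `ε → 0`. -/
def IsUniform (P : Measure Ω) (Φ : Ω → LocComplexMeasure d) (p : ℝ) : Prop :=
  ∃ ν : Measure (Rd d), IsBartlettSpectralMeasure P Φ ν ∧
    (fun ε : ℝ => ν.real (Metric.ball 0 ε) / ε ^ d) =O[𝓝[>] (0 : ℝ)] fun ε : ℝ => ε ^ p

/-- `Φ` is beyond `p`-uniform: its Bartlett spectral measure `ν` exists and satisfies
`ν(B_ε) / ε^d = o(ε^p)` as `ε → 0`. -/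
def IsBeyondUniform (P : Measure Ω) (Φ : Ω → LocComplexMeasure d) (p : ℝ) : Prop :=
  ∃ ν : Measure (Rd d), IsBartlettSpectralMeasure P Φ ν ∧
    (fun ε : ℝ => ν.real (Metric.ball 0 ε) / ε ^ d) =o[𝓝[>] (0 : ℝ)] fun ε : ℝ => ε ^ p

/-- The variance `E[|X|²] - |E[X]|²` of a complex random variable. -/
def complexVariance (P : Measure Ω) (X : Ω → ℂ) : ℝ :=
  (∫ ω, ‖X ω‖ ^ 2 ∂P) - ‖∫ ω, X ω ∂P‖ ^ 2

end Random

/-! ### Test functions of the real-space characterization -/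

/-- Fourier-smoothness of `f ∈ L¹` with exponent `q`. The bound
`∫_{B_2ᶜ} sup_{s ∈ B_1} |f̂(r (k + s))|² dk = O(r^{-(d+q)})` is stated with values in `[0, ∞]`. -/
structure IsFourierSmooth {d : ℕ} (f : Rd d → ℂ) (q : ℝ) : Prop where
  integrable : Integrable f
  decay : ∃ c : ℝ, 0 < c ∧ ∀ k : Rd d, ‖fourierHat f k‖ ≤ c / (1 + ‖k‖) ^ (((d : ℝ) + q) / 2)
  tail : q ≤ 0 → ∃ C : ℝ, ∀ᶠ r : ℝ in atTop,
    ∫⁻ k in (Metric.ball (0 : Rd d) 2)ᶜ,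
        (⨆ s ∈ Metric.ball (0 : Rd d) 1, ‖fourierHat f (r • (k + s))‖ₑ ^ 2) ≤
      ENNReal.ofReal (C * r ^ (-((d : ℝ) + q)))

/-- The spread function `f_r(x) = f(x / r)`. -/
def spread {d : ℕ} (f : Rd d → ℂ) (r : ℝ) (x : Rd d) : ℂ := f (r⁻¹ • x)

end

/-! Everything rests on the spectral isometry V[Φ(f)] = ∫ |f̂|² dν, where ν is the Bartlett spectral
measure, valid for integrable f with f̂ ∈ L²(ν) (`IsBartlettSpectralMeasure.complexVariance_eq`).
Since f_r has transform r^d f̂(r k), it yields V[Φ(f_r)] / r^d = r^d ∫ |f̂(r k)|² ν(dk), and both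
directions compare this dilated profile with the mass of ν near 0.

Direct part. Put a = d + p ≥ 0 and b = d + p + ϑ > a, so that |f̂(k)|² is at most a constant times
(1 + ‖k‖)^(-b). Near 0, where ν(B_ε) ≤ A ε^a, the dyadic balls of radius 2^j / r contribute A r^(-a)
2^(j(a-b)), a convergent geometric series. On a bounded shell away from 0 the decay gives O(r^(-b)).
Far out, ν is merely bounded on unit balls, and the integral is compared with a Lebesgue integral of
local suprema of |f̂(r ·)|², again O(r^(-b)). The constant in front of A depends neither on A nor on
the radius up to which the bound on ν holds, so one estimate
(`IsFourierSmooth.exists_integral_norm_sq_le`) serves both O and o.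

Converse. If f̂(0) = ∫ f ≠ 0, then |f̂|² is bounded below on some B_δ, and ν(B_ε) is at most a
multiple of ∫ |f̂(δ k / ε)|² ν(dk) (`IsBartlettSpectralMeasure.isBigO_measure_ball`).

Existence of ν. By invariance the second moment measures of the four Jordan parts disintegrate into
Lebesgue measure times a reduced measure (`secondMoment_map_sub`). This gives a covariance measure β
with β(f ⋆ f) = V[Φ(f)] ≥ 0, and the Bochner–Schwartz theorem applies. It is proved by windowing:
multiplied by W = w ⋆ w, the measure β acquires a bounded continuous nonnegative transform; as W → 1
the resulting measures stay uniformly bounded on unit balls and have a limit point ν; mollification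
then extends the identity to all test functions.

The isometry passes from test functions to general f by approximating f in L¹ and f̂ in L²(ν) at the
same time. Fatou's lemma first gives an upper bound on the second moment, and this bound applied to
differences gives equality. -/

noncomputable section

/-! ### Bounded Borel sets and mutually singular locally finite measures -/

/-- A monotone exhaustion of a measurable set by bounded measurable sets. -/
theorem iUnion_inter_ball_nat {E : Type*} [SeminormedAddCommGroup E] (s : Set E) :
    ⋃ n : ℕ, s ∩ Metric.ball 0 n = s := by
  rw [← Set.inter_iUnion, Metric.iUnion_ball_nat, Set.inter_univ]

theorem monotone_inter_ball_nat {E : Type*} [SeminormedAddCommGroup E] (s : Set E) :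
    Monotone fun n : ℕ => s ∩ Metric.ball (0 : E) n := fun _ _ h =>
  Set.inter_subset_inter_right _ (Metric.ball_subset_ball (by exact_mod_cast h))

theorem measure_eq_iSup_inter_ball {E : Type*} [SeminormedAddCommGroup E] [MeasurableSpace E]
    (μ : Measure E) (s : Set E) : μ s = ⨆ n : ℕ, μ (s ∩ Metric.ball 0 n) := by
  rw [← (monotone_inter_ball_nat s).measure_iUnion, iUnion_inter_ball_nat]

/-- Domination on bounded measurable sets implies domination. -/
theorem measure_le_of_isBounded {E : Type*} [SeminormedAddCommGroup E] [MeasurableSpace E]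
    [OpensMeasurableSpace E] {μ ν : Measure E}
    (h : ∀ s, MeasurableSet s → Bornology.IsBounded s → μ s ≤ ν s) : μ ≤ ν := by
  refine Measure.le_iff.2 fun s hs => ?_
  rw [measure_eq_iSup_inter_ball μ, measure_eq_iSup_inter_ball ν]
  exact iSup_mono fun n => h _ (hs.inter Metric.isOpen_ball.measurableSet)
    (Metric.isBounded_ball.subset Set.inter_subset_right)

/-- The positive part of a difference of mutually singular measures is obtained by testing the
difference on the sets of a generating algebra. -/
theorem measure_eq_iSup_ofReal_sub {d : ℕ} {μ ν : Measure (Rd d)} [IsLocallyFiniteMeasure μ]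
    [IsLocallyFiniteMeasure ν] (h : μ ⟂ₘ ν) {𝒜 : Set (Set (Rd d))} (h𝒜 : IsSetAlgebra 𝒜)
    (hgen : (inferInstance : MeasurableSpace (Rd d)) = MeasurableSpace.generateFrom 𝒜)
    {B : Set (Rd d)} (hb : Bornology.IsBounded B) :
    μ B = ⨆ A ∈ 𝒜, ENNReal.ofReal (μ.real (A ∩ B) - ν.real (A ∩ B)) := by
  have hμ : μ B ≠ ∞ := hb.measure_lt_top.ne
  have hν : ν B ≠ ∞ := hb.measure_lt_top.ne
  have hμ' : ∀ A, μ (A ∩ B) ≠ ∞ := fun A => ne_top_of_le_ne_top hμ (measure_mono Set.inter_subset_right)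
  have hν' : ∀ A, ν (A ∩ B) ≠ ∞ := fun A => ne_top_of_le_ne_top hν (measure_mono Set.inter_subset_right)
  apply le_antisymm
  · obtain ⟨S, hS, hS0, hS1⟩ := h
    have hf : IsFiniteMeasure ((μ + ν).restrict B) := by
      refine ⟨?_⟩
      rw [Measure.restrict_apply_univ, Measure.add_apply]
      exact ENNReal.add_lt_top.2 ⟨hμ.lt_top, hν.lt_top⟩
    have hd := Measure.MeasureDense.of_generateFrom_isSetAlgebra_finite ((μ + ν).restrict B) h𝒜 hgen
    refine ENNReal.le_of_forall_pos_le_add fun ε hε _ => ?_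
    -- The set `Sᶜ` carries all of `μ` and none of `ν`, so testing on it would give `μ B` exactly. A
    -- member of the algebra that is `ε`-close to it for `μ + ν` on `B` loses at most `ε`.
    obtain ⟨A, hA, hlt⟩ := hd.approx Sᶜ hS.compl (measure_ne_top _ _) ε (by exact_mod_cast hε)
    have hAm := hd.measurable A hA
    rw [Measure.restrict_apply (hS.compl.symmDiff hAm), Measure.add_apply] at hlt
    have key : μ B + ν (A ∩ B) ≤ μ (A ∩ B) + ENNReal.ofReal ε := by
      have h1 : μ B ≤ μ (A ∩ B) + μ (symmDiff Sᶜ A ∩ B) := by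
        calc μ B ≤ μ (S ∪ (A ∩ B) ∪ (symmDiff Sᶜ A ∩ B)) := by
              refine measure_mono fun x hx => ?_
              simp only [Set.mem_union, Set.mem_inter_iff, Set.mem_symmDiff, Set.mem_compl_iff]
              tauto
          _ ≤ μ S + μ (A ∩ B) + μ (symmDiff Sᶜ A ∩ B) :=
              (measure_union_le _ _).trans (by gcongr; exact measure_union_le _ _)
          _ = _ := by rw [hS0, zero_add]
      have h2 : ν (A ∩ B) ≤ ν (symmDiff Sᶜ A ∩ B) := by
        calc ν (A ∩ B) ≤ ν (Sᶜ ∪ (symmDiff Sᶜ A ∩ B)) := by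
              refine measure_mono fun x hx => ?_
              simp only [Set.mem_union, Set.mem_inter_iff, Set.mem_symmDiff, Set.mem_compl_iff]
              have := hx.1; have := hx.2
              tauto
          _ ≤ ν Sᶜ + ν (symmDiff Sᶜ A ∩ B) := measure_union_le _ _
          _ = _ := by rw [hS1, zero_add]
      calc _ ≤ μ (A ∩ B) + μ (symmDiff Sᶜ A ∩ B) + ν (symmDiff Sᶜ A ∩ B) := add_le_add h1 h2
        _ ≤ _ := by rw [add_assoc]; gcongr
    refine le_trans ?_ (add_le_add_left (le_iSup₂_of_le A hA le_rfl) _)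
    have key' := ENNReal.toReal_mono (by simp [hμ' A]) key
    rw [ENNReal.toReal_add hμ (hν' A), ENNReal.toReal_add (hμ' A) (by simp),
      ENNReal.toReal_ofReal ε.coe_nonneg] at key'
    rw [← ENNReal.ofReal_toReal hμ, ← ENNReal.ofReal_coe_nnreal]
    rw [← ENNReal.toReal_le_toReal (by simp) (by simp), ENNReal.toReal_ofReal ENNReal.toReal_nonneg,
      ENNReal.toReal_add (by simp) (by simp), ENNReal.toReal_ofReal ε.coe_nonneg,
      ENNReal.toReal_ofReal']
    simp only [Measure.real]
    have := le_max_left ((μ (A ∩ B)).toReal - (ν (A ∩ B)).toReal) 0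
    linarith
  · refine iSup₂_le fun A _ => ?_
    calc ENNReal.ofReal (μ.real (A ∩ B) - ν.real (A ∩ B)) ≤ ENNReal.ofReal (μ.real (A ∩ B)) :=
          ENNReal.ofReal_le_ofReal (sub_le_self _ measureReal_nonneg)
      _ = μ (A ∩ B) := ofReal_measureReal (hμ' A)
      _ ≤ μ B := measure_mono Set.inter_subset_right

/-! ### The four parts of a locally finite complex measure -/

/-- The coefficients `1, -1, i, -i` of the four parts of a complex measure. -/
def unitCoeff : Fin 4 → ℂ := ![1, -1, Complex.I, -Complex.I]

theorem norm_unitCoeff (j : Fin 4) : ‖unitCoeff j‖ = 1 := by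
  fin_cases j <;> simp [unitCoeff]

namespace LocComplexMeasure

variable {d : ℕ}

/-- The four parts of a complex measure. -/
def part (μ : LocComplexMeasure d) : Fin 4 → Measure (Rd d) :=
  ![μ.rePos, μ.reNeg, μ.imPos, μ.imNeg]

instance (μ : LocComplexMeasure d) (j : Fin 4) : IsLocallyFiniteMeasure (μ.part j) := by
  fin_cases j
  exacts [μ.locFinite_rePos, μ.locFinite_reNeg, μ.locFinite_imPos, μ.locFinite_imNeg]

theorem eval_eq_sum (μ : LocComplexMeasure d) (B : Set (Rd d)) :
    μ.eval B = ∑ j, unitCoeff j * ((μ.part j).real B : ℂ) := by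
  simp [eval, Fin.sum_univ_four, unitCoeff, part]
  ring

theorem integral_eq_sum (μ : LocComplexMeasure d) (f : Rd d → ℂ) :
    μ.integral f = ∑ j, unitCoeff j * ∫ x, f x ∂(μ.part j) := by
  simp [integral, Fin.sum_univ_four, unitCoeff, part]
  ring

/-- The sum of the four parts, a measure comparable to the total variation. -/
def total (μ : LocComplexMeasure d) : Measure (Rd d) := ∑ j, μ.part j

theorem part_le_total (μ : LocComplexMeasure d) (j : Fin 4) : μ.part j ≤ μ.total := by
  refine Measure.le_iff.2 fun s _ => ?_
  rw [total, Measure.finsetSum_apply]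
  exact Finset.single_le_sum (f := fun j => μ.part j s) (fun _ _ => zero_le) (Finset.mem_univ j)

/-- Multiplying by the conjugate coefficient rotates the `j`-th part into the positive part of a
real Jordan decomposition, and singularity makes that part recoverable from evaluations. A countable
`𝒜` serves measurability, the algebra of all Borel sets serves domination. -/
theorem part_apply_eq_iSup (μ : LocComplexMeasure d) (j : Fin 4) {𝒜 : Set (Set (Rd d))}
    (h𝒜 : IsSetAlgebra 𝒜)
    (hgen : (inferInstance : MeasurableSpace (Rd d)) = MeasurableSpace.generateFrom 𝒜)
    {B : Set (Rd d)} (hb : Bornology.IsBounded B) :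
    μ.part j B = ⨆ A ∈ 𝒜, ENNReal.ofReal (conj (unitCoeff j) * μ.eval (A ∩ B)).re := by
  have := μ.locFinite_rePos
  have := μ.locFinite_reNeg
  have := μ.locFinite_imPos
  have := μ.locFinite_imNeg
  fin_cases j
  · refine (measure_eq_iSup_ofReal_sub μ.singular_re h𝒜 hgen hb).trans ?_
    simp [unitCoeff, eval]
  · refine (measure_eq_iSup_ofReal_sub μ.singular_re.symm h𝒜 hgen hb).trans ?_
    simp [unitCoeff, eval]
  · refine (measure_eq_iSup_ofReal_sub μ.singular_im h𝒜 hgen hb).trans ?_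
    simp [unitCoeff, eval]
  · refine (measure_eq_iSup_ofReal_sub μ.singular_im.symm h𝒜 hgen hb).trans ?_
    simp [unitCoeff, eval]

theorem isSetAlgebra_measurableSet {α : Type*} [MeasurableSpace α] :
    IsSetAlgebra {s : Set α | MeasurableSet s} where
  empty_mem := MeasurableSet.empty
  compl_mem := fun _ h => MeasurableSet.compl h
  union_mem := fun _ _ h h' => MeasurableSet.union h h'

theorem part_apply_eq_iSup_measurableSet (μ : LocComplexMeasure d) (j : Fin 4)
    {B : Set (Rd d)} (hb : Bornology.IsBounded B) :
    μ.part j B = ⨆ (A) (_ : MeasurableSet A),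
      ENNReal.ofReal (conj (unitCoeff j) * μ.eval (A ∩ B)).re :=
  μ.part_apply_eq_iSup j isSetAlgebra_measurableSet
    (MeasurableSpace.generateFrom_measurableSet).symm hb

theorem measurable_eval {B : Set (Rd d)} (hB : MeasurableSet B) (hb : Bornology.IsBounded B) :
    Measurable fun μ : LocComplexMeasure d => μ.eval B := by
  refine measurable_iff_comap_le.2 ?_
  exact le_iSup_of_le B (le_iSup_of_le hB (le_iSup_of_le hb le_rfl))

/-- The σ-field only knows evaluations. On a bounded set a part is a supremum of evaluations over a
countable algebra generating the Borel sets, and general sets are exhausted by bounded ones. -/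
theorem measurable_part (j : Fin 4) : Measurable fun μ : LocComplexMeasure d => μ.part j := by
  refine Measure.measurable_of_measurable_coe _ fun B hB => ?_
  simp_rw [fun μ : LocComplexMeasure d => measure_eq_iSup_inter_ball (μ.part j) B]
  refine Measurable.iSup fun n => ?_
  have hBn : MeasurableSet (B ∩ Metric.ball 0 n) := hB.inter Metric.isOpen_ball.measurableSet
  have hbn : Bornology.IsBounded (B ∩ Metric.ball 0 n) :=
    Metric.isBounded_ball.subset Set.inter_subset_right
  set 𝒜 := generateSetAlgebra (MeasurableSpace.countableGeneratingSet (Rd d)) with h𝒜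
  have hgen : (inferInstance : MeasurableSpace (Rd d)) = MeasurableSpace.generateFrom 𝒜 := by
    rw [h𝒜, generateFrom_generateSetAlgebra_eq,
      MeasurableSpace.generateFrom_countableGeneratingSet]
  have hc : 𝒜.Countable :=
    countable_generateSetAlgebra (MeasurableSpace.countable_countableGeneratingSet)
  simp_rw [fun μ : LocComplexMeasure d =>
    μ.part_apply_eq_iSup j isSetAlgebra_generateSetAlgebra hgen hbn]
  refine Measurable.biSup _ hc fun A hA => ?_
  have hAm : MeasurableSet A := by
    have := MeasurableSpace.measurableSet_generateFrom hA
    rwa [← hgen] at this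
  exact ENNReal.measurable_ofReal.comp (Complex.measurable_re.comp
    ((measurable_eval (hAm.inter hBn) (hbn.subset Set.inter_subset_right)).const_mul _))

theorem measurable_total : Measurable fun μ : LocComplexMeasure d => μ.total := by
  refine Measure.measurable_of_measurable_coe _ fun B hB => ?_
  simp only [total, Measure.finsetSum_apply]
  exact Finset.measurable_sum _ fun j _ => (Measure.measurable_coe hB).comp (measurable_part j)

theorem enorm_eval_le_total (μ : LocComplexMeasure d) {B : Set (Rd d)}
    (hb : Bornology.IsBounded B) : ‖μ.eval B‖ₑ ≤ μ.total B := by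
  rw [eval_eq_sum, total, Measure.finsetSum_apply]
  refine (enorm_sum_le _ _).trans (Finset.sum_le_sum fun j _ => ?_)
  have : μ.part j B ≠ ∞ := hb.measure_lt_top.ne
  rw [enorm_mul, ← ofReal_norm, norm_unitCoeff, ENNReal.ofReal_one, one_mul, ← ofReal_norm,
    Complex.norm_real, Real.norm_of_nonneg measureReal_nonneg, ofReal_measureReal this]

theorem variation_le_total (μ : LocComplexMeasure d) : μ.variation ≤ μ.total :=
  sInf_le fun _ _ hb => μ.enorm_eval_le_total hb

/-- A measure dominating the norms of all evaluations dominates the supremum formula for each part.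
With `variation_le_total` this makes `total` and `variation` comparable, so the infimum defining the
latter never has to be computed. -/
theorem part_le_variation (μ : LocComplexMeasure d) (j : Fin 4) : μ.part j ≤ μ.variation := by
  refine le_sInf fun ν hν => measure_le_of_isBounded fun B hB hb => ?_
  rw [μ.part_apply_eq_iSup_measurableSet j hb]
  refine iSup₂_le fun A hA => ?_
  refine le_trans ?_ ((hν _ (hA.inter hB) (hb.subset Set.inter_subset_right)).trans
    (measure_mono Set.inter_subset_right))
  rw [← ofReal_norm]
  refine ENNReal.ofReal_le_ofReal ((Complex.re_le_norm _).trans ?_)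
  rw [norm_mul, RCLike.norm_conj, norm_unitCoeff, one_mul]

theorem total_apply_le (μ : LocComplexMeasure d) (B : Set (Rd d)) :
    μ.total B ≤ 4 * μ.variation B := by
  rw [total, Measure.finsetSum_apply]
  calc ∑ j, μ.part j B ≤ ∑ _j : Fin 4, μ.variation B :=
        Finset.sum_le_sum fun j _ => μ.part_le_variation j B
    _ = 4 * μ.variation B := by simp

/-- A translation relation between evaluations carries over to the parts. -/
theorem part_le_of_eval_translate {μ μ' : LocComplexMeasure d} (x : Rd d)
    (h : ∀ B : Set (Rd d), MeasurableSet B → Bornology.IsBounded B →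
      μ'.eval ((fun y => x + y) '' B) = μ.eval B) (j : Fin 4) :
    μ'.part j ≤ (μ.part j).map (x + ·) := by
  refine measure_le_of_isBounded fun B hB hb => ?_
  have hm : Measurable (fun y : Rd d => x + y) := measurable_const_add x
  have hpre : ∀ C : Set (Rd d), Bornology.IsBounded C →
      Bornology.IsBounded ((fun y : Rd d => x + y) ⁻¹' C) := fun C hC => by
    rw [show (fun y : Rd d => x + y) ⁻¹' C = (fun y => -x + y) '' C from
      (Set.image_add_left (a := -x) (t := C) ▸ by simp)]
    simpa using (Bornology.isBounded_singleton (x := -x)).add hC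
  rw [Measure.map_apply hm hB, μ'.part_apply_eq_iSup_measurableSet j hb,
    μ.part_apply_eq_iSup_measurableSet j (hpre B hb)]
  refine iSup₂_le fun A hA => le_iSup₂_of_le ((fun y => x + y) ⁻¹' A) (hm hA) ?_
  rw [← Set.preimage_inter, ← h _ (hm (hA.inter hB)) (hpre _ (hb.subset Set.inter_subset_right)),
    Set.image_preimage_eq _ (add_left_surjective x)]

end LocComplexMeasure

section

/-! ### Random complex measures as kernels -/

open ProbabilityTheory

/-- A kernel of locally finite measures is s-finite. -/
theorem isSFiniteKernel_of_isLocallyFiniteMeasure {d : ℕ} {Ω : Type*} [MeasurableSpace Ω]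
    (κ : Kernel Ω (Rd d)) (h : ∀ ω, IsLocallyFiniteMeasure (κ ω)) : IsSFiniteKernel κ := by
  -- Space is cut into bounded shells, and then, for each shell, `Ω` into the level sets of the
  -- integer part of the mass of that shell. On each piece the kernel is bounded by `k + 1`.
  set A : ℕ → Set (Rd d) := disjointed fun n : ℕ => Metric.ball (0 : Rd d) n with hA
  have hAm : ∀ n, MeasurableSet (A n) :=
    MeasurableSet.disjointed fun n => Metric.isOpen_ball.measurableSet
  have hAd : Pairwise (Function.onFun Disjoint A) := disjoint_disjointed _
  have hAU : ⋃ n, A n = Set.univ := by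
    rw [hA, iUnion_disjointed, Metric.iUnion_ball_nat]
  have hAf : ∀ n ω, κ ω (A n) < ∞ := fun n ω =>
    (Metric.isBounded_ball.subset (disjointed_subset _ n)).measure_lt_top
  have h1 : κ = Kernel.sum fun n => κ.restrict (hAm n) := by
    ext ω s hs
    rw [Kernel.sum_apply' _ _ hs]
    simp_rw [Kernel.restrict_apply' _ (hAm _) _ hs]
    rw [← measure_iUnion (fun i j hij => (hAd hij).mono Set.inter_subset_right
      Set.inter_subset_right) fun n => hs.inter (hAm n), ← Set.inter_iUnion, hAU, Set.inter_univ]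
  rw [h1]
  refine @Kernel.isSFiniteKernel_sum _ _ _ _ _ _ _ fun n => ?_
  set S : ℕ → Set Ω := fun k => {ω | ⌊(κ ω (A n)).toReal⌋₊ = k} with hS
  have hSm : ∀ k, MeasurableSet (S k) := fun k =>
    (Nat.measurable_floor.comp (Kernel.measurable_coe κ (hAm n)).ennreal_toReal)
      (measurableSet_singleton k)
  classical
  have h2 : κ.restrict (hAm n) =
      Kernel.sum fun k => Kernel.piecewise (hSm k) (κ.restrict (hAm n)) 0 := by
    ext ω s hs
    rw [Kernel.sum_apply' _ _ hs, tsum_eq_single ⌊(κ ω (A n)).toReal⌋₊]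
    · rw [Kernel.piecewise_apply, if_pos (by simp [hS])]
    · intro k hk
      rw [Kernel.piecewise_apply, if_neg (by simpa [hS] using hk.symm)]
      simp
  rw [h2]
  refine @Kernel.isSFiniteKernel_sum _ _ _ _ _ _ _ fun k => ?_
  have : IsFiniteKernel (Kernel.piecewise (hSm k) (κ.restrict (hAm n)) 0) := by
    refine ⟨⟨ENNReal.ofReal (k + 1), ENNReal.ofReal_lt_top, fun ω => ?_⟩⟩
    rw [Kernel.piecewise_apply]
    split_ifs with hω
    · rw [Kernel.restrict_apply, Measure.restrict_apply_univ,
        ← ENNReal.ofReal_toReal (hAf n ω).ne]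
      refine ENNReal.ofReal_le_ofReal ?_
      rw [← show ⌊(κ ω (A n)).toReal⌋₊ = k from hω]
      exact (Nat.lt_floor_add_one _).le
    · simp
  infer_instance

namespace LocComplexMeasure

variable {d : ℕ} {Ω : Type*} [MeasurableSpace Ω] {Φ : Ω → LocComplexMeasure d}

/-- The parts of a random complex measure, as kernels. -/
def partKernel (hΦ : Measurable Φ) (j : Fin 4) : Kernel Ω (Rd d) :=
  ⟨fun ω => (Φ ω).part j, (measurable_part j).comp hΦ⟩

theorem partKernel_apply (hΦ : Measurable Φ) (j : Fin 4) (ω : Ω) :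
    partKernel hΦ j ω = (Φ ω).part j := rfl

instance (hΦ : Measurable Φ) (j : Fin 4) : IsSFiniteKernel (partKernel hΦ j) :=
  isSFiniteKernel_of_isLocallyFiniteMeasure _ fun ω => by
    rw [partKernel_apply]; infer_instance

end LocComplexMeasure

open LocComplexMeasure

/-! ### Invariance of the parts and second moments on bounded sets -/

section Invariance

variable {d : ℕ} {Ω : Type*} [AddAction (Rd d) Ω] {Φ : Ω → LocComplexMeasure d}

/-- Evaluations determine the parts, so invariance passes to each of them: one inequality comes from
translating by `x`, the other from translating back by `-x`. -/
theorem IsInvariantRCM.part_vadd (hinv : IsInvariantRCM Φ) (x : Rd d) (ω : Ω) (j : Fin 4) :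
    (Φ (x +ᵥ ω)).part j = ((Φ ω).part j).map (x + ·) := by
  refine le_antisymm (part_le_of_eval_translate x (hinv x ω) j) ?_
  have h := part_le_of_eval_translate (-x) (hinv (-x) (x +ᵥ ω)) j
  rw [neg_vadd_vadd] at h
  have hx : Measurable fun y : Rd d => x + y := measurable_const_add x
  have hx' : Measurable fun y : Rd d => -x + y := measurable_const_add (-x)
  calc ((Φ ω).part j).map (x + ·)
      ≤ (((Φ (x +ᵥ ω)).part j).map (-x + ·)).map (x + ·) := Measure.map_mono h hx
    _ = (Φ (x +ᵥ ω)).part j := by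
        rw [Measure.map_map hx hx']
        have : (fun y : Rd d => x + y) ∘ (fun y => -x + y) = id := by ext1 y; simp
        rw [this, Measure.map_id]

theorem IsInvariantRCM.total_vadd (hinv : IsInvariantRCM Φ) (x : Rd d) (ω : Ω) :
    (Φ (x +ᵥ ω)).total = ((Φ ω).total).map (x + ·) := by
  have hx : Measurable fun y : Rd d => x + y := measurable_const_add x
  ext s hs
  rw [Measure.map_apply hx hs, total, total, Measure.finsetSum_apply, Measure.finsetSum_apply]
  refine Finset.sum_congr rfl fun j _ => ?_
  rw [hinv.part_vadd, Measure.map_apply hx hs]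

/-- Invariance moves the moment bound from `B_1` to every unit ball, and a bounded set is covered by
finitely many of those. -/
theorem lintegral_total_sq_lt_top [MeasurableSpace Ω] {P : Measure Ω} [MeasurableConstVAdd (Rd d) Ω] [VAddInvariantMeasure (Rd d) Ω P]
    (hΦ : Measurable Φ) (hinv : IsInvariantRCM Φ)
    (hsq : IsLocallySquareIntegrable P Φ) {K : Set (Rd d)} (hK : Bornology.IsBounded K) :
    ∫⁻ ω, (Φ ω).total K ^ 2 ∂P < ∞ := by
  have hT : ∀ x : Rd d, Measurable fun ω => (Φ ω).total (Metric.ball x 1) := fun x =>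
    (Measure.measurable_coe Metric.isOpen_ball.measurableSet).comp (measurable_total.comp hΦ)
  have hball : ∀ x : Rd d, ∫⁻ ω, (Φ ω).total (Metric.ball x 1) ^ 2 ∂P < ∞ := by
    intro x
    have h0 : ∫⁻ ω, (Φ ω).total (Metric.ball 0 1) ^ 2 ∂P < ∞ := by
      calc ∫⁻ ω, (Φ ω).total (Metric.ball 0 1) ^ 2 ∂P
          ≤ ∫⁻ ω, 16 * (Φ ω).variation (Metric.ball 0 1) ^ 2 ∂P := by
            refine lintegral_mono fun ω => ?_
            calc (Φ ω).total (Metric.ball 0 1) ^ 2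
                ≤ (4 * (Φ ω).variation (Metric.ball 0 1)) ^ 2 := by
                  gcongr; exact total_apply_le _ _
              _ = _ := by ring
        _ = 16 * ∫⁻ ω, (Φ ω).variation (Metric.ball 0 1) ^ 2 ∂P :=
            lintegral_const_mul' _ _ (by simp)
        _ < ∞ := ENNReal.mul_lt_top (by simp) hsq
    have hmp : MeasurePreserving (fun ω : Ω => x +ᵥ ω) P P := measurePreserving_vadd x P
    rw [← hmp.lintegral_comp ((hT x).pow_const 2)]
    convert h0 using 4 with ω
    rw [hinv.total_vadd, Measure.map_apply (measurable_const_add x)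
      Metric.isOpen_ball.measurableSet]
    congr 1
    ext y
    simp [Metric.mem_ball, dist_eq_norm]
  obtain ⟨t, ht, hKt⟩ := Metric.totallyBounded_iff.1
    (hK.isCompact_closure.totallyBounded.subset subset_closure) 1 one_pos
  lift t to Finset (Rd d) using ht
  have hfin : ∀ t : Finset (Rd d), ∫⁻ ω, (∑ y ∈ t, (Φ ω).total (Metric.ball y 1)) ^ 2 ∂P < ∞ := by
    classical
    intro t
    induction t using Finset.induction_on with
    | empty => simp
    | insert a s ha ih =>
      -- A crude constant: the sum is at most twice the larger term.
      have hsq4 : ∀ u v : ℝ≥0∞, (u + v) ^ 2 ≤ 4 * (u ^ 2 + v ^ 2) := fun u v => by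
        rcases le_total u v with h | h
        · calc (u + v) ^ 2 ≤ (v + v) ^ 2 := by gcongr
            _ = 4 * v ^ 2 := by ring
            _ ≤ _ := by gcongr; exact le_add_self
        · calc (u + v) ^ 2 ≤ (u + u) ^ 2 := by gcongr
            _ = 4 * u ^ 2 := by ring
            _ ≤ _ := by gcongr; exact le_self_add
      simp_rw [Finset.sum_insert ha]
      refine (lintegral_mono fun ω => hsq4 _ _).trans_lt ?_
      rw [lintegral_const_mul' _ _ (by simp), lintegral_add_left ((hT a).pow_const 2)]
      exact ENNReal.mul_lt_top (by simp) (ENNReal.add_lt_top.2 ⟨hball a, ih⟩)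
  refine (lintegral_mono fun ω => ?_).trans_lt (hfin t)
  gcongr
  exact (measure_mono hKt).trans (measure_biUnion_finset_le _ _)

end Invariance

end

section

/-! ### Moment measures -/

open ProbabilityTheory LocComplexMeasure

theorem unitCube_eq_preimage (d : ℕ) :
    unitCube d = (MeasurableEquiv.toLp 2 (Fin d → ℝ)).symm ⁻¹'
      (Set.univ.pi fun _ => Set.Ico 0 1) := by
  ext x
  simp [unitCube, Set.mem_pi]

theorem measurableSet_unitCube (d : ℕ) : MeasurableSet (unitCube d) := by
  rw [unitCube_eq_preimage]
  exact (MeasurableEquiv.measurable _)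
    (MeasurableSet.pi Set.countable_univ fun _ _ => measurableSet_Ico)

theorem volume_unitCube (d : ℕ) : (volume : Measure (Rd d)) (unitCube d) = 1 := by
  rw [unitCube_eq_preimage,
    (EuclideanSpace.volume_preserving_symm_measurableEquiv_toLp (Fin d)).measure_preimage_equiv,
    Real.volume_pi_Ico]
  simp

theorem isBounded_unitCube (d : ℕ) : Bornology.IsBounded (unitCube d) := by
  refine isBounded_iff_forall_norm_le.2 ⟨√d, fun x hx => ?_⟩
  rw [EuclideanSpace.norm_eq]
  refine Real.sqrt_le_sqrt ?_
  calc ∑ i, ‖x i‖ ^ 2 ≤ ∑ _i : Fin d, (1 : ℝ) := by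
        refine Finset.sum_le_sum fun i _ => ?_
        rw [Real.norm_eq_abs, sq_abs]
        have := hx i
        nlinarith
    _ = d := by simp

/-- A translation invariant locally finite measure is a multiple of Lebesgue measure. -/
theorem eq_smul_volume_of_map_add {d : ℕ} (ν : Measure (Rd d)) [IsFiniteMeasureOnCompacts ν]
    (h : ∀ v : Rd d, ν.map (v + ·) = ν) : ν = ν (unitCube d) • volume := by
  have hl : ν.IsAddLeftInvariant := ⟨h⟩
  have hs := Measure.isAddLeftInvariant_eq_smul ν (volume : Measure (Rd d))
  have hc : ν (unitCube d) = (ν.addHaarScalarFactor (volume : Measure (Rd d)) : ℝ≥0∞) := by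
    conv_lhs => rw [hs]
    rw [Measure.smul_apply, volume_unitCube, ENNReal.smul_def, smul_eq_mul, mul_one]
  rw [hc]
  exact hs

section Moments

variable {d : ℕ} {Ω : Type*} [MeasurableSpace Ω] {Φ : Ω → LocComplexMeasure d}

/-- The first moment measure of a part. -/
def firstMoment (P : Measure Ω) (hΦ : Measurable Φ) (j : Fin 4) : Measure (Rd d) :=
  P.bind (partKernel hΦ j)

/-- The second moment measure of a pair of parts. -/
def secondMoment (P : Measure Ω) (hΦ : Measurable Φ) (j k : Fin 4) : Measure (Rd d × Rd d) :=
  P.bind (partKernel hΦ j ×ₖ partKernel hΦ k)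

/-- The reduced second moment measure of a pair of parts. -/
def reducedMoment (P : Measure Ω) (hΦ : Measurable Φ) (j k : Fin 4) : Measure (Rd d) :=
  ((secondMoment P hΦ j k).restrict (unitCube d ×ˢ Set.univ)).map fun z => z.1 - z.2

theorem firstMoment_apply (P : Measure Ω) (hΦ : Measurable Φ) (j : Fin 4) {s : Set (Rd d)}
    (hs : MeasurableSet s) : firstMoment P hΦ j s = ∫⁻ ω, (Φ ω).part j s ∂P := by
  rw [firstMoment, Measure.bind_apply hs (Kernel.aemeasurable _)]
  rfl

theorem secondMoment_apply (P : Measure Ω) (hΦ : Measurable Φ) (j k : Fin 4)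
    {s : Set (Rd d × Rd d)} (hs : MeasurableSet s) :
    secondMoment P hΦ j k s = ∫⁻ ω, ((Φ ω).part j).prod ((Φ ω).part k) s ∂P := by
  rw [secondMoment, Measure.bind_apply hs (Kernel.aemeasurable _)]
  simp_rw [Kernel.prod_apply, partKernel_apply]

theorem reducedMoment_apply (P : Measure Ω) (hΦ : Measurable Φ) (j k : Fin 4) {s : Set (Rd d)}
    (hs : MeasurableSet s) : reducedMoment P hΦ j k s =
      secondMoment P hΦ j k ((fun z => z.1 - z.2) ⁻¹' s ∩ unitCube d ×ˢ Set.univ) := by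
  have hm : Measurable fun z : Rd d × Rd d => z.1 - z.2 := measurable_fst.sub measurable_snd
  rw [reducedMoment, Measure.map_apply hm hs, Measure.restrict_apply (hm hs)]

variable {P : Measure Ω} [AddAction (Rd d) Ω]
  [MeasurableConstVAdd (Rd d) Ω] [VAddInvariantMeasure (Rd d) Ω P]

theorem secondMoment_prod_lt_top (hΦ : Measurable Φ) (hinv : IsInvariantRCM Φ)
    (hsq : IsLocallySquareIntegrable P Φ) (j k : Fin 4) {s : Set (Rd d × Rd d)}
    (hs : Bornology.IsBounded s) : secondMoment P hΦ j k s < ∞ := by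
  obtain ⟨R, hR⟩ := hs.subset_ball (0 : Rd d × Rd d)
  set K : Set (Rd d) := Metric.ball 0 R with hK
  have hKm : MeasurableSet K := Metric.isOpen_ball.measurableSet
  have hsub : s ⊆ K ×ˢ K := by
    refine hR.trans ?_
    rw [show (0 : Rd d × Rd d) = (0, 0) from rfl, ← ball_prod_same]
  refine (measure_mono hsub).trans_lt ?_
  rw [secondMoment_apply P hΦ j k (hKm.prod hKm)]
  refine (lintegral_mono fun ω => ?_).trans_lt
    (lintegral_total_sq_lt_top hΦ hinv hsq (K := K) Metric.isBounded_ball)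
  rw [Measure.prod_prod, sq]
  exact mul_le_mul' (part_le_total _ j K) (part_le_total _ k K)

/-- A diagonal shift of the pair amounts to acting on `Ω`, which preserves `P`. -/
theorem secondMoment_map_add (hΦ : Measurable Φ) (hinv : IsInvariantRCM Φ) (j k : Fin 4)
    (v : Rd d) : (secondMoment P hΦ j k).map (Prod.map (v + ·) (v + ·)) =
      secondMoment P hΦ j k := by
  have hv : Measurable fun y : Rd d => v + y := measurable_const_add v
  ext s hs
  rw [Measure.map_apply (hv.prodMap hv) hs, secondMoment_apply P hΦ j k hs,
    secondMoment_apply P hΦ j k ((hv.prodMap hv) hs)]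
  have hmeas : Measurable fun ω => ((Φ ω).part j).prod ((Φ ω).part k) s := by
    simpa only [Kernel.prod_apply, partKernel_apply] using
      Kernel.measurable_coe (partKernel hΦ j ×ₖ partKernel hΦ k) hs
  rw [← (measurePreserving_vadd v P).lintegral_comp hmeas]
  refine lintegral_congr fun ω => ?_
  rw [hinv.part_vadd, hinv.part_vadd, Measure.map_prod_map _ _ hv hv,
    Measure.map_apply (hv.prodMap hv) hs]

variable [IsProbabilityMeasure P]

theorem firstMoment_lt_top (hΦ : Measurable Φ) (hinv : IsInvariantRCM Φ)
    (hsq : IsLocallySquareIntegrable P Φ) (j : Fin 4) {s : Set (Rd d)}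
    (hs : Bornology.IsBounded s) : firstMoment P hΦ j s < ∞ := by
  obtain ⟨R, hR⟩ := hs.subset_ball (0 : Rd d)
  refine (measure_mono hR).trans_lt ?_
  rw [firstMoment_apply P hΦ j Metric.isOpen_ball.measurableSet]
  refine (lintegral_mono (g := fun ω => 1 + (Φ ω).total (Metric.ball 0 R) ^ 2) fun ω => ?_).trans_lt
    ?_
  · refine (part_le_total _ j _).trans ?_
    rcases le_total ((Φ ω).total (Metric.ball 0 R)) 1 with h | h
    · exact h.trans le_self_add
    · exact (le_self_pow₀ h two_ne_zero).trans le_add_self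
  · rw [lintegral_add_left measurable_const]
    exact ENNReal.add_lt_top.2 ⟨by simp,
      lintegral_total_sq_lt_top hΦ hinv hsq Metric.isBounded_ball⟩

theorem firstMoment_eq_smul (hΦ : Measurable Φ) (hinv : IsInvariantRCM Φ)
    (hsq : IsLocallySquareIntegrable P Φ) (j : Fin 4) :
    firstMoment P hΦ j = firstMoment P hΦ j (unitCube d) • volume := by
  have : IsFiniteMeasureOnCompacts (firstMoment P hΦ j) :=
    ⟨fun K hK => firstMoment_lt_top hΦ hinv hsq j hK.isBounded⟩
  refine eq_smul_volume_of_map_add _ fun v => ?_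
  have hv : Measurable fun y : Rd d => v + y := measurable_const_add v
  ext s hs
  rw [Measure.map_apply hv hs, firstMoment_apply P hΦ j hs, firstMoment_apply P hΦ j (hv hs)]
  rw [← (measurePreserving_vadd v P).lintegral_comp
    (f := fun ω => (Φ ω).part j s) ((Measure.measurable_coe hs).comp ((measurable_part j).comp hΦ))]
  refine lintegral_congr fun ω => ?_
  rw [hinv.part_vadd, Measure.map_apply hv hs]

theorem reducedMoment_lt_top (hΦ : Measurable Φ) (hinv : IsInvariantRCM Φ)
    (hsq : IsLocallySquareIntegrable P Φ) (j k : Fin 4) {s : Set (Rd d)}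
    (hs : Bornology.IsBounded s) : reducedMoment P hΦ j k s < ∞ := by
  obtain ⟨R, hR⟩ := hs.subset_ball (0 : Rd d)
  refine (measure_mono hR).trans_lt ?_
  rw [reducedMoment_apply P hΦ j k Metric.isOpen_ball.measurableSet]
  refine secondMoment_prod_lt_top hΦ hinv hsq j k ?_
  refine ((isBounded_unitCube d).prod
    ((isBounded_unitCube d).sub (Metric.isBounded_ball (x := (0 : Rd d)) (r := R)))).subset ?_
  rintro ⟨x, y⟩ ⟨hxy, hx, -⟩
  exact ⟨hx, Set.mem_sub.2 ⟨x, hx, x - y, hxy, by simp⟩⟩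

/-- The second moment measure disintegrates into Lebesgue measure and the reduced second moment
measure. -/
theorem secondMoment_map_sub (hΦ : Measurable Φ) (hinv : IsInvariantRCM Φ)
    (hsq : IsLocallySquareIntegrable P Φ) (j k : Fin 4) :
    (secondMoment P hΦ j k).map (fun z => (z.1, z.1 - z.2)) =
      (volume : Measure (Rd d)).prod (reducedMoment P hΦ j k) := by
  have hlf : IsLocallyFiniteMeasure (reducedMoment P hΦ j k) :=
    ⟨fun x => ⟨Metric.ball x 1, Metric.ball_mem_nhds x one_pos,
      reducedMoment_lt_top hΦ hinv hsq j k Metric.isBounded_ball⟩⟩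
  have hT : Measurable fun z : Rd d × Rd d => (z.1, z.1 - z.2) :=
    measurable_fst.prodMk (measurable_fst.sub measurable_snd)
  symm
  -- For fixed bounded `B` the mass of `A ×ˢ B`, as a function of `A`, is translation invariant,
  -- because a diagonal shift moves the first coordinate and keeps the difference. It is therefore a
  -- multiple of Lebesgue measure, and its value at the unit cube is the reduced moment of `B`.
  have hbdd : ∀ A B : Set (Rd d), MeasurableSet A → MeasurableSet B → Bornology.IsBounded B →
      (secondMoment P hΦ j k).map (fun z => (z.1, z.1 - z.2)) (A ×ˢ B) =
        volume A * reducedMoment P hΦ j k B := by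
    intro A B hA hB hb
    set N := (secondMoment P hΦ j k).map (fun z => (z.1, z.1 - z.2)) with hN
    set ν := (N.restrict (Set.univ ×ˢ B)).map Prod.fst with hν
    have hνa : ∀ C : Set (Rd d), MeasurableSet C → ν C = N (C ×ˢ B) := fun C hC => by
      rw [hν, Measure.map_apply measurable_fst hC, Measure.restrict_apply (measurable_fst hC)]
      congr 1
      ext z
      simp
    have hfin : IsFiniteMeasureOnCompacts ν := by
      refine ⟨fun K hK => ?_⟩
      rw [hνa K hK.measurableSet, hN, Measure.map_apply hT (hK.measurableSet.prod hB)]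
      refine secondMoment_prod_lt_top hΦ hinv hsq j k ?_
      refine (hK.isBounded.prod (hK.isBounded.sub hb)).subset ?_
      rintro ⟨x, y⟩ ⟨hx, hxy⟩
      exact ⟨hx, Set.mem_sub.2 ⟨x, hx, x - y, hxy, by simp⟩⟩
    have hs := eq_smul_volume_of_map_add ν fun v => by
      have hv : Measurable fun y : Rd d => v + y := measurable_const_add v
      ext C hC
      rw [Measure.map_apply hv hC, hνa _ (hv hC), hνa _ hC, hN,
        Measure.map_apply hT ((hv hC).prod hB), Measure.map_apply hT (hC.prod hB)]
      conv_rhs => rw [← secondMoment_map_add hΦ hinv j k v]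
      rw [Measure.map_apply (hv.prodMap hv) (hT (hC.prod hB))]
      congr 1
      ext z
      simp
    rw [← hνa A hA, hs, Measure.smul_apply, smul_eq_mul, mul_comm, hνa _ (measurableSet_unitCube d),
      hN, Measure.map_apply hT ((measurableSet_unitCube d).prod hB), reducedMoment_apply P hΦ j k hB]
    congr 2
    ext z
    simp [and_comm]
  refine Measure.prod_eq fun A B hA hB => ?_
  rw [measure_eq_iSup_inter_ball (reducedMoment P hΦ j k), ENNReal.mul_iSup]
  have hmono : Monotone fun n : ℕ => A ×ˢ (B ∩ Metric.ball 0 n) := fun m n h =>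
    Set.prod_mono_right (monotone_inter_ball_nat B h)
  rw [← iUnion_inter_ball_nat B, Set.prod_iUnion, hmono.measure_iUnion, iUnion_inter_ball_nat]
  exact iSup_congr fun n => hbdd A _ hA (hB.inter Metric.isOpen_ball.measurableSet)
    (Metric.isBounded_ball.subset Set.inter_subset_right)

end Moments

end

section

/-! ### Test functions and Fourier transforms -/

open scoped FourierTransform

section TestFunctions

variable {d : ℕ}

theorem IsTestFunction.exists_bound {f : Rd d → ℂ} (hf : IsTestFunction f) :
    ∃ C R : ℝ, 0 ≤ C ∧ 0 ≤ R ∧ (∀ x, ‖f x‖ ≤ C) ∧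
      ∀ x, x ∉ Metric.closedBall (0 : Rd d) R → f x = 0 := by
  obtain ⟨-, ⟨C, hC⟩, hs⟩ := hf
  obtain ⟨R, hR⟩ := hs.isCompact.isBounded.subset_closedBall (0 : Rd d)
  refine ⟨C, max R 0, (norm_nonneg _).trans (hC 0), le_max_right _ _, hC, fun x hx => ?_⟩
  by_contra h
  exact hx (Metric.closedBall_subset_closedBall (le_max_left _ _)
    (hR (subset_tsupport f (Function.mem_support.2 h))))

theorem isTestFunction_of_bound {f : Rd d → ℂ} (hm : Measurable f) {C R : ℝ}
    (hC : ∀ x, ‖f x‖ ≤ C) (hR : ∀ x, x ∉ Metric.closedBall (0 : Rd d) R → f x = 0) :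
    IsTestFunction f :=
  ⟨hm, ⟨C, hC⟩, HasCompactSupport.intro (isCompact_closedBall _ _) hR⟩

theorem integrable_of_bound {α : Type*} [MeasurableSpace α] {f : α → ℂ}
    (hm : Measurable f) {C : ℝ} (hC : ∀ x, ‖f x‖ ≤ C) {S : Set α} (hS : ∀ x, x ∉ S → f x = 0)
    {μ : Measure α} (hμ : μ S ≠ ∞) : Integrable f μ := by
  have : IntegrableOn f S μ :=
    Measure.integrableOn_of_bounded hμ hm.aestronglyMeasurable (ae_of_all _ hC)
  exact this.integrable_of_forall_notMem_eq_zero hS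

theorem IsTestFunction.integrable {f : Rd d → ℂ} (hf : IsTestFunction f) (μ : Measure (Rd d))
    [IsLocallyFiniteMeasure μ] : Integrable f μ := by
  obtain ⟨C, R, -, -, hC, hR⟩ := hf.exists_bound
  exact integrable_of_bound hf.1 hC hR Metric.isBounded_closedBall.measure_lt_top.ne

theorem isTestFunction_indicator {B : Set (Rd d)} (hB : MeasurableSet B)
    (hb : Bornology.IsBounded B) : IsTestFunction (B.indicator fun _ => (1 : ℂ)) := by
  obtain ⟨R, hR⟩ := hb.subset_closedBall (0 : Rd d)
  refine isTestFunction_of_bound (C := 1) (R := R) (measurable_const.indicator hB)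
    (fun x => ?_) fun x hx => Set.indicator_of_notMem (fun h => hx (hR h)) _
  refine (norm_indicator_le_norm_self _ _).trans (by simp)

theorem IsTestFunction.mul_bounded {f g : Rd d → ℂ} (hf : IsTestFunction f) (hg : Measurable g)
    {C : ℝ} (hC : ∀ x, ‖g x‖ ≤ C) : IsTestFunction fun x => g x * f x := by
  obtain ⟨D, R, hD0, -, hD, hR⟩ := hf.exists_bound
  refine isTestFunction_of_bound (C := C * D) (R := R) (hg.mul hf.1) (fun x => ?_) fun x hx => by
    rw [hR x hx, mul_zero]
  rw [norm_mul]
  exact mul_le_mul (hC x) (hD x) (norm_nonneg _) ((norm_nonneg _).trans (hC x))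

theorem measurable_tiltedConv {f g : Rd d → ℂ} (hf : Measurable f) (hg : Measurable g) :
    Measurable (tiltedConv f g) := by
  have h : Measurable fun p : Rd d × Rd d => f p.2 * conj (g (p.2 - p.1)) :=
    (hf.comp measurable_snd).mul (Complex.continuous_conj.measurable.comp
      (hg.comp (measurable_snd.sub measurable_fst)))
  exact (h.stronglyMeasurable.integral_prod_right').measurable

theorem norm_tiltedConv_le {f g : Rd d → ℂ} (hf : Integrable f) {C : ℝ} (hC : ∀ x, ‖g x‖ ≤ C)
    (y : Rd d) : ‖tiltedConv f g y‖ ≤ (∫ x, ‖f x‖) * C := by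
  rw [tiltedConv, ← integral_mul_const]
  refine norm_integral_le_of_norm_le (hf.norm.mul_const C) (ae_of_all _ fun x => ?_)
  rw [norm_mul, RCLike.norm_conj]
  exact mul_le_mul_of_nonneg_left (hC _) (norm_nonneg _)

theorem norm_tiltedConv_le' {f g : Rd d → ℂ} (hg : Integrable g) {C : ℝ} (hC : ∀ x, ‖f x‖ ≤ C)
    (y : Rd d) : ‖tiltedConv f g y‖ ≤ C * ∫ x, ‖g x‖ := by
  rw [tiltedConv, ← integral_sub_right_eq_self (fun x => ‖g x‖) y, ← integral_const_mul]
  refine norm_integral_le_of_norm_le ((hg.norm.comp_sub_right y).const_mul C)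
    (ae_of_all _ fun x => ?_)
  rw [norm_mul, RCLike.norm_conj]
  exact mul_le_mul_of_nonneg_right (hC _) (norm_nonneg _)

theorem tiltedConv_eq_zero {f g : Rd d → ℂ} {R R' : ℝ}
    (hf : ∀ x, x ∉ Metric.closedBall (0 : Rd d) R → f x = 0)
    (hg : ∀ x, x ∉ Metric.closedBall (0 : Rd d) R' → g x = 0) (y : Rd d)
    (hy : y ∉ Metric.closedBall (0 : Rd d) (R + R')) : tiltedConv f g y = 0 := by
  rw [tiltedConv]
  refine integral_eq_zero_of_ae (ae_of_all _ fun x => ?_)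
  by_cases hx : x ∈ Metric.closedBall (0 : Rd d) R
  · by_cases hx' : x - y ∈ Metric.closedBall (0 : Rd d) R'
    · refine absurd ?_ hy
      rw [mem_closedBall_zero_iff] at *
      calc ‖y‖ = ‖x - (x - y)‖ := by simp
        _ ≤ ‖x‖ + ‖x - y‖ := norm_sub_le _ _
        _ ≤ _ := add_le_add hx hx'
    · simp [hg _ hx']
  · simp [hf _ hx]

theorem IsTestFunction.tiltedConv {f g : Rd d → ℂ} (hf : IsTestFunction f)
    (hg : IsTestFunction g) : IsTestFunction (tiltedConv f g) := by
  obtain ⟨C, R, -, -, hC, hR⟩ := hf.exists_bound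
  obtain ⟨C', R', -, -, hC', hR'⟩ := hg.exists_bound
  exact isTestFunction_of_bound (measurable_tiltedConv hf.1 hg.1)
    (norm_tiltedConv_le (hf.integrable volume) hC') (tiltedConv_eq_zero hR hR')

theorem continuous_tiltedConv {f g : Rd d → ℂ} (hf : Integrable f) (hg : Continuous g) {C : ℝ}
    (hC : ∀ x, ‖g x‖ ≤ C) : Continuous (tiltedConv f g) := by
  refine continuous_of_dominated (bound := fun x => ‖f x‖ * C) (fun y => ?_)
    (fun y => ae_of_all _ fun x => ?_) (hf.norm.mul_const C) (ae_of_all _ fun x => ?_)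
  · exact hf.aestronglyMeasurable.mul (Complex.continuous_conj.comp
      (hg.comp (continuous_id.sub continuous_const))).aestronglyMeasurable
  · rw [norm_mul, RCLike.norm_conj]
    exact mul_le_mul_of_nonneg_left (hC _) (norm_nonneg _)
  · exact continuous_const.mul (Complex.continuous_conj.comp
      (hg.comp (continuous_const.sub continuous_id)))

theorem tiltedConv_eq_convolution (f g : Rd d → ℂ) :
    tiltedConv f g = convolution f (fun t => conj (g (-t))) (ContinuousLinearMap.mul ℂ ℂ) := by
  ext y
  simp [tiltedConv, convolution]

theorem integrable_tiltedConv {f g : Rd d → ℂ} (hf : Integrable f) (hg : Integrable g) :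
    Integrable (tiltedConv f g) := by
  rw [tiltedConv_eq_convolution]
  refine hf.integrable_convolution _ ?_
  exact (LinearIsometryEquiv.integrable_comp_iff (Complex.conjLIE)).2 hg.comp_neg

theorem integrable_norm_tiltedConv_le {f g : Rd d → ℂ} (hf : Integrable f) (hg : Integrable g) :
    ∫ y, ‖tiltedConv f g y‖ ≤ (∫ x, ‖f x‖) * ∫ x, ‖g x‖ := by
  have hg' : Integrable fun t => ‖g (-t)‖ := hg.comp_neg.norm
  calc ∫ y, ‖tiltedConv f g y‖ ≤ ∫ y, convolution (fun x => ‖f x‖) (fun t => ‖g (-t)‖)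
        (ContinuousLinearMap.mul ℝ ℝ) volume y := by
        refine integral_mono (integrable_tiltedConv hf hg).norm
          (hf.norm.integrable_convolution _ hg') fun y => ?_
        refine (norm_integral_le_integral_norm _).trans (le_of_eq ?_)
        simp [convolution]
    _ = _ := by
        rw [integral_convolution _ hf.norm hg']
        simp [integral_neg_eq_self (fun x => ‖g x‖)]

theorem fourier_eq_fourierHat (f : Rd d → ℂ) (ξ : Rd d) :
    𝓕 f ξ = fourierHat f ((2 * Real.pi) • ξ) := by
  rw [Real.fourier_eq', fourierHat]
  congr 1
  ext x
  rw [smul_eq_mul, real_inner_smul_left, real_inner_comm ξ x]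
  congr 2
  push_cast
  ring

theorem fourierHat_eq_fourier (f : Rd d → ℂ) (k : Rd d) :
    fourierHat f k = 𝓕 f ((2 * Real.pi)⁻¹ • k) := by
  rw [fourier_eq_fourierHat, smul_smul, mul_inv_cancel₀ (by positivity), one_smul]

theorem norm_exp_neg_I_mul (t : ℝ) : ‖Complex.exp (-(Complex.I * (t : ℂ)))‖ = 1 := by
  rw [Complex.norm_exp]
  simp

theorem norm_exp_I_mul (t : ℝ) : ‖Complex.exp (Complex.I * (t : ℂ))‖ = 1 := by
  rw [Complex.norm_exp]
  simp

theorem norm_fourierHat_le (f : Rd d → ℂ) (k : Rd d) : ‖fourierHat f k‖ ≤ ∫ x, ‖f x‖ := by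
  refine (norm_integral_le_integral_norm _).trans (le_of_eq ?_)
  simp only [norm_mul, norm_exp_neg_I_mul, one_mul]

theorem continuous_fourierHat {f : Rd d → ℂ} (hf : Integrable f) : Continuous (fourierHat f) := by
  refine continuous_of_dominated (bound := fun x => ‖f x‖) (fun k => ?_)
    (fun k => ae_of_all _ fun x => ?_) hf.norm (ae_of_all _ fun x => by fun_prop)
  · exact (by fun_prop : Continuous fun x : Rd d =>
      Complex.exp (-(Complex.I * ((inner ℝ k x : ℝ) : ℂ)))).aestronglyMeasurable.mul
      hf.aestronglyMeasurable
  · rw [norm_mul, norm_exp_neg_I_mul, one_mul]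

theorem integrable_exp_mul {f : Rd d → ℂ} (hf : Integrable f) (k : Rd d) :
    Integrable fun x => Complex.exp (-(Complex.I * ((inner ℝ k x : ℝ) : ℂ))) * f x := by
  refine hf.bdd_mul (c := 1) ?_ (ae_of_all _ fun x => (norm_exp_neg_I_mul _).le)
  exact (by fun_prop : Continuous fun x : Rd d =>
    Complex.exp (-(Complex.I * ((inner ℝ k x : ℝ) : ℂ)))).aestronglyMeasurable

theorem fourierHat_sub {f g : Rd d → ℂ} (hf : Integrable f) (hg : Integrable g) (k : Rd d) :
    fourierHat (fun x => f x - g x) k = fourierHat f k - fourierHat g k := by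
  simp only [fourierHat, mul_sub]
  exact integral_sub (integrable_exp_mul hf k) (integrable_exp_mul hg k)

theorem fourierHat_zero (f : Rd d → ℂ) : fourierHat f 0 = ∫ x, f x := by
  simp [fourierHat]

theorem fourierHat_conj_neg (g : Rd d → ℂ) (k : Rd d) :
    fourierHat (fun t => conj (g (-t))) k = conj (fourierHat g k) := by
  rw [fourierHat, fourierHat, ← integral_conj, ← integral_neg_eq_self]
  congr 1
  ext x
  rw [neg_neg, map_mul, ← Complex.exp_conj]
  simp

theorem fourierHat_tiltedConv {f g : Rd d → ℂ} (hf : Integrable f) (hg : Integrable g)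
    (k : Rd d) : fourierHat (tiltedConv f g) k = fourierHat f k * conj (fourierHat g k) := by
  have hg' : Integrable fun t => conj (g (-t)) :=
    (LinearIsometryEquiv.integrable_comp_iff (Complex.conjLIE)).2 hg.comp_neg
  rw [← fourierHat_conj_neg, tiltedConv_eq_convolution, fourierHat_eq_fourier,
    Real.fourier_mul_convolution_eq hf hg', ← fourierHat_eq_fourier, ← fourierHat_eq_fourier]

theorem integral_tiltedConv {f g : Rd d → ℂ} (hf : Integrable f) (hg : Integrable g) :
    ∫ y, tiltedConv f g y = (∫ x, f x) * conj (∫ x, g x) := by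
  rw [← fourierHat_zero, fourierHat_tiltedConv hf hg, fourierHat_zero, fourierHat_zero]

/-- Modulation shifts the Fourier transform. -/
theorem fourierHat_modulate (f : Rd d → ℂ) (k₀ k : Rd d) :
    fourierHat (fun x => Complex.exp (Complex.I * ((inner ℝ k₀ x : ℝ) : ℂ)) * f x) k =
      fourierHat f (k - k₀) := by
  rw [fourierHat, fourierHat]
  congr 1
  ext x
  rw [← mul_assoc, ← Complex.exp_add, inner_sub_left]
  congr 2
  push_cast
  ring

/-- The characters at `x` and, conjugated, at `x - y` combine to the character at `y`, which leaves
the integral. Hence a character times a tilted self-convolution is again a tilted self-convolution;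
this turns semidefiniteness into nonnegativity at every frequency. -/
theorem tiltedConv_modulate (f g : Rd d → ℂ) (k₀ y : Rd d) :
    tiltedConv (fun x => Complex.exp (Complex.I * ((inner ℝ k₀ x : ℝ) : ℂ)) * f x)
      (fun x => Complex.exp (Complex.I * ((inner ℝ k₀ x : ℝ) : ℂ)) * g x) y =
      Complex.exp (Complex.I * ((inner ℝ k₀ y : ℝ) : ℂ)) * tiltedConv f g y := by
  rw [tiltedConv, tiltedConv, ← integral_const_mul]
  congr 1
  ext x
  rw [map_mul, ← Complex.exp_conj]
  have : Complex.exp (Complex.I * ((inner ℝ k₀ x : ℝ) : ℂ)) *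
      Complex.exp (conj (Complex.I * ((inner ℝ k₀ (x - y) : ℝ) : ℂ))) =
      Complex.exp (Complex.I * ((inner ℝ k₀ y : ℝ) : ℂ)) := by
    rw [← Complex.exp_add, inner_sub_right]
    congr 1
    simp
    ring
  rw [← this]
  ring

theorem IsTestFunction.modulate {f : Rd d → ℂ} (hf : IsTestFunction f) (k₀ : Rd d) :
    IsTestFunction fun x => Complex.exp (Complex.I * ((inner ℝ k₀ x : ℝ) : ℂ)) * f x :=
  hf.mul_bounded (by fun_prop) (C := 1) fun _ => (norm_exp_I_mul _).le

theorem integral_spread (f : Rd d → ℂ) {r : ℝ} (hr : 0 < r) :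
    ∫ x, spread f r x = (r : ℂ) ^ d * ∫ x, f x := by
  simp only [spread]
  rw [Measure.integral_comp_inv_smul_of_nonneg _ _ hr.le]
  simp

theorem integrable_spread {f : Rd d → ℂ} (hf : Integrable f) {r : ℝ} (hr : 0 < r) :
    Integrable (spread f r) :=
  hf.comp_smul (inv_ne_zero hr.ne')

theorem fourierHat_spread (f : Rd d → ℂ) {r : ℝ} (hr : 0 < r) (k : Rd d) :
    fourierHat (spread f r) k = (r : ℂ) ^ d * fourierHat f (r • k) := by
  rw [fourierHat, fourierHat, ← integral_spread _ hr]
  congr 1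
  ext x
  simp only [spread]
  rw [real_inner_smul_left, real_inner_smul_right, ← mul_assoc, mul_inv_cancel₀ hr.ne', one_mul]

/-- Two complex combinations of locally finite measures that agree on bounded Borel sets have the
same integrals of test functions. -/
theorem sum_integral_eq_zero {ι : Type*} [Fintype ι] {a : ι → ℂ} {m : ι → Measure (Rd d)}
    (hm : ∀ i, IsLocallyFiniteMeasure (m i))
    (h : ∀ B, MeasurableSet B → Bornology.IsBounded B → ∑ i, a i * ((m i).real B : ℂ) = 0)
    {f : Rd d → ℂ} (hf : IsTestFunction f) : ∑ i, a i * ∫ x, f x ∂(m i) = 0 := by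
  obtain ⟨C, R, hC0, -, hC, hR⟩ := hf.exists_bound
  set K := Metric.closedBall (0 : Rd d) R with hK
  have hKm : MeasurableSet K := Metric.isClosed_closedBall.measurableSet
  have hsm : StronglyMeasurable f := hf.1.stronglyMeasurable
  have hfin : ∀ i, IsFiniteMeasure ((m i).restrict K) := fun i =>
    ⟨by rw [Measure.restrict_apply_univ]; exact Metric.isBounded_closedBall.measure_lt_top⟩
  -- The same bounded simple functions approximate `f` for all the measures at once. Their fibers
  -- intersected with `K` are bounded Borel sets, to which the hypothesis applies.
  have hlim : ∀ i, Tendsto (fun n => ∫ x, hsm.approxBounded C n x ∂((m i).restrict K)) atTop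
      (𝓝 (∫ x, f x ∂(m i))) := fun i => by
    rw [← setIntegral_eq_integral_of_forall_compl_eq_zero (s := K) (μ := m i) (f := f)
      (fun x hx => hR x hx)]
    refine tendsto_integral_of_dominated_convergence (fun _ => C)
      (fun n => (hsm.approxBounded C n).aestronglyMeasurable) (integrable_const _)
      (fun n => ae_of_all _ fun x => hsm.norm_approxBounded_le hC0 n x)
      (ae_of_all _ fun x => hsm.tendsto_approxBounded_of_norm_le (hC x))
  have hzero : ∀ n, ∑ i, a i * ∫ x, hsm.approxBounded C n x ∂((m i).restrict K) = 0 := by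
    intro n
    have hint : ∀ i, Integrable (hsm.approxBounded C n) ((m i).restrict K) := fun i =>
      SimpleFunc.integrable_of_isFiniteMeasure _
    simp_rw [fun i => SimpleFunc.integral_eq_sum _ (hint i), Finset.mul_sum]
    rw [Finset.sum_comm]
    refine Finset.sum_eq_zero fun y _ => ?_
    have hS : MeasurableSet (hsm.approxBounded C n ⁻¹' {y}) := SimpleFunc.measurableSet_fiber _ _
    have := h (hsm.approxBounded C n ⁻¹' {y} ∩ K) (hS.inter hKm)
      (Metric.isBounded_closedBall.subset Set.inter_subset_right)
    calc _ = (∑ i, a i * ((m i).real (hsm.approxBounded C n ⁻¹' {y} ∩ K) : ℂ)) * y := by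
          rw [Finset.sum_mul]
          refine Finset.sum_congr rfl fun i _ => ?_
          rw [measureReal_restrict_apply hS, Complex.real_smul, mul_assoc]
      _ = 0 := by rw [this, zero_mul]
  refine tendsto_nhds_unique (tendsto_finsetSum _ fun i _ => (hlim i).const_mul (a i)) ?_
  simp_rw [hzero]
  exact tendsto_const_nhds

theorem LocComplexMeasure.integral_eq_sum_of_eval_eq {ι : Type*} [Fintype ι] {a : ι → ℂ}
    {m : ι → Measure (Rd d)} (hm : ∀ i, IsLocallyFiniteMeasure (m i)) {β : LocComplexMeasure d}
    (h : ∀ B, MeasurableSet B → Bornology.IsBounded B →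
      β.eval B = ∑ i, a i * ((m i).real B : ℂ))
    {f : Rd d → ℂ} (hf : IsTestFunction f) : β.integral f = ∑ i, a i * ∫ x, f x ∂(m i) := by
  -- Both sides are merged into one vanishing combination: the four parts of `β`, and the family `m`
  -- with opposite sign.
  have := sum_integral_eq_zero (ι := Fin 4 ⊕ ι) (a := Sum.elim unitCoeff fun i => -a i)
    (m := Sum.elim β.part m) (by
      rintro (j | i)
      · exact inferInstanceAs (IsLocallyFiniteMeasure (β.part j))
      · exact hm i) (fun B hB hb => by
      have := h B hB hb
      rw [β.eval_eq_sum] at this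
      simp [this]) hf
  rw [β.integral_eq_sum]
  simpa [add_neg_eq_zero] using this

/-- Complex combinations of locally finite measures are locally finite complex measures. -/
theorem LocComplexMeasure.exists_eval_eq_sum {ι : Type*} [Fintype ι] (a : ι → ℂ)
    (m : ι → Measure (Rd d)) (hm : ∀ i, IsLocallyFiniteMeasure (m i)) :
    ∃ β : LocComplexMeasure d, ∀ B, MeasurableSet B → Bornology.IsBounded B →
      β.eval B = ∑ i, a i * ((m i).real B : ℂ) := by
  have hloc : ∀ b : ι → ℝ, IsLocallyFiniteMeasure (∑ i, ENNReal.ofReal (b i) • m i) := fun b => by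
    refine ⟨fun x => ⟨Metric.ball x 1, Metric.ball_mem_nhds x one_pos, ?_⟩⟩
    rw [Measure.finsetSum_apply]
    refine ENNReal.sum_lt_top.2 fun j _ => ?_
    rw [Measure.smul_apply, smul_eq_mul]
    exact ENNReal.mul_lt_top (by simp) Metric.isBounded_ball.measure_lt_top
  have := hloc
  have hreal : ∀ (b : ι → ℝ) (B : Set (Rd d)), Bornology.IsBounded B →
      (∑ i, ENNReal.ofReal (b i) • m i).real B = ∑ i, max (b i) 0 * (m i).real B := by
    intro b B hb
    rw [Measure.real, Measure.finsetSum_apply, ENNReal.toReal_sum]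
    · refine Finset.sum_congr rfl fun i _ => ?_
      rw [Measure.smul_apply, smul_eq_mul, ENNReal.toReal_mul, ENNReal.toReal_ofReal',
        Measure.real]
    · intro i _
      rw [Measure.smul_apply, smul_eq_mul]
      exact (ENNReal.mul_lt_top (by simp) hb.measure_lt_top).ne
  obtain ⟨β, hβ⟩ := exists_eval_eq (∑ i, ENNReal.ofReal (a i).re • m i)
    (∑ i, ENNReal.ofReal (-(a i).re) • m i) (∑ i, ENNReal.ofReal (a i).im • m i)
    (∑ i, ENNReal.ofReal (-(a i).im) • m i)
  refine ⟨β, fun B hB hb => ?_⟩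
  rw [hβ B hB hb, hreal _ B hb, hreal (fun i => -(a i).re) B hb, hreal _ B hb,
    hreal (fun i => -(a i).im) B hb, ← Finset.sum_sub_distrib, ← Finset.sum_sub_distrib]
  have hmax : ∀ t : ℝ, max t 0 - max (-t) 0 = t := fun t => by
    rcases le_total t 0 with h | h
    · rw [max_eq_right h, max_eq_left (by linarith)]; ring
    · rw [max_eq_left h, max_eq_right (by linarith)]; ring
  simp_rw [← sub_mul, hmax]
  push_cast
  rw [Finset.mul_sum, ← Finset.sum_add_distrib]
  refine Finset.sum_congr rfl fun i _ => ?_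
  conv_rhs => rw [← Complex.re_add_im (a i)]
  ring

end TestFunctions

end

section

/-! ### Covariances of linear statistics of test functions -/

open ProbabilityTheory LocComplexMeasure

section Covariance

variable {d : ℕ} {Ω : Type*} [MeasurableSpace Ω] {Φ : Ω → LocComplexMeasure d} {P : Measure Ω}

theorem integral_bind_kernel {α β : Type*} [MeasurableSpace α] [MeasurableSpace β]
    (μ : Measure α) (κ : Kernel α β) {F : β → ℂ} (hF : Integrable F (μ.bind κ)) :
    Integrable (fun a => ∫ b, F b ∂κ a) μ ∧ ∫ b, F b ∂(μ.bind κ) = ∫ a, ∫ b, F b ∂κ a ∂μ := by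
  rw [Measure.comp_eq_comp_const_apply] at hF ⊢
  refine ⟨?_, ?_⟩
  · simpa using hF.integral_comp
  · rw [Kernel.integral_comp hF]
    simp

theorem integral_secondMoment (hΦ : Measurable Φ) {j k : Fin 4} {F : Rd d × Rd d → ℂ}
    (hF : Integrable F (secondMoment P hΦ j k)) :
    Integrable (fun ω => ∫ z, F z ∂((Φ ω).part j).prod ((Φ ω).part k)) P ∧
      ∫ z, F z ∂(secondMoment P hΦ j k) =
        ∫ ω, ∫ z, F z ∂((Φ ω).part j).prod ((Φ ω).part k) ∂P := by
  simpa only [secondMoment, Kernel.prod_apply, partKernel_apply] using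
    integral_bind_kernel P _ hF

/-- The complex combination of the parts of a product of a complex measure and its conjugate. -/
theorem sum_sum_integral_prod {ι : Type*} [Fintype ι] {E : ι → ι → Ω → ℂ} {a : ι → ι → ℂ}
    (hE : ∀ j k, Integrable (E j k) P) :
    Integrable (fun ω => ∑ j, ∑ k, a j k * E j k ω) P ∧
      ∫ ω, ∑ j, ∑ k, a j k * E j k ω ∂P = ∑ j, ∑ k, a j k * ∫ ω, E j k ω ∂P := by
  refine ⟨integrable_finsetSum _ fun j _ => integrable_finsetSum _ fun k _ =>
    (hE j k).const_mul _, ?_⟩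
  rw [integral_finsetSum _ fun j _ => integrable_finsetSum _ fun k _ => (hE j k).const_mul _]
  refine Finset.sum_congr rfl fun j _ => ?_
  rw [integral_finsetSum _ fun k _ => (hE j k).const_mul _]
  exact Finset.sum_congr rfl fun k _ => integral_const_mul _ _

theorem integral_mul_conj_integral (μ : LocComplexMeasure d) (f g : Rd d → ℂ) :
    μ.integral f * conj (μ.integral g) = ∑ j, ∑ k, (unitCoeff j * conj (unitCoeff k)) *
      ∫ z, f z.1 * conj (g z.2) ∂(μ.part j).prod (μ.part k) := by
  rw [μ.integral_eq_sum, μ.integral_eq_sum, map_sum, Finset.sum_mul_sum]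
  refine Finset.sum_congr rfl fun j _ => Finset.sum_congr rfl fun k _ => ?_
  rw [integral_prod_mul f (fun y => conj (g y)), integral_conj, map_mul]
  ring

theorem integral_indicator_one_complex {α : Type*} [MeasurableSpace α] (μ : Measure α) {s : Set α}
    (hs : MeasurableSet s) : ∫ x, s.indicator (fun _ => (1 : ℂ)) x ∂μ = (μ.real s : ℂ) := by
  rw [integral_indicator hs]
  simp

theorem LocComplexMeasure.eval_eq_integral (μ : LocComplexMeasure d) {B : Set (Rd d)}
    (hB : MeasurableSet B) : μ.eval B = μ.integral (B.indicator fun _ => 1) := by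
  rw [μ.eval_eq_sum, μ.integral_eq_sum]
  simp_rw [integral_indicator_one_complex _ hB]

variable [IsProbabilityMeasure P] [AddAction (Rd d) Ω]
  [MeasurableConstVAdd (Rd d) Ω] [VAddInvariantMeasure (Rd d) Ω P]

theorem integrable_secondMoment_of_bound (hΦ : Measurable Φ) (hinv : IsInvariantRCM Φ)
    (hsq : IsLocallySquareIntegrable P Φ) (j k : Fin 4) {F : Rd d × Rd d → ℂ} (hF : Measurable F)
    {C : ℝ} (hC : ∀ z, ‖F z‖ ≤ C) {S : Set (Rd d × Rd d)} (hS : Bornology.IsBounded S)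
    (hS0 : ∀ z, z ∉ S → F z = 0) : Integrable F (secondMoment P hΦ j k) :=
  integrable_of_bound hF hC hS0 (secondMoment_prod_lt_top hΦ hinv hsq j k hS).ne

theorem isLocallyFiniteMeasure_reducedMoment (hΦ : Measurable Φ) (hinv : IsInvariantRCM Φ)
    (hsq : IsLocallySquareIntegrable P Φ) (j k : Fin 4) :
    IsLocallyFiniteMeasure (reducedMoment P hΦ j k) :=
  ⟨fun x => ⟨Metric.ball x 1, Metric.ball_mem_nhds x one_pos,
    reducedMoment_lt_top hΦ hinv hsq j k Metric.isBounded_ball⟩⟩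

/-- Under `(x, y) ↦ (x, x - y)` the second moment measure becomes a product with Lebesgue measure,
and Fubini integrates over `x` first. For `F (x, y) = f x * conj (g y)` the inner integral is the
tilted convolution. -/
theorem integral_secondMoment_eq_reducedMoment (hΦ : Measurable Φ) (hinv : IsInvariantRCM Φ)
    (hsq : IsLocallySquareIntegrable P Φ) (j k : Fin 4) {F : Rd d × Rd d → ℂ} (hF : Measurable F)
    (hi : Integrable F (secondMoment P hΦ j k)) :
    ∫ z, F z ∂(secondMoment P hΦ j k) =
      ∫ z, (∫ x, F (x, x - z)) ∂(reducedMoment P hΦ j k) := by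
  have := isLocallyFiniteMeasure_reducedMoment hΦ hinv hsq j k
  have hT : Measurable fun z : Rd d × Rd d => (z.1, z.1 - z.2) :=
    measurable_fst.prodMk (measurable_fst.sub measurable_snd)
  set G : Rd d × Rd d → ℂ := fun z => F (z.1, z.1 - z.2) with hG
  have hGm : Measurable G := hF.comp hT
  have hFG : F = G ∘ fun z : Rd d × Rd d => (z.1, z.1 - z.2) := by
    ext z
    simp [hG]
  have hGi : Integrable G ((volume : Measure (Rd d)).prod (reducedMoment P hΦ j k)) := by
    rw [← secondMoment_map_sub hΦ hinv hsq j k,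
      integrable_map_measure hGm.aestronglyMeasurable hT.aemeasurable, ← hFG]
    exact hi
  rw [← integral_prod_symm G hGi, ← secondMoment_map_sub hΦ hinv hsq j k,
    integral_map hT.aemeasurable hGm.aestronglyMeasurable]
  exact integral_congr_ae (ae_of_all _ fun z => congrFun hFG z)

theorem integrable_secondMoment_mul (hΦ : Measurable Φ) (hinv : IsInvariantRCM Φ)
    (hsq : IsLocallySquareIntegrable P Φ) (j k : Fin 4) {f g : Rd d → ℂ} (hf : IsTestFunction f)
    (hg : IsTestFunction g) :
    Integrable (fun z : Rd d × Rd d => f z.1 * conj (g z.2)) (secondMoment P hΦ j k) := by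
  obtain ⟨C, R, hC0, -, hC, hR⟩ := hf.exists_bound
  obtain ⟨C', R', -, -, hC', hR'⟩ := hg.exists_bound
  refine integrable_secondMoment_of_bound hΦ hinv hsq j k
    ((hf.1.comp measurable_fst).mul (Complex.continuous_conj.measurable.comp
      (hg.1.comp measurable_snd))) (C := C * C') (fun z => ?_)
    ((Metric.isBounded_closedBall (x := (0 : Rd d)) (r := R)).prod
      (Metric.isBounded_closedBall (x := (0 : Rd d)) (r := R'))) fun z hz => ?_
  · rw [norm_mul, RCLike.norm_conj]
    exact mul_le_mul (hC _) (hC' _) (norm_nonneg _) hC0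
  · by_cases h : z.1 ∈ Metric.closedBall (0 : Rd d) R
    · rw [hR' z.2 fun h' => hz ⟨h, h'⟩, map_zero, mul_zero]
    · rw [hR _ h, zero_mul]

/-- Mixed second moments of linear statistics in terms of the reduced second moment measures. -/
theorem integral_mul_conj_eq_reducedMoment (hΦ : Measurable Φ) (hinv : IsInvariantRCM Φ)
    (hsq : IsLocallySquareIntegrable P Φ) {f g : Rd d → ℂ} (hf : IsTestFunction f)
    (hg : IsTestFunction g) :
    Integrable (fun ω => (Φ ω).integral f * conj ((Φ ω).integral g)) P ∧
      ∫ ω, (Φ ω).integral f * conj ((Φ ω).integral g) ∂P =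
        ∑ j, ∑ k, (unitCoeff j * conj (unitCoeff k)) *
          ∫ z, tiltedConv f g z ∂(reducedMoment P hΦ j k) := by
  have hi := fun j k => integrable_secondMoment_mul hΦ hinv hsq j k hf hg
  simp_rw [integral_mul_conj_integral]
  have h := sum_sum_integral_prod (a := fun j k => unitCoeff j * conj (unitCoeff k))
    fun j k => (integral_secondMoment hΦ (hi j k)).1
  refine ⟨h.1, h.2.trans ?_⟩
  refine Finset.sum_congr rfl fun j _ => Finset.sum_congr rfl fun k _ => ?_
  rw [← (integral_secondMoment hΦ (hi j k)).2,
    integral_secondMoment_eq_reducedMoment hΦ hinv hsq j k _ (hi j k)]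
  · rfl
  · exact (hf.1.comp measurable_fst).mul (Complex.continuous_conj.measurable.comp
      (hg.1.comp measurable_snd))

/-- For each pair of parts the iterated integral in the definition is the integral of a single
indicator over the product measure. The set in question is bounded, as the first coordinate lies in
the cube and the difference in `B`, so every expectation is finite and the sum may be pulled out. -/
theorem reducedSecondMoment_eq_sum (hΦ : Measurable Φ) (hinv : IsInvariantRCM Φ)
    (hsq : IsLocallySquareIntegrable P Φ) {B : Set (Rd d)} (hB : MeasurableSet B)
    (hb : Bornology.IsBounded B) : reducedSecondMoment P Φ B =
      ∑ j, ∑ k, (unitCoeff j * conj (unitCoeff k)) * ((reducedMoment P hΦ j k).real B : ℂ) := by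
  set S : Set (Rd d × Rd d) := (fun z => z.1 - z.2) ⁻¹' B ∩ unitCube d ×ˢ Set.univ with hS
  have hm : Measurable fun z : Rd d × Rd d => z.1 - z.2 := measurable_fst.sub measurable_snd
  have hSm : MeasurableSet S := (hm hB).inter ((measurableSet_unitCube d).prod MeasurableSet.univ)
  set F : Rd d × Rd d → ℂ := S.indicator fun _ => 1 with hF
  have hFm : Measurable F := measurable_const.indicator hSm
  have hFC : ∀ z, ‖F z‖ ≤ 1 := fun z => (norm_indicator_le_norm_self _ _).trans (by simp)
  have hSb : Bornology.IsBounded S := by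
    refine ((isBounded_unitCube d).prod ((isBounded_unitCube d).sub hb)).subset ?_
    rintro ⟨x, y⟩ ⟨hxy, hx, -⟩
    exact ⟨hx, Set.mem_sub.2 ⟨x, hx, x - y, hxy, by simp⟩⟩
  have hF0 : ∀ z, z ∉ S → F z = 0 := fun z hz => Set.indicator_of_notMem hz _
  have hi := fun j k => integrable_secondMoment_of_bound hΦ hinv hsq j k hFm hFC hSb hF0
  have hprod : ∀ (μ : LocComplexMeasure d) j k, Integrable F ((μ.part j).prod (μ.part k)) :=
    fun μ j k => integrable_of_bound hFm hFC hF0 hSb.measure_lt_top.ne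
  have key : ∀ μ : LocComplexMeasure d, μ.integral (fun x => (unitCube d).indicator
      (fun x => conj (μ.integral fun y => B.indicator (fun _ => (1 : ℂ)) (x - y))) x) =
      ∑ j, ∑ k, (unitCoeff j * conj (unitCoeff k)) *
        ∫ z, F z ∂(μ.part j).prod (μ.part k) := by
    intro μ
    have hx : ∀ x, (unitCube d).indicator
        (fun x => conj (μ.integral fun y => B.indicator (fun _ => (1 : ℂ)) (x - y))) x =
        ∑ k, conj (unitCoeff k) * ∫ y, F (x, y) ∂(μ.part k) := by
      intro x
      by_cases hxC : x ∈ unitCube d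
      · rw [Set.indicator_of_mem hxC, μ.integral_eq_sum, map_sum]
        refine Finset.sum_congr rfl fun k _ => ?_
        rw [map_mul, ← integral_conj]
        congr 2
        ext y
        by_cases hy : x - y ∈ B
        · rw [Set.indicator_of_mem hy, hF, Set.indicator_of_mem (by exact ⟨hy, hxC, trivial⟩)]
          simp
        · rw [Set.indicator_of_notMem hy, hF, Set.indicator_of_notMem fun h => hy h.1]
          simp
      · rw [Set.indicator_of_notMem hxC]
        symm
        refine Finset.sum_eq_zero fun k _ => ?_
        have : ∀ y, F (x, y) = 0 := fun y => hF0 _ fun h => hxC h.2.1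
        simp [this]
    simp_rw [hx]
    rw [μ.integral_eq_sum]
    refine Finset.sum_congr rfl fun j _ => ?_
    rw [integral_finsetSum _ fun k _ => (hprod μ j k).integral_prod_left.const_mul _,
      Finset.mul_sum]
    refine Finset.sum_congr rfl fun k _ => ?_
    rw [integral_const_mul, ← integral_prod _ (hprod μ j k), mul_assoc]
  rw [reducedSecondMoment]
  simp_rw [key]
  have h := sum_sum_integral_prod (a := fun j k => unitCoeff j * conj (unitCoeff k))
    fun j k => (integral_secondMoment hΦ (hi j k)).1
  refine h.2.trans (Finset.sum_congr rfl fun j _ => Finset.sum_congr rfl fun k _ => ?_)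
  rw [← (integral_secondMoment hΦ (hi j k)).2, hF, integral_indicator_one_complex _ hSm,
    Measure.real, Measure.real, reducedMoment_apply P hΦ j k hB]

theorem integrable_firstMoment (hΦ : Measurable Φ) (hinv : IsInvariantRCM Φ)
    (hsq : IsLocallySquareIntegrable P Φ) (j : Fin 4) {f : Rd d → ℂ} (hf : Integrable f) :
    Integrable f (firstMoment P hΦ j) := by
  rw [firstMoment_eq_smul hΦ hinv hsq j]
  exact hf.smul_measure (firstMoment_lt_top hΦ hinv hsq j (isBounded_unitCube d)).ne

theorem ae_integrable_part (hΦ : Measurable Φ) (hinv : IsInvariantRCM Φ)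
    (hsq : IsLocallySquareIntegrable P Φ) {f : Rd d → ℂ} (hf : Integrable f) :
    ∀ᵐ ω ∂P, ∀ j, Integrable f ((Φ ω).part j) :=
  ae_all_iff.2 fun j => Measure.ae_integrable_of_integrable_comp
    (κ := partKernel hΦ j) (integrable_firstMoment hΦ hinv hsq j hf)

theorem integrable_integral_part (hΦ : Measurable Φ) (hinv : IsInvariantRCM Φ)
    (hsq : IsLocallySquareIntegrable P Φ) {f : Rd d → ℂ} (hf : Integrable f) (j : Fin 4) :
    Integrable (fun ω => ∫ x, f x ∂(Φ ω).part j) P :=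
  (integral_bind_kernel P (partKernel hΦ j) (integrable_firstMoment hΦ hinv hsq j hf)).1

theorem integral_integral_part (hΦ : Measurable Φ) (hinv : IsInvariantRCM Φ)
    (hsq : IsLocallySquareIntegrable P Φ) {f : Rd d → ℂ} (hf : Integrable f) (j : Fin 4) :
    ∫ ω, ∫ x, f x ∂(Φ ω).part j ∂P =
      ((firstMoment P hΦ j).real (unitCube d) : ℂ) * ∫ x, f x := by
  rw [← Complex.real_smul, Measure.real, ← integral_smul_measure,
    ← firstMoment_eq_smul hΦ hinv hsq j]
  exact (integral_bind_kernel P (partKernel hΦ j) (integrable_firstMoment hΦ hinv hsq j hf)).2.symm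

theorem integrable_integral (hΦ : Measurable Φ) (hinv : IsInvariantRCM Φ)
    (hsq : IsLocallySquareIntegrable P Φ) {f : Rd d → ℂ} (hf : Integrable f) :
    Integrable (fun ω => (Φ ω).integral f) P := by
  simp_rw [LocComplexMeasure.integral_eq_sum]
  exact integrable_finsetSum _ fun j _ =>
    (integrable_integral_part hΦ hinv hsq hf j).const_mul _

theorem intensity_eq_sum (hΦ : Measurable Φ) (hinv : IsInvariantRCM Φ)
    (hsq : IsLocallySquareIntegrable P Φ) :
    intensity P Φ = ∑ j, unitCoeff j * ((firstMoment P hΦ j).real (unitCube d) : ℂ) := by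
  have hf : Integrable ((unitCube d).indicator fun _ => (1 : ℂ)) :=
    (isTestFunction_indicator (measurableSet_unitCube d) (isBounded_unitCube d)).integrable _
  rw [intensity]
  simp_rw [fun ω => (Φ ω).eval_eq_integral (measurableSet_unitCube d),
    LocComplexMeasure.integral_eq_sum]
  rw [integral_finsetSum _ fun j _ => (integrable_integral_part hΦ hinv hsq hf j).const_mul _]
  refine Finset.sum_congr rfl fun j _ => ?_
  rw [integral_const_mul, integral_integral_part hΦ hinv hsq hf,
    integral_indicator_one_complex _ (measurableSet_unitCube d), measureReal_def volume,
    volume_unitCube]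
  simp

/-- Campbell's formula for the first moment. -/
theorem integral_integral_eq_intensity_mul (hΦ : Measurable Φ) (hinv : IsInvariantRCM Φ)
    (hsq : IsLocallySquareIntegrable P Φ) {f : Rd d → ℂ} (hf : Integrable f) :
    ∫ ω, (Φ ω).integral f ∂P = intensity P Φ * ∫ x, f x := by
  simp_rw [LocComplexMeasure.integral_eq_sum]
  rw [integral_finsetSum _ fun j _ => (integrable_integral_part hΦ hinv hsq hf j).const_mul _,
    intensity_eq_sum hΦ hinv hsq, Finset.sum_mul]
  refine Finset.sum_congr rfl fun j _ => ?_
  rw [integral_const_mul, integral_integral_part hΦ hinv hsq hf, mul_assoc]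

/-- The linear statistics of `f` are controlled in `L¹` by the `L¹`-norm of `f`. -/
theorem integral_norm_integral_le (hΦ : Measurable Φ) (hinv : IsInvariantRCM Φ)
    (hsq : IsLocallySquareIntegrable P Φ) : ∃ C : ℝ, 0 ≤ C ∧ ∀ f : Rd d → ℂ, Integrable f →
      ∫ ω, ‖(Φ ω).integral f‖ ∂P ≤ C * ∫ x, ‖f x‖ := by
  refine ⟨∑ j, (firstMoment P hΦ j).real (unitCube d),
    Finset.sum_nonneg fun _ _ => measureReal_nonneg, fun f hf => ?_⟩
  have hn : Integrable (fun x => (‖f x‖ : ℂ)) := hf.norm.ofReal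
  have hpart : ∀ j, Integrable (fun ω => ∫ x, ‖f x‖ ∂(Φ ω).part j) P := fun j => by
    have := (integrable_integral_part hΦ hinv hsq hn j).re
    refine this.congr (ae_of_all _ fun ω => ?_)
    simp only [integral_complex_ofReal, RCLike.re_to_complex, Complex.ofReal_re]
  calc ∫ ω, ‖(Φ ω).integral f‖ ∂P ≤ ∫ ω, ∑ j, ∫ x, ‖f x‖ ∂(Φ ω).part j ∂P := by
        refine integral_mono (integrable_integral hΦ hinv hsq hf).norm
          (integrable_finsetSum _ fun j _ => hpart j) fun ω => ?_
        simp only [LocComplexMeasure.integral_eq_sum]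
        refine (norm_sum_le _ _).trans (Finset.sum_le_sum fun j _ => ?_)
        rw [norm_mul, norm_unitCoeff, one_mul]
        exact norm_integral_le_integral_norm _
    _ = _ := by
        rw [integral_finsetSum _ fun j _ => hpart j, Finset.sum_mul]
        refine Finset.sum_congr rfl fun j _ => ?_
        have := integral_integral_part hΦ hinv hsq hn j
        simp only [integral_complex_ofReal] at this
        exact_mod_cast this

/-- The sum formula exhibits `α_Φ - |γ|² λ_d` as a finite complex combination of locally finite
measures. The index `none` stands for Lebesgue measure. -/
theorem exists_isCovarianceMeasure (hΦ : Measurable Φ) (hinv : IsInvariantRCM Φ)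
    (hsq : IsLocallySquareIntegrable P Φ) : ∃ β, IsCovarianceMeasure P Φ β := by
  obtain ⟨β, hβ⟩ := exists_eval_eq_sum (ι := Option (Fin 4 × Fin 4))
    (fun i => i.elim (-((‖intensity P Φ‖ ^ 2 : ℝ) : ℂ))
      fun p => unitCoeff p.1 * conj (unitCoeff p.2))
    (fun i => i.elim (volume : Measure (Rd d)) fun p => reducedMoment P hΦ p.1 p.2) (by
      rintro (_ | ⟨j, k⟩)
      · exact inferInstanceAs (IsLocallyFiniteMeasure (volume : Measure (Rd d)))
      · exact isLocallyFiniteMeasure_reducedMoment hΦ hinv hsq j k)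
  refine ⟨β, fun B hB hb => ?_⟩
  rw [hβ B hB hb, reducedSecondMoment_eq_sum hΦ hinv hsq hB hb, Fintype.sum_option,
    Fintype.sum_prod_type]
  simp only [Option.elim]
  push_cast
  ring

theorem IsCovarianceMeasure.integral_eq (hΦ : Measurable Φ) (hinv : IsInvariantRCM Φ)
    (hsq : IsLocallySquareIntegrable P Φ) {β : LocComplexMeasure d}
    (hβ : IsCovarianceMeasure P Φ β) {ρ : Rd d → ℂ} (hρ : IsTestFunction ρ) :
    β.integral ρ = ∑ j, ∑ k, (unitCoeff j * conj (unitCoeff k)) *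
      ∫ z, ρ z ∂(reducedMoment P hΦ j k) - ((‖intensity P Φ‖ ^ 2 : ℝ) : ℂ) * ∫ x, ρ x := by
  rw [integral_eq_sum_of_eval_eq (ι := Option (Fin 4 × Fin 4))
    (a := fun i => i.elim (-((‖intensity P Φ‖ ^ 2 : ℝ) : ℂ))
      fun p => unitCoeff p.1 * conj (unitCoeff p.2))
    (m := fun i => i.elim (volume : Measure (Rd d)) fun p => reducedMoment P hΦ p.1 p.2) (by
      rintro (_ | ⟨j, k⟩)
      · exact inferInstanceAs (IsLocallyFiniteMeasure (volume : Measure (Rd d)))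
      · exact isLocallyFiniteMeasure_reducedMoment hΦ hinv hsq j k) (fun B hB hb => ?_) hρ]
  · rw [Fintype.sum_option, Fintype.sum_prod_type]
    simp only [Option.elim]
    ring
  · rw [hβ B hB hb, reducedSecondMoment_eq_sum hΦ hinv hsq hB hb, Fintype.sum_option,
      Fintype.sum_prod_type]
    simp only [Option.elim]
    push_cast
    ring

/-- The covariance measure yields the covariances of linear statistics of test functions. -/
theorem IsCovarianceMeasure.integral_tiltedConv (hΦ : Measurable Φ) (hinv : IsInvariantRCM Φ)
    (hsq : IsLocallySquareIntegrable P Φ) {β : LocComplexMeasure d}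
    (hβ : IsCovarianceMeasure P Φ β) {f g : Rd d → ℂ} (hf : IsTestFunction f)
    (hg : IsTestFunction g) :
    β.integral (tiltedConv f g) = ∫ ω, (Φ ω).integral f * conj ((Φ ω).integral g) ∂P -
      (∫ ω, (Φ ω).integral f ∂P) * conj (∫ ω, (Φ ω).integral g ∂P) := by
  have hfi := hf.integrable (volume : Measure (Rd d))
  have hgi := hg.integrable (volume : Measure (Rd d))
  rw [hβ.integral_eq hΦ hinv hsq (hf.tiltedConv hg),
    (integral_mul_conj_eq_reducedMoment hΦ hinv hsq hf hg).2, _root_.integral_tiltedConv hfi hgi,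
    integral_integral_eq_intensity_mul hΦ hinv hsq hfi,
    integral_integral_eq_intensity_mul hΦ hinv hsq hgi, map_mul]
  have : ((‖intensity P Φ‖ ^ 2 : ℝ) : ℂ) = intensity P Φ * conj (intensity P Φ) := by
    rw [Complex.mul_conj, Complex.normSq_eq_norm_sq]
  rw [this]
  ring

theorem memLp_integral_of_isTestFunction (hΦ : Measurable Φ) (hinv : IsInvariantRCM Φ)
    (hsq : IsLocallySquareIntegrable P Φ) {f : Rd d → ℂ} (hf : IsTestFunction f) :
    MemLp (fun ω => (Φ ω).integral f) 2 P := by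
  rw [memLp_two_iff_integrable_sq_norm (integrable_integral hΦ hinv hsq
    (hf.integrable volume)).aestronglyMeasurable]
  refine ((integral_mul_conj_eq_reducedMoment hΦ hinv hsq hf hf).1.norm).congr
    (ae_of_all _ fun ω => ?_)
  simp only [norm_mul, RCLike.norm_conj, sq]

theorem IsCovarianceMeasure.integral_tiltedConv_self (hΦ : Measurable Φ)
    (hinv : IsInvariantRCM Φ) (hsq : IsLocallySquareIntegrable P Φ) {β : LocComplexMeasure d}
    (hβ : IsCovarianceMeasure P Φ β) {f : Rd d → ℂ} (hf : IsTestFunction f) :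
    β.integral (tiltedConv f f) =
      (complexVariance P (fun ω => (Φ ω).integral f) : ℂ) := by
  rw [hβ.integral_tiltedConv hΦ hinv hsq hf hf, complexVariance]
  simp_rw [Complex.mul_conj, Complex.normSq_eq_norm_sq]
  rw [integral_complex_ofReal]
  push_cast
  rfl

theorem complexVariance_nonneg {X : Ω → ℂ} (hX : MemLp X 2 P) : 0 ≤ complexVariance P X := by
  rw [complexVariance, sub_nonneg]
  have h1 : ‖∫ ω, X ω ∂P‖ ≤ ∫ ω, ‖X ω‖ ∂P := norm_integral_le_integral_norm _
  have h2 : (∫ ω, ‖X ω‖ ∂P) ^ 2 ≤ ∫ ω, ‖X ω‖ ^ 2 ∂P := by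
    have hv := variance_nonneg (fun ω => ‖X ω‖) P
    rw [variance_eq_sub hX.norm] at hv
    simpa using hv
  exact (pow_le_pow_left₀ (norm_nonneg _) h1 2).trans h2

end Covariance

end

section

/-! ### Mollifiers, windows and translation bounded measures -/

open scoped FourierTransform

section Mollifier

variable {d : ℕ}

/-- A smooth bump at the origin with support of radius `1 / (n + 4)`. -/
def mollifierBump (d n : ℕ) : ContDiffBump (0 : Rd d) where
  rIn := 1 / (2 * (n + 4))
  -- The shift by 4 keeps the transform of the bump with `n = 0` within `1 / 4` of one on the unit
  -- ball, as needed in `measure_ball_le_of_modulate_mollifier`.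
  rOut := 1 / (n + 4)
  rIn_pos := by positivity
  rIn_lt_rOut := by
    apply one_div_lt_one_div_of_lt
    · positivity
    · have : (0 : ℝ) ≤ n := n.cast_nonneg
      linarith

/-- A smooth approximate identity. -/
def mollifier (d n : ℕ) (x : Rd d) : ℂ := ((mollifierBump d n).normed volume x : ℂ)

theorem continuous_mollifier (d n : ℕ) : Continuous (mollifier d n) :=
  Complex.continuous_ofReal.comp (mollifierBump d n).continuous_normed

theorem mollifier_eq_zero (n : ℕ) (x : Rd d)
    (hx : x ∉ Metric.closedBall (0 : Rd d) (1 / (n + 4))) : mollifier d n x = 0 := by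
  have : x ∉ Function.support ((mollifierBump d n).normed volume) := by
    rw [ContDiffBump.support_normed_eq]
    exact fun h => hx (Metric.ball_subset_closedBall h)
  rw [mollifier, Function.notMem_support.1 this, Complex.ofReal_zero]

theorem norm_mollifier (n : ℕ) (x : Rd d) :
    ‖mollifier d n x‖ = (mollifierBump d n).normed volume x := by
  rw [mollifier, Complex.norm_real, Real.norm_of_nonneg (ContDiffBump.nonneg_normed _ _)]

theorem integral_norm_mollifier (d n : ℕ) : ∫ x, ‖mollifier d n x‖ = 1 := by
  simp_rw [norm_mollifier]
  exact ContDiffBump.integral_normed _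

theorem integral_mollifier (d n : ℕ) : ∫ x, mollifier d n x = 1 := by
  simp only [mollifier]
  rw [integral_complex_ofReal, ContDiffBump.integral_normed, Complex.ofReal_one]

theorem hasCompactSupport_mollifier (d n : ℕ) : HasCompactSupport (mollifier d n) :=
  HasCompactSupport.intro (isCompact_closedBall _ _) (mollifier_eq_zero n)

theorem isTestFunction_mollifier (d n : ℕ) : IsTestFunction (mollifier d n) := by
  obtain ⟨C, hC⟩ := (continuous_mollifier d n).bounded_above_of_compact_support
    (hasCompactSupport_mollifier d n)
  exact ⟨(continuous_mollifier d n).measurable, ⟨C, hC⟩, hasCompactSupport_mollifier d n⟩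

theorem norm_fourierHat_mollifier_le (n : ℕ) (k : Rd d) :
    ‖fourierHat (mollifier d n) k‖ ≤ 1 :=
  (norm_fourierHat_le _ _).trans (integral_norm_mollifier d n).le

/-- On the support, `|e^{-i⟨k,x⟩} - 1| ≤ ‖k‖ ‖x‖ ≤ ‖k‖ / (n + 4)`, and the mollifier has mass one.
-/
theorem norm_fourierHat_mollifier_sub_one_le (n : ℕ) (k : Rd d) :
    ‖fourierHat (mollifier d n) k - 1‖ ≤ ‖k‖ / (n + 4) := by
  have hi := (isTestFunction_mollifier d n).integrable volume
  rw [← integral_mollifier d n, fourierHat, ← integral_sub (integrable_exp_mul hi k) hi]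
  calc _ ≤ ∫ x, ‖k‖ / (n + 4) * ‖mollifier d n x‖ := by
        refine norm_integral_le_of_norm_le (hi.norm.const_mul _) (ae_of_all _ fun x => ?_)
        by_cases hx : x ∈ Metric.closedBall (0 : Rd d) (1 / (n + 4))
        · rw [← sub_one_mul, norm_mul]
          refine mul_le_mul_of_nonneg_right ?_ (norm_nonneg _)
          have h1 := Real.norm_exp_I_mul_ofReal_sub_one_le (x := -inner ℝ k x)
          rw [Complex.ofReal_neg, mul_neg] at h1
          refine h1.trans ?_
          rw [norm_neg]
          refine (norm_inner_le_norm k x).trans ?_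
          rw [mem_closedBall_zero_iff] at hx
          rw [div_eq_mul_one_div]
          exact mul_le_mul_of_nonneg_left hx (norm_nonneg _)
        · simp [mollifier_eq_zero n x hx]
    _ = _ := by rw [integral_const_mul, integral_norm_mollifier, mul_one]

theorem tendsto_fourierHat_mollifier (k : Rd d) :
    Tendsto (fun n => fourierHat (mollifier d n) k) atTop (𝓝 1) := by
  rw [tendsto_iff_norm_sub_tendsto_zero]
  refine squeeze_zero (fun _ => norm_nonneg _)
    (fun n => norm_fourierHat_mollifier_sub_one_le n k) ?_
  exact tendsto_const_nhds.div_atTop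
    (tendsto_atTop_add_const_right _ _ tendsto_natCast_atTop_atTop)

/-- A mollifier is smooth with compact support, hence Schwartz, and so is its transform. The power
`d + 1` is the smallest integer one that makes the bound Lebesgue integrable. -/
theorem exists_fourierHat_mollifier_le (d n : ℕ) : ∃ C : ℝ, 0 ≤ C ∧ ∀ k : Rd d,
    ‖fourierHat (mollifier d n) k‖ ≤ C * ((1 + ‖k‖) ^ (d + 1))⁻¹ := by
  have hsm : ContDiff ℝ ((⊤ : ℕ∞) : WithTop ℕ∞) (mollifier d n) :=
    Complex.ofRealCLM.contDiff.comp (mollifierBump d n).contDiff_normed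
  set S := (hasCompactSupport_mollifier d n).toSchwartzMap hsm with hS
  set D := 2 ^ (d + 1) * (Finset.Iic ((d + 1, 0) : ℕ × ℕ)).sup
    (fun m => SchwartzMap.seminorm ℂ m.1 m.2) (𝓕 S) with hD
  have hb : ∀ ξ : Rd d, (1 + ‖ξ‖) ^ (d + 1) * ‖𝓕 (mollifier d n) ξ‖ ≤ D := fun ξ => by
    have := SchwartzMap.one_add_le_sup_seminorm_apply (𝕜 := ℂ) (m := (d + 1, 0)) (k := d + 1)
      (n := 0) le_rfl le_rfl (𝓕 S) ξ
    rw [norm_iteratedFDeriv_zero, SchwartzMap.fourier_coe] at this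
    exact this
  have hpi : (1 : ℝ) ≤ 2 * Real.pi := by linarith [Real.pi_gt_three]
  have hD0 : 0 ≤ D := (mul_nonneg (by positivity) (norm_nonneg _)).trans (hb 0)
  -- The power of `2π` pays for the passage from the frequency of `𝓕` to that of `fourierHat`.
  refine ⟨(2 * Real.pi) ^ (d + 1) * D, by positivity, fun k => ?_⟩
  rw [← div_eq_mul_inv, le_div_iff₀ (by positivity), mul_comm]
  have h1 := hb ((2 * Real.pi)⁻¹ • k)
  rw [← fourierHat_eq_fourier, norm_smul, Real.norm_of_nonneg (by positivity)] at h1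
  have h2 : (1 + ‖k‖) ^ (d + 1) ≤
      (2 * Real.pi) ^ (d + 1) * (1 + (2 * Real.pi)⁻¹ * ‖k‖) ^ (d + 1) := by
    rw [← mul_pow]
    refine pow_le_pow_left₀ (by positivity) ?_ _
    rw [mul_add, mul_one, ← mul_assoc, mul_inv_cancel₀ (by positivity), one_mul]
    linarith
  calc _ ≤ (2 * Real.pi) ^ (d + 1) * (1 + (2 * Real.pi)⁻¹ * ‖k‖) ^ (d + 1) *
        ‖fourierHat (mollifier d n) k‖ := mul_le_mul_of_nonneg_right h2 (norm_nonneg _)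
    _ ≤ _ := by
        rw [mul_assoc]
        exact mul_le_mul_of_nonneg_left h1 (by positivity)

theorem integrable_mul_conj_translate {f h : Rd d → ℂ} (hf : Integrable f) (hh : Measurable h)
    {C : ℝ} (hC : ∀ x, ‖h x‖ ≤ C) (y : Rd d) : Integrable fun x => f x * conj (h (x - y)) :=
  hf.mul_bdd (c := C) (Complex.continuous_conj.measurable.comp
    (hh.comp (measurable_id.sub_const y))).aestronglyMeasurable
    (ae_of_all _ fun x => by rw [RCLike.norm_conj]; exact hC _)

theorem tiltedConv_sub_left {f g h : Rd d → ℂ} (hf : Integrable f) (hg : Integrable g)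
    (hh : Measurable h) {C : ℝ} (hC : ∀ x, ‖h x‖ ≤ C) (y : Rd d) :
    tiltedConv (fun x => f x - g x) h y = tiltedConv f h y - tiltedConv g h y := by
  simp only [tiltedConv, sub_mul]
  exact integral_sub (integrable_mul_conj_translate hf hh hC y)
    (integrable_mul_conj_translate hg hh hC y)

theorem tiltedConv_sub_right {f g h : Rd d → ℂ} (hf : Integrable f) (hg : Measurable g)
    (hh : Measurable h) {C D : ℝ} (hC : ∀ x, ‖g x‖ ≤ C) (hD : ∀ x, ‖h x‖ ≤ D) (y : Rd d) :
    tiltedConv f (fun x => g x - h x) y = tiltedConv f g y - tiltedConv f h y := by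
  simp only [tiltedConv, map_sub, mul_sub]
  exact integral_sub (integrable_mul_conj_translate hf hg hC y)
    (integrable_mul_conj_translate hf hh hD y)

/-- Mollification converges in `L¹`. -/
theorem tendsto_integral_norm_tiltedConv_mollifier_sub {f : Rd d → ℂ} (hf : Integrable f) :
    Tendsto (fun n => ∫ y, ‖tiltedConv f (mollifier d n) y - f y‖) atTop (𝓝 0) := by
  have hη := fun n => (isTestFunction_mollifier d n).integrable volume
  have hbd : ∀ n, ∃ C, ∀ x, ‖mollifier d n x‖ ≤ C := fun n => (isTestFunction_mollifier d n).2.1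
  rw [Metric.tendsto_atTop]
  intro ε hε
  -- For continuous compactly supported `g` the convergence is uniform and takes place on a fixed
  -- ball. The remainder `f - g` is not enlarged in `L¹` by a kernel of mass one. This makes three
  -- errors of size `ε / 4`.
  obtain ⟨g, hgs, hfg, hgc, hgi⟩ :=
    hf.exists_hasCompactSupport_integral_sub_le (ε := ε / 4) (by positivity)
  obtain ⟨R, hR⟩ := hgs.isCompact.isBounded.subset_closedBall (0 : Rd d)
  have hg0 : ∀ x, x ∉ Metric.closedBall (0 : Rd d) R → g x = 0 := fun x hx => by
    by_contra h
    exact hx (hR (subset_tsupport g (Function.mem_support.2 h)))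
  set V := (volume : Measure (Rd d)).real (Metric.closedBall 0 (R + 1)) with hV
  have hVf : (volume : Measure (Rd d)) (Metric.closedBall 0 (R + 1)) ≠ ∞ :=
    Metric.isBounded_closedBall.measure_lt_top.ne
  -- A uniform error whose integral over the ball of volume `V`, outside which `g` and its
  -- mollification vanish, is at most `ε / 4`.
  set ε' := ε / (4 * (V + 1)) with hε'
  have hV0 : 0 ≤ V := measureReal_nonneg
  have hε'0 : 0 < ε' := by positivity
  obtain ⟨δ, hδ, hδg⟩ := Metric.uniformContinuous_iff.1
    (hgs.uniformContinuous_of_continuous hgc) ε' hε'0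
  obtain ⟨N, hN⟩ := exists_nat_gt (1 / δ)
  refine ⟨N, fun n hn => ?_⟩
  rw [Real.dist_eq, sub_zero, abs_of_nonneg (integral_nonneg fun _ => norm_nonneg _)]
  have hn4 : (1 : ℝ) / (n + 4) < δ := by
    rw [div_lt_iff₀ (by positivity)]
    rw [div_lt_iff₀ hδ] at hN
    have : (N : ℝ) ≤ n := by exact_mod_cast hn
    nlinarith
  obtain ⟨C, hC⟩ := hbd n
  have hgpt : ∀ y, ‖tiltedConv g (mollifier d n) y - g y‖ ≤ ε' := by
    intro y
    have hm1 : Integrable fun x => mollifier d n (x - y) := (hη n).comp_sub_right y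
    have hm : Integrable fun x => conj (mollifier d n (x - y)) :=
      (LinearIsometryEquiv.integrable_comp_iff (Complex.conjLIE)).2 hm1
    have h1 : ∫ x, conj (mollifier d n (x - y)) = 1 := by
      rw [integral_conj, integral_sub_right_eq_self (mollifier d n) y, integral_mollifier, map_one]
    have h2 : g y = ∫ x, g y * conj (mollifier d n (x - y)) := by
      rw [integral_const_mul, h1, mul_one]
    obtain ⟨D, hD⟩ := hgc.bounded_above_of_compact_support hgs
    rw [h2, tiltedConv, ← integral_sub (hm.bdd_mul (c := D) hgc.aestronglyMeasurable
      (ae_of_all _ hD)) (hm.const_mul _)]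
    calc _ ≤ ∫ x, ε' * ‖mollifier d n (x - y)‖ := by
          refine norm_integral_le_of_norm_le (hm1.norm.const_mul _) (ae_of_all _ fun x => ?_)
          rw [← sub_mul, norm_mul, RCLike.norm_conj]
          by_cases hx : x - y ∈ Metric.closedBall (0 : Rd d) (1 / (n + 4))
          · refine mul_le_mul_of_nonneg_right ?_ (norm_nonneg _)
            rw [← dist_eq_norm]
            refine (hδg ?_).le
            rw [dist_eq_norm]
            exact (mem_closedBall_zero_iff.1 hx).trans_lt hn4
          · rw [mollifier_eq_zero n _ hx]
            simp
      _ = ε' := by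
          rw [integral_const_mul, integral_sub_right_eq_self (fun x => ‖mollifier d n x‖) y,
            integral_norm_mollifier, mul_one]
  have hgint : ∫ y, ‖tiltedConv g (mollifier d n) y - g y‖ ≤ ε / 4 := by
    have h0 : ∀ y, y ∉ Metric.closedBall (0 : Rd d) (R + 1) →
        ‖tiltedConv g (mollifier d n) y - g y‖ = 0 := by
      intro y hy
      have hle : (1 : ℝ) / (n + 4) ≤ 1 := by
        rw [div_le_one (by positivity)]
        have : (0 : ℝ) ≤ n := n.cast_nonneg
        linarith
      rw [hg0 y fun h => hy (Metric.closedBall_subset_closedBall (by linarith) h),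
        tiltedConv_eq_zero hg0 (mollifier_eq_zero n) y fun h =>
          hy (Metric.closedBall_subset_closedBall (by linarith) h)]
      simp
    rw [← setIntegral_eq_integral_of_forall_compl_eq_zero h0]
    calc _ ≤ ε' * V := by
          refine (le_abs_self _).trans ?_
          rw [← Real.norm_eq_abs]
          refine norm_setIntegral_le_of_norm_le_const hVf.lt_top fun y _ => ?_
          rw [norm_norm]
          exact hgpt y
      _ ≤ ε / 4 := by
          rw [hε', div_mul_eq_mul_div, div_le_div_iff₀ (by positivity) (by positivity)]
          nlinarith
  have hi1 := integrable_tiltedConv (hf.sub hgi) (hη n)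
  have hi2 := (integrable_tiltedConv hgi (hη n)).sub hgi
  calc ∫ y, ‖tiltedConv f (mollifier d n) y - f y‖
      ≤ ∫ y, (‖tiltedConv (f - g) (mollifier d n) y‖ +
          ‖tiltedConv g (mollifier d n) y - g y‖ + ‖f y - g y‖) := by
        refine integral_mono ((integrable_tiltedConv hf (hη n)).sub hf).norm
          ((hi1.norm.add hi2.norm).add (hf.sub hgi).norm) fun y => ?_
        have e : tiltedConv (f - g) (mollifier d n) y =
          tiltedConv f (mollifier d n) y - tiltedConv g (mollifier d n) y :=
          tiltedConv_sub_left hf hgi (continuous_mollifier d n).measurable hC y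
        simp only [e]
        calc _ = ‖(tiltedConv f (mollifier d n) y - tiltedConv g (mollifier d n) y) +
              (tiltedConv g (mollifier d n) y - g y) - (f y - g y)‖ := by congr 1; ring
          _ ≤ _ := (norm_sub_le _ _).trans (add_le_add_left (norm_add_le _ _) _)
    _ = (∫ y, ‖tiltedConv (f - g) (mollifier d n) y‖) +
          (∫ y, ‖tiltedConv g (mollifier d n) y - g y‖) + ∫ y, ‖f y - g y‖ := by
        rw [integral_add (f := fun y => ‖tiltedConv (f - g) (mollifier d n) y‖ +
            ‖tiltedConv g (mollifier d n) y - g y‖) (g := fun y => ‖f y - g y‖)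
            (hi1.norm.add hi2.norm) (hf.sub hgi).norm,
          integral_add (g := fun y => ‖tiltedConv g (mollifier d n) y - g y‖) hi1.norm hi2.norm]
    _ ≤ ε / 4 + ε / 4 + ε / 4 := by
        refine add_le_add (add_le_add ?_ hgint) hfg
        refine (integrable_norm_tiltedConv_le (hf.sub hgi) (hη n)).trans ?_
        rw [integral_norm_mollifier, mul_one]
        exact hfg
    _ < ε := by linarith

end Mollifier

section Window

/-- Windows whose tilted self-convolutions are bounded by one and converge to one. -/
theorem exists_window (d : ℕ) : ∃ w : ℕ → Rd d → ℂ, (∀ n, IsTestFunction (w n)) ∧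
    (∀ n z, ‖tiltedConv (w n) (w n) z‖ ≤ 1) ∧
    ∀ z, Tendsto (fun n => tiltedConv (w n) (w n) z) atTop (𝓝 1) := by
  set μ : Measure (Rd d) := volume
  set v : ℝ := μ.real (Metric.ball (0 : Rd d) 1) with hv
  have hfin : ∀ (x : Rd d) r, μ (Metric.ball x r) ≠ ∞ := fun x r =>
    Metric.isBounded_ball.measure_lt_top.ne
  have hv0 : 0 < v := ENNReal.toReal_pos (Metric.measure_ball_pos μ _ one_pos).ne' (hfin _ _)
  have hball : ∀ (x : Rd d) {r : ℝ}, 0 < r → μ.real (Metric.ball x r) = r ^ d * v := by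
    intro x r hr
    rw [Measure.real, Measure.addHaar_ball_of_pos _ _ hr, ENNReal.toReal_mul,
      ENNReal.toReal_ofReal (by positivity), finrank_euclideanSpace_fin]
    rfl
  set B : ℕ → Set (Rd d) := fun n => Metric.ball 0 ((n : ℝ) + 1) with hB
  have hBm : ∀ n, MeasurableSet (B n) := fun n => Metric.isOpen_ball.measurableSet
  set V : ℕ → ℝ := fun n => μ.real (B n) with hV
  have hV' : ∀ n, V n = ((n : ℝ) + 1) ^ d * v := fun n => hball 0 (by positivity)
  have hV0 : ∀ n, 0 < V n := fun n => by rw [hV']; positivity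
  -- With this normalization, `w n ⋆ w n` at `z` is the fraction of the ball of radius `n + 1` that
  -- overlaps with its translate by `z`.
  set w : ℕ → Rd d → ℂ := fun n => (B n).indicator fun _ => (((√(V n))⁻¹ : ℝ) : ℂ) with hw
  have hwC : ∀ n x, ‖w n x‖ ≤ (√(V n))⁻¹ := fun n x => by
    refine (norm_indicator_le_norm_self _ _).trans ?_
    rw [Complex.norm_real, Real.norm_of_nonneg (by positivity)]
  have hwt : ∀ n, IsTestFunction (w n) := fun n =>
    isTestFunction_of_bound (measurable_const.indicator (hBm n)) (hwC n)
      (R := (n : ℝ) + 1) fun x hx =>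
        Set.indicator_of_notMem (fun h => hx (Metric.ball_subset_closedBall h)) _
  have hval : ∀ n z, tiltedConv (w n) (w n) z =
      ((μ.real (B n ∩ Metric.ball z ((n : ℝ) + 1)) / V n : ℝ) : ℂ) := by
    intro n z
    have hpt : ∀ x, w n x * conj (w n (x - z)) = (B n ∩ Metric.ball z ((n : ℝ) + 1)).indicator
        (fun _ => (((V n)⁻¹ : ℝ) : ℂ)) x := by
      intro x
      have hiff : x - z ∈ B n ↔ x ∈ Metric.ball z ((n : ℝ) + 1) := by
        simp [hB, dist_eq_norm]
      simp only [hw]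
      by_cases h1 : x ∈ B n
      · by_cases h2 : x ∈ Metric.ball z ((n : ℝ) + 1)
        · rw [Set.indicator_of_mem (show x ∈ _ ∩ _ from ⟨h1, h2⟩),
            Set.indicator_of_mem h1, Set.indicator_of_mem (hiff.2 h2), Complex.conj_ofReal,
            ← Complex.ofReal_mul, ← mul_inv, Real.mul_self_sqrt (hV0 n).le]
        · rw [Set.indicator_of_notMem (s := B n ∩ Metric.ball z ((n : ℝ) + 1))
            (fun h => h2 h.2),
            Set.indicator_of_notMem fun h => h2 (hiff.1 h), map_zero, mul_zero]
      · rw [Set.indicator_of_notMem (s := B n ∩ Metric.ball z ((n : ℝ) + 1)) (fun h => h1 h.1), Set.indicator_of_notMem h1, zero_mul]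
    simp only [tiltedConv, hpt]
    rw [integral_indicator ((hBm n).inter Metric.isOpen_ball.measurableSet), setIntegral_const,
      Complex.real_smul, div_eq_mul_inv]
    push_cast
    rfl
  have hle : ∀ n z, μ.real (B n ∩ Metric.ball z ((n : ℝ) + 1)) / V n ≤ 1 := fun n z => by
    rw [div_le_one (hV0 n)]
    exact measureReal_mono Set.inter_subset_left (hfin _ _)
  refine ⟨w, hwt, fun n z => ?_, fun z => ?_⟩
  · rw [hval, Complex.norm_real, Real.norm_of_nonneg (by have := (hV0 n).le; positivity)]
    exact hle n z
  · simp_rw [hval]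
    rw [← Complex.ofReal_one]
    refine (Complex.continuous_ofReal.tendsto 1).comp ?_
    -- The overlap contains the ball of radius `n + 1 - ‖z‖` about the origin, which occupies this
    -- fraction of the volume.
    have hlow : Tendsto (fun n : ℕ => (1 - ‖z‖ / ((n : ℝ) + 1)) ^ d) atTop (𝓝 1) := by
      have : Tendsto (fun n : ℕ => ‖z‖ / ((n : ℝ) + 1)) atTop (𝓝 0) :=
        tendsto_const_nhds.div_atTop
          (tendsto_atTop_add_const_right _ _ tendsto_natCast_atTop_atTop)
      simpa using ((tendsto_const_nhds (x := (1 : ℝ))).sub this).pow d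
    refine tendsto_of_tendsto_of_tendsto_of_le_of_le' hlow tendsto_const_nhds ?_
      (Eventually.of_forall fun n => hle n z)
    obtain ⟨N, hN⟩ := exists_nat_gt ‖z‖
    filter_upwards [eventually_ge_atTop N] with n hn
    have hnz : ‖z‖ < (n : ℝ) + 1 := by
      have : (N : ℝ) ≤ n := by exact_mod_cast hn
      linarith
    rw [le_div_iff₀ (hV0 n), hV', ← mul_assoc, ← mul_pow, sub_mul, one_mul,
      div_mul_cancel₀ _ (by positivity), ← hball 0 (by linarith)]
    refine measureReal_mono (Set.subset_inter (Metric.ball_subset_ball (by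
      linarith [norm_nonneg z])) fun x hx => ?_)
      (ne_top_of_le_ne_top (hfin _ _) (measure_mono Set.inter_subset_left))
    rw [mem_ball_zero_iff] at hx
    rw [mem_ball_iff_norm]
    exact (norm_sub_le _ _).trans_lt (by linarith)

end Window

section TranslationBounded

variable {d : ℕ}

/-- Integrals with respect to a measure that is bounded on unit balls are controlled by Lebesgue
integrals of local suprema. -/
theorem lintegral_le_of_measure_ball_le {ν : Measure (Rd d)} [SFinite ν] {C : ℝ≥0∞}
    (hν : ∀ x, ν (Metric.ball x 1) ≤ C) {h H : Rd d → ℝ≥0∞} (hh : Measurable h)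
    (hH : Measurable H) (hhH : ∀ x y, dist x y < 1 → h x ≤ H y) :
    ∫⁻ x, h x ∂ν ≤ C / volume (Metric.ball (0 : Rd d) 1) * ∫⁻ y, H y := by
  set v := (volume : Measure (Rd d)) (Metric.ball (0 : Rd d) 1) with hv
  have hv0 : v ≠ 0 := (Metric.measure_ball_pos _ _ one_pos).ne'
  have hvt : v ≠ ∞ := Metric.isBounded_ball.measure_lt_top.ne
  set D : Set (Rd d × Rd d) := {p | dist p.1 p.2 < 1} with hD
  have hDm : MeasurableSet D := measurableSet_lt measurable_dist measurable_const
  -- Fubini on the strip `dist x y < 1`: integrating `h x` over `y` produces the volume `v` of a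
  -- unit ball, while integrating `H y` over `x` costs at most `C`.
  have hstep : v * ∫⁻ x, h x ∂ν ≤ C * ∫⁻ y, H y := by
    calc v * ∫⁻ x, h x ∂ν = ∫⁻ x, ∫⁻ y, D.indicator (fun p => h p.1) (x, y) ∂volume ∂ν := by
          rw [← lintegral_const_mul _ hh]
          refine lintegral_congr fun x => ?_
          have : (fun y => D.indicator (fun p => h p.1) (x, y)) =
              (Metric.ball x 1).indicator fun _ => h x := by
            ext y
            by_cases hxy : dist x y < 1
            · rw [Set.indicator_of_mem (show (x, y) ∈ D from hxy),
                Set.indicator_of_mem (by rwa [Metric.mem_ball'])]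
            · rw [Set.indicator_of_notMem (show (x, y) ∉ D from hxy),
                Set.indicator_of_notMem (by rwa [Metric.mem_ball'])]
          rw [this, lintegral_indicator Metric.isOpen_ball.measurableSet, setLIntegral_const,
            mul_comm, hv, Measure.addHaar_ball_center _ x 1]
      _ ≤ ∫⁻ x, ∫⁻ y, D.indicator (fun p => H p.2) (x, y) ∂volume ∂ν := by
          refine lintegral_mono fun x => lintegral_mono fun y => ?_
          exact Set.indicator_le_indicator' fun hxy => hhH x y hxy
      _ = ∫⁻ y, ∫⁻ x, D.indicator (fun p => H p.2) (x, y) ∂ν := by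
          rw [lintegral_lintegral_swap]
          exact ((hH.comp measurable_snd).indicator hDm).aemeasurable
      _ ≤ ∫⁻ y, C * H y := by
          refine lintegral_mono fun y => ?_
          have : (fun x => D.indicator (fun p => H p.2) (x, y)) =
              (Metric.ball y 1).indicator fun _ => H y := by
            ext x
            by_cases hxy : dist x y < 1
            · rw [Set.indicator_of_mem (show (x, y) ∈ D from hxy),
                Set.indicator_of_mem (by rwa [Metric.mem_ball])]
            · rw [Set.indicator_of_notMem (show (x, y) ∉ D from hxy),
                Set.indicator_of_notMem (by rwa [Metric.mem_ball])]
          rw [this, lintegral_indicator Metric.isOpen_ball.measurableSet, setLIntegral_const,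
            mul_comm]
          gcongr
          exact hν y
      _ = C * ∫⁻ y, H y := lintegral_const_mul _ hH
  rw [div_eq_mul_inv, mul_right_comm, ← div_eq_mul_inv, ENNReal.le_div_iff_mul_le (Or.inl hv0)
    (Or.inl hvt), mul_comm]
  exact hstep

end TranslationBounded

end

section

/-! ### Fourier transforms of positive semidefinite complex measures -/

open scoped FourierTransform

section Bochner

variable {d : ℕ}

namespace LocComplexMeasure

theorem norm_integral_le_of_bound (μ : LocComplexMeasure d) {f : Rd d → ℂ} {C R : ℝ}
    (hC : ∀ x, ‖f x‖ ≤ C) (hR : ∀ x, x ∉ Metric.closedBall (0 : Rd d) R → f x = 0) :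
    ‖μ.integral f‖ ≤ C * ∑ j, (μ.part j).real (Metric.closedBall 0 R) := by
  rw [μ.integral_eq_sum, Finset.mul_sum]
  refine (norm_sum_le _ _).trans (Finset.sum_le_sum fun j _ => ?_)
  rw [norm_mul, norm_unitCoeff, one_mul,
    ← setIntegral_eq_integral_of_forall_compl_eq_zero (s := Metric.closedBall (0 : Rd d) R)
      (fun x hx => hR x hx)]
  exact norm_setIntegral_le_of_norm_le_const Metric.isBounded_closedBall.measure_lt_top
    fun x _ => hC x

theorem tendsto_integral_of_bound (μ : LocComplexMeasure d) {F : ℕ → Rd d → ℂ} {f : Rd d → ℂ}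
    {C R : ℝ} (hF : ∀ n, Measurable (F n)) (hC : ∀ n x, ‖F n x‖ ≤ C)
    (hR : ∀ n x, x ∉ Metric.closedBall (0 : Rd d) R → F n x = 0)
    (hlim : ∀ x, Tendsto (fun n => F n x) atTop (𝓝 (f x))) :
    Tendsto (fun n => μ.integral (F n)) atTop (𝓝 (μ.integral f)) := by
  simp_rw [μ.integral_eq_sum]
  refine tendsto_finsetSum _ fun j _ => Tendsto.const_mul _ ?_
  have hi : Integrable ((Metric.closedBall (0 : Rd d) R).indicator fun _ => C) (μ.part j) :=
    (integrable_indicator_iff Metric.isClosed_closedBall.measurableSet).2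
      (integrableOn_const (hs := Metric.isBounded_closedBall.measure_lt_top.ne))
  refine tendsto_integral_of_dominated_convergence _
    (fun n => (hF n).aestronglyMeasurable) hi (fun n => ae_of_all _ fun x => ?_)
    (ae_of_all _ hlim)
  by_cases hx : x ∈ Metric.closedBall (0 : Rd d) R
  · rw [Set.indicator_of_mem hx]
    exact hC n x
  · rw [Set.indicator_of_notMem hx, hR n x hx, norm_zero]

theorem continuous_integral_modulate (μ : LocComplexMeasure d) {W : Rd d → ℂ}
    (hW : IsTestFunction W) : Continuous fun k : Rd d =>
      μ.integral fun z => Complex.exp (Complex.I * ((inner ℝ k z : ℝ) : ℂ)) * W z := by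
  simp_rw [μ.integral_eq_sum]
  refine continuous_finsetSum _ fun j _ => continuous_const.mul ?_
  refine continuous_of_dominated (bound := fun z => ‖W z‖)
    (fun k => (hW.modulate k).1.aestronglyMeasurable) (fun k => ae_of_all _ fun z => ?_)
    (hW.integrable _).norm (ae_of_all _ fun z => by fun_prop)
  rw [norm_mul, norm_exp_I_mul, one_mul]

/-- If all modulations of a test function have nonnegative integrals with respect to a complex
measure, then the product of the measure with the function has a nonnegative Fourier transform. -/
theorem exists_measure_of_modulate_nonneg (β : LocComplexMeasure d) {W : Rd d → ℂ}
    (hW : IsTestFunction W)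
    (hpos : ∀ k : Rd d, ∃ r : ℝ, 0 ≤ r ∧
      β.integral (fun z => Complex.exp (Complex.I * ((inner ℝ k z : ℝ) : ℂ)) * W z) = r) :
    ∃ ν : Measure (Rd d), IsLocallyFiniteMeasure ν ∧ ∀ ρ : Rd d → ℂ, IsTestFunction ρ →
      Continuous ρ → Integrable (fourierHat ρ) →
      Integrable (fourierHat ρ) ν ∧
        ∫ k, fourierHat ρ k ∂ν = β.integral fun z => W z * ρ z := by
  set S : Rd d → ℂ := fun k =>
    β.integral fun z => Complex.exp (Complex.I * ((inner ℝ k z : ℝ) : ℂ)) * W z with hS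
  have hSc : Continuous S := β.continuous_integral_modulate hW
  have hSre : ∀ k, (((S k).re : ℝ) : ℂ) = S k ∧ 0 ≤ (S k).re := fun k => by
    obtain ⟨r, hr, h⟩ := hpos k
    have h' : S k = r := h
    rw [h', Complex.ofReal_re]
    exact ⟨rfl, hr⟩
  obtain ⟨C, R, hC0, -, hC, hR⟩ := hW.exists_bound
  set M := C * ∑ j, (β.part j).real (Metric.closedBall 0 R) with hM
  have hSM : ∀ k, ‖S k‖ ≤ M := fun k => by
    refine β.norm_integral_le_of_bound (fun z => ?_) fun z hz => ?_
    · rw [norm_mul, norm_exp_I_mul, one_mul]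
      exact hC z
    · rw [hR z hz, mul_zero]
  set c : ℝ := 2 * Real.pi with hc
  have hc0 : c ≠ 0 := by positivity
  -- The sought measure has Lebesgue density `S`, up to the factor `(2π)^(-d)`. It is built in the
  -- frequency of `𝓕` and pushed forward by the factor `2π`, so that Fourier inversion applies
  -- without constants.
  set D : Rd d → ℝ≥0∞ := fun ξ => ENNReal.ofReal (S (c • ξ)).re with hD
  have hDm : Measurable D := ENNReal.measurable_ofReal.comp (Complex.measurable_re.comp
    (hSc.comp (continuous_const_smul c)).measurable)
  have hDt : ∀ᵐ ξ ∂(volume : Measure (Rd d)), D ξ < ∞ := ae_of_all _ fun _ => ENNReal.ofReal_lt_top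
  have hcm : Measurable fun ξ : Rd d => c • ξ := measurable_const_smul c
  refine ⟨(volume.withDensity D).map fun ξ => c • ξ, ?_, fun ρ hρ hρc hρi => ?_⟩
  · refine ⟨fun x => ⟨Metric.ball x 1, Metric.ball_mem_nhds x one_pos, ?_⟩⟩
    rw [Measure.map_apply hcm Metric.isOpen_ball.measurableSet,
      withDensity_apply _ (hcm Metric.isOpen_ball.measurableSet)]
    have hb : (volume : Measure (Rd d)) ((fun ξ => c • ξ) ⁻¹' Metric.ball x 1) < ∞ := by
      rw [Measure.addHaar_preimage_smul _ hc0]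
      exact ENNReal.mul_lt_top (by simp) Metric.isBounded_ball.measure_lt_top
    refine (lintegral_mono (g := fun _ => ENNReal.ofReal M) fun ξ => ?_).trans_lt ?_
    · exact ENNReal.ofReal_le_ofReal ((Complex.re_le_norm _).trans (hSM _))
    · rw [setLIntegral_const]
      exact ENNReal.mul_lt_top (by simp) hb
  · have hFi : Integrable (𝓕 ρ) := by
      rw [show 𝓕 ρ = fun ξ => fourierHat ρ (c • ξ) from funext (fourier_eq_fourierHat ρ)]
      exact hρi.comp_smul hc0
    have hFc : Continuous (fourierHat ρ) := continuous_fourierHat (hρ.integrable volume)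
    have hval : ∀ ξ, (D ξ).toReal • fourierHat ρ (c • ξ) = S (c • ξ) * 𝓕 ρ ξ := fun ξ => by
      rw [fourier_eq_fourierHat, hD, ENNReal.toReal_ofReal (hSre _).2, Complex.real_smul,
        (hSre _).1]
    have hint : Integrable (fun ξ => S (c • ξ) * 𝓕 ρ ξ) :=
      hFi.bdd_mul (c := M) (hSc.comp (continuous_const_smul c)).aestronglyMeasurable
        (ae_of_all _ fun _ => hSM _)
    refine ⟨?_, ?_⟩
    · rw [integrable_map_measure hFc.aestronglyMeasurable hcm.aemeasurable,
        integrable_withDensity_iff_integrable_smul' hDm hDt]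
      exact hint.congr (ae_of_all _ fun ξ => (hval ξ).symm)
    · rw [integral_map hcm.aemeasurable hFc.aestronglyMeasurable,
        integral_withDensity_eq_integral_toReal_smul hDm hDt]
      simp_rw [hval]
      have hprod : ∀ j, Integrable (fun p : Rd d × Rd d =>
          (Complex.exp (Complex.I * ((inner ℝ (c • p.1) p.2 : ℝ) : ℂ)) * W p.2) * 𝓕 ρ p.1)
          ((volume : Measure (Rd d)).prod (β.part j)) := fun j => by
        have h := (hFi.mul_prod (hW.integrable (β.part j))).bdd_mul (c := 1)
          (f := fun p : Rd d × Rd d => Complex.exp (Complex.I * ((inner ℝ (c • p.1) p.2 : ℝ) : ℂ)))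
          (by fun_prop : Continuous fun p : Rd d × Rd d =>
            Complex.exp (Complex.I * ((inner ℝ (c • p.1) p.2 : ℝ) : ℂ))).aestronglyMeasurable
          (ae_of_all _ fun p => (norm_exp_I_mul _).le)
        refine h.congr (ae_of_all _ fun p => ?_)
        ring
      calc ∫ ξ, S (c • ξ) * 𝓕 ρ ξ
          = ∫ ξ, ∑ j, unitCoeff j * ∫ z, (Complex.exp (Complex.I *
              ((inner ℝ (c • ξ) z : ℝ) : ℂ)) * W z) * 𝓕 ρ ξ ∂(β.part j) := by
            refine integral_congr_ae (ae_of_all _ fun ξ => ?_)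
            simp only [hS, β.integral_eq_sum, Finset.sum_mul, integral_mul_const]
            exact Finset.sum_congr rfl fun j _ => mul_assoc _ _ _
        _ = ∑ j, unitCoeff j * ∫ z, W z * ρ z ∂(β.part j) := by
            rw [integral_finsetSum _ fun j _ => (hprod j).integral_prod_left.const_mul _]
            refine Finset.sum_congr rfl fun j _ => ?_
            -- Once the order of integration is exchanged, the integral over `ξ` is the inversion
            -- formula for `ρ` at `z`.
            rw [integral_const_mul, integral_integral_swap (hprod j)]
            congr 1
            refine integral_congr_ae (ae_of_all _ fun z => ?_)
            have hinv := congrFun (hρc.fourierInv_fourier_eq (hρ.integrable volume) hFi) z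
            rw [Real.fourierInv_eq'] at hinv
            simp only [← hinv]
            rw [← integral_const_mul]
            refine integral_congr_ae (ae_of_all _ fun ξ => ?_)
            simp only [smul_eq_mul, real_inner_smul_left, hc]
            rw [mul_comm Complex.I]
            ring
        _ = _ := by rw [β.integral_eq_sum]

end LocComplexMeasure

end Bochner

end

/-! ### Vague compactness of uniformly translation bounded measures -/

section PositiveSemidefinite

variable {d : ℕ}

/-- The reference weight `(1 + ‖k‖)^{-(d+1)}`. -/
def decayWeight (d : ℕ) (k : Rd d) : ℝ := ((1 + ‖k‖) ^ (d + 1))⁻¹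

theorem decayWeight_pos (k : Rd d) : 0 < decayWeight d k := by
  unfold decayWeight; positivity

theorem continuous_decayWeight (d : ℕ) : Continuous (decayWeight d) :=
  (by fun_prop : Continuous fun k : Rd d => (1 + ‖k‖) ^ (d + 1)).inv₀ fun k => by positivity

theorem integrable_decayWeight (d : ℕ) : Integrable (decayWeight d) := by
  have h := integrable_one_add_norm (E := Rd d) (μ := volume) (r := d + 1) (by simp)
  refine h.congr (ae_of_all _ fun k => ?_)
  simp only [decayWeight]
  rw [Real.rpow_neg (by positivity)]
  norm_cast

/-- Comparability of the weight at points of distance less than one is what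
`lintegral_le_of_measure_ball_le` needs to integrate it against a translation bounded measure. -/
theorem decayWeight_le_of_dist_lt {x y : Rd d} (h : dist x y < 1) :
    decayWeight d x ≤ 2 ^ (d + 1) * decayWeight d y := by
  unfold decayWeight
  rw [← div_eq_mul_inv, inv_eq_one_div, div_le_div_iff₀ (by positivity) (by positivity), one_mul,
    ← mul_pow]
  refine pow_le_pow_left₀ (by positivity) ?_ _
  rw [dist_eq_norm] at h
  have : ‖y‖ ≤ ‖x‖ + ‖x - y‖ := by
    calc ‖y‖ = ‖x - (x - y)‖ := by simp
      _ ≤ _ := norm_sub_le _ _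
  linarith [norm_nonneg x]

/-- A positive semidefinite complex measure: `μ(f ⋆ f) ≥ 0` for all test functions `f`. -/
def LocComplexMeasure.IsPosSemidef (β : LocComplexMeasure d) : Prop :=
  ∀ f : Rd d → ℂ, IsTestFunction f → ∃ r : ℝ, 0 ≤ r ∧ β.integral (tiltedConv f f) = r

theorem integrable_of_norm_le_decayWeight {F : Rd d → ℂ} (hF : Continuous F) {C : ℝ}
    (hC : ∀ k, ‖F k‖ ≤ C * decayWeight d k) : Integrable F :=
  ((integrable_decayWeight d).const_mul C).mono' hF.aestronglyMeasurable (ae_of_all _ hC)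

/-- The tail of the reference weight with respect to a translation bounded measure. -/
theorem lintegral_decayWeight_compl_le {ν : Measure (Rd d)} [SFinite ν] {C : ℝ≥0∞}
    (hν : ∀ x, ν (Metric.ball x 1) ≤ C) (R : ℝ) :
    ∫⁻ k in (Metric.closedBall (0 : Rd d) (R + 1))ᶜ, ENNReal.ofReal (decayWeight d k) ∂ν ≤
      C / volume (Metric.ball (0 : Rd d) 1) * ∫⁻ k in (Metric.closedBall (0 : Rd d) R)ᶜ,
        ENNReal.ofReal (2 ^ (d + 1) * decayWeight d k) := by
  have hm : ∀ R, MeasurableSet (Metric.closedBall (0 : Rd d) R)ᶜ := fun R =>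
    Metric.isClosed_closedBall.measurableSet.compl
  have hw := (continuous_decayWeight d).measurable
  rw [← lintegral_indicator (hm _), ← lintegral_indicator (hm _)]
  refine lintegral_le_of_measure_ball_le hν ((ENNReal.measurable_ofReal.comp hw).indicator (hm _))
    ((ENNReal.measurable_ofReal.comp (hw.const_mul _)).indicator (hm _)) fun x y hxy => ?_
  by_cases hx : x ∈ (Metric.closedBall (0 : Rd d) (R + 1))ᶜ
  · have hy : y ∈ (Metric.closedBall (0 : Rd d) R)ᶜ := by
      rw [Set.mem_compl_iff, mem_closedBall_zero_iff, not_le] at *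
      rw [dist_eq_norm] at hxy
      have : ‖x‖ ≤ ‖x - y‖ + ‖y‖ := by
        calc ‖x‖ = ‖(x - y) + y‖ := by simp
          _ ≤ _ := norm_add_le _ _
      linarith
    rw [Set.indicator_of_mem hx, Set.indicator_of_mem hy]
    exact ENNReal.ofReal_le_ofReal (decayWeight_le_of_dist_lt hxy)
  · rw [Set.indicator_of_notMem hx]
    exact zero_le

/-- Translation bounded sequences of measures have vague limit points along which integrals of
continuous functions with sufficient decay converge. -/
theorem exists_vague_limit {ν : ℕ → Measure (Rd d)} (hν : ∀ n, IsLocallyFiniteMeasure (ν n))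
    {C : ℝ≥0∞} (hC : C ≠ ∞) (hνC : ∀ n x, ν n (Metric.ball x 1) ≤ C) :
    ∃ (U : Ultrafilter ℕ) (ν' : Measure (Rd d)), (U : Filter ℕ) ≤ atTop ∧
      IsLocallyFiniteMeasure ν' ∧ ∀ F : Rd d → ℂ, Continuous F →
        (∃ D, ∀ k, ‖F k‖ ≤ D * decayWeight d k) →
        Integrable F ν' ∧ Tendsto (fun n => ∫ k, F k ∂(ν n)) U (𝓝 (∫ k, F k ∂ν')) := by
  set v := (volume : Measure (Rd d)) (Metric.ball (0 : Rd d) 1) with hv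
  have hv0 : v ≠ 0 := (Metric.measure_ball_pos _ _ one_pos).ne'
  have hwm : Measurable fun k : Rd d => ENNReal.ofReal (decayWeight d k) :=
    ENNReal.measurable_ofReal.comp (continuous_decayWeight d).measurable
  -- A common bound for the weighted mass of every `ν n` outside the ball of radius `R + 1`. Its
  -- convergence to zero is tightness.
  set T : ℝ → ℝ≥0∞ := fun R => C / v * ∫⁻ k in (Metric.closedBall (0 : Rd d) R)ᶜ,
    ENNReal.ofReal (2 ^ (d + 1) * decayWeight d k) with hT
  have hw2i : Integrable fun k : Rd d => 2 ^ (d + 1) * decayWeight d k :=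
    (integrable_decayWeight d).const_mul _
  have hw2 : ∫⁻ k : Rd d, ENNReal.ofReal (2 ^ (d + 1) * decayWeight d k) ≠ ∞ := hw2i.lintegral_lt_top.ne
  have hCv : C / v ≠ ∞ := (ENNReal.div_lt_top hC hv0).ne
  have hTfin : ∀ R, T R ≠ ∞ := fun R => ENNReal.mul_ne_top hCv
    (ne_top_of_le_ne_top hw2 (setLIntegral_le_lintegral _ _))
  have hTlim : Tendsto (fun n : ℕ => T n) atTop (𝓝 0) := by
    have h0 : Tendsto (fun n : ℕ => ∫⁻ k in (Metric.closedBall (0 : Rd d) n)ᶜ,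
        ENNReal.ofReal (2 ^ (d + 1) * decayWeight d k)) atTop (𝓝 0) := by
      have hanti : Antitone fun n : ℕ => (Metric.closedBall (0 : Rd d) n)ᶜ := fun m n h =>
        Set.compl_subset_compl.2 (Metric.closedBall_subset_closedBall (by exact_mod_cast h))
      have hm : ∀ n : ℕ, MeasurableSet (Metric.closedBall (0 : Rd d) n)ᶜ := fun n =>
        Metric.isClosed_closedBall.measurableSet.compl
      have h1 := tendsto_measure_iInter_atTop
        (μ := (volume : Measure (Rd d)).withDensity
          fun k => ENNReal.ofReal (2 ^ (d + 1) * decayWeight d k))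
        (s := fun n : ℕ => (Metric.closedBall (0 : Rd d) n)ᶜ)
        (fun n => (hm n).nullMeasurableSet) hanti ⟨0, by
          rw [withDensity_apply _ (hm 0)]
          exact ne_top_of_le_ne_top hw2 (setLIntegral_le_lintegral _ _)⟩
      have h2 : (⋂ n : ℕ, (Metric.closedBall (0 : Rd d) n)ᶜ) = ∅ := by
        rw [← Set.compl_iUnion, Metric.iUnion_closedBall_nat, Set.compl_univ]
      rw [h2, measure_empty] at h1
      refine h1.congr fun n => ?_
      rw [Function.comp_apply, withDensity_apply _ (hm n)]
    have h1 := ENNReal.Tendsto.const_mul h0 (Or.inr hCv)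
    rwa [mul_zero] at h1
  have htot : ∀ n, ∫⁻ k, ENNReal.ofReal (decayWeight d k) ∂(ν n) ≤
      C / v * ∫⁻ k : Rd d, ENNReal.ofReal (2 ^ (d + 1) * decayWeight d k) := fun n =>
    lintegral_le_of_measure_ball_le (hνC n) hwm
      (ENNReal.measurable_ofReal.comp ((continuous_decayWeight d).measurable.const_mul _))
      fun x y hxy => ENNReal.ofReal_le_ofReal (decayWeight_le_of_dist_lt hxy)
  set A := C / v * ∫⁻ k : Rd d, ENNReal.ofReal (2 ^ (d + 1) * decayWeight d k) with hA
  have hAfin : A ≠ ∞ := ENNReal.mul_ne_top hCv hw2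
  -- The weight makes the measures finite with mass at most `A`, which puts them in the range of
  -- Prokhorov's theorem.
  let m : ℕ → FiniteMeasure (Rd d) := fun n =>
    ⟨(ν n).withDensity fun k => ENNReal.ofReal (decayWeight d k), ⟨by
      rw [withDensity_apply _ MeasurableSet.univ, setLIntegral_univ]
      exact (htot n).trans_lt hAfin.lt_top⟩⟩
  have hcompact := isCompact_setOfPred_finiteMeasure_mass_le_compl_isCompact_le
    (E := Rd d) (u := fun n => (T n).toNNReal)
    (K := fun n => Metric.closedBall (0 : Rd d) (n + 1)) A.toNNReal
    (by
      have := (ENNReal.tendsto_toNNReal (ENNReal.zero_ne_top)).comp hTlim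
      exact this)
    (fun n => isCompact_closedBall _ _) (Or.inl inferInstance)
  have hmem : ∀ n, m n ∈ {μ : FiniteMeasure (Rd d) | μ.mass ≤ A.toNNReal ∧
      ∀ j : ℕ, μ (Metric.closedBall (0 : Rd d) (j + 1))ᶜ ≤ (T j).toNNReal} := by
    intro n
    constructor
    · refine ENNReal.toNNReal_mono hAfin ?_
      change ((ν n).withDensity fun k => ENNReal.ofReal (decayWeight d k)) Set.univ ≤ A
      rw [withDensity_apply _ MeasurableSet.univ, setLIntegral_univ]
      exact htot n
    · intro j
      refine ENNReal.toNNReal_mono (hTfin j) ?_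
      change ((ν n).withDensity fun k => ENNReal.ofReal (decayWeight d k)) _ ≤ _
      rw [withDensity_apply _ Metric.isClosed_closedBall.measurableSet.compl]
      exact lintegral_decayWeight_compl_le (hνC n) j
  -- Compactness gives a limit along a free ultrafilter, so no subsequence has to be extracted; such
  -- an ultrafilter still refines `atTop`.
  obtain ⟨m', -, hm'⟩ := hcompact.ultrafilter_le_nhds ((hyperfilter ℕ).map m)
    (le_principal_iff.2 (mem_map.2 (univ_mem' hmem)))
  have hm't : Tendsto m (hyperfilter ℕ : Filter ℕ) (𝓝 m') := hm'
  rw [FiniteMeasure.tendsto_iff_forall_integral_rclike_tendsto ℂ] at hm't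
  have hwinv : Continuous fun k : Rd d => (decayWeight d k)⁻¹ :=
    (continuous_decayWeight d).inv₀ fun k => (decayWeight_pos k).ne'
  -- The weight is divided out of the limit. A continuous function dominated by the weight becomes
  -- bounded when divided by it, hence admissible for weak convergence.
  refine ⟨hyperfilter ℕ, (m' : Measure (Rd d)).withDensity
    fun k => ENNReal.ofReal (decayWeight d k)⁻¹, by
      rw [← Nat.cofinite_eq_atTop]; exact hyperfilter_le_cofinite,
    IsLocallyFiniteMeasure.withDensity_ofReal hwinv, fun F hF ⟨D, hD⟩ => ?_⟩
  have hGb : ∀ k, ‖((decayWeight d k)⁻¹ : ℝ) • F k‖ ≤ D := fun k => by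
    rw [norm_smul, Real.norm_of_nonneg (inv_nonneg.2 (decayWeight_pos k).le),
      inv_mul_le_iff₀ (decayWeight_pos k), mul_comm]
    exact hD k
  have hGc : Continuous fun k => ((decayWeight d k)⁻¹ : ℝ) • F k := hwinv.smul hF
  let G : BoundedContinuousFunction (Rd d) ℂ := BoundedContinuousFunction.ofNormedAddCommGroup
    (fun k => ((decayWeight d k)⁻¹ : ℝ) • F k) hGc D hGb
  have hwim : Measurable fun k : Rd d => ENNReal.ofReal (decayWeight d k)⁻¹ :=
    ENNReal.measurable_ofReal.comp hwinv.measurable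
  have hG : Integrable (fun k => ((decayWeight d k)⁻¹ : ℝ) • F k) (m' : Measure (Rd d)) :=
    G.integrable _
  constructor
  · rw [integrable_withDensity_iff_integrable_smul' hwim (ae_of_all _ fun _ => ENNReal.ofReal_lt_top)]
    refine hG.congr (ae_of_all _ fun k => ?_)
    simp only
    rw [ENNReal.toReal_ofReal (inv_nonneg.2 (decayWeight_pos k).le)]
  · have h := hm't G
    rw [integral_withDensity_eq_integral_toReal_smul hwim
      (ae_of_all _ fun _ => ENNReal.ofReal_lt_top)]
    have e1 : (∫ k, (ENNReal.ofReal (decayWeight d k)⁻¹).toReal • F k ∂(m' : Measure (Rd d))) =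
        ∫ k, G k ∂(m' : Measure (Rd d)) := by
      refine integral_congr_ae (ae_of_all _ fun k => ?_)
      simp only
      rw [ENNReal.toReal_ofReal (inv_nonneg.2 (decayWeight_pos k).le)]
      rfl
    rw [e1]
    refine h.congr fun n => ?_
    change ∫ k, G k ∂((ν n).withDensity fun k => ENNReal.ofReal (decayWeight d k)) = _
    rw [integral_withDensity_eq_integral_toReal_smul hwm
      (ae_of_all _ fun _ => ENNReal.ofReal_lt_top)]
    refine integral_congr_ae (ae_of_all _ fun k => ?_)
    simp only
    rw [ENNReal.toReal_ofReal (decayWeight_pos k).le]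
    change decayWeight d k • ((decayWeight d k)⁻¹ : ℝ) • F k = F k
    rw [smul_smul, mul_inv_cancel₀ (decayWeight_pos k).ne', one_smul]

end PositiveSemidefinite

/-! ### The Bochner–Schwartz theorem -/

section BochnerSchwartz

variable {d : ℕ}

/-- Dominating a ball by the squared Fourier transform of a modulated mollifier. -/
theorem measure_ball_le_of_modulate_mollifier {ν : Measure (Rd d)} (k₀ : Rd d) {K : ℝ}
    {h : Rd d → ℂ} (hh : h = fun x => Complex.exp (Complex.I * ((inner ℝ k₀ x : ℝ) : ℂ)) *
      mollifier d 0 x)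
    (hi : Integrable (fun k => fourierHat h k * conj (fourierHat h k)) ν)
    (hK : ‖∫ k, fourierHat h k * conj (fourierHat h k) ∂ν‖ ≤ K) :
    ν (Metric.ball k₀ 1) ≤ ENNReal.ofReal (4 * K) := by
  have e : ∀ k, fourierHat h k * conj (fourierHat h k) = ((‖fourierHat h k‖ ^ 2 : ℝ) : ℂ) :=
    fun k => by rw [Complex.mul_conj, Complex.normSq_eq_norm_sq]
  simp_rw [e] at hi hK
  have hi' : Integrable (fun k => ‖fourierHat h k‖ ^ 2) ν := by
    exact hi.re.congr (ae_of_all _ fun k => Complex.ofReal_re _)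
  rw [integral_complex_ofReal, Complex.norm_real, Real.norm_of_nonneg (by positivity)] at hK
  -- On this ball the transform of `h` has modulus at least `3 / 4`, so four times its square
  -- exceeds one.
  have h1 : ν (Metric.ball k₀ 1) ≤ ∫⁻ k, ENNReal.ofReal (4 * ‖fourierHat h k‖ ^ 2) ∂ν := by
    rw [← lintegral_indicator_one Metric.isOpen_ball.measurableSet]
    refine lintegral_mono fun k => ?_
    by_cases hk : k ∈ Metric.ball k₀ 1
    · rw [Set.indicator_of_mem hk, Pi.one_apply, ← ENNReal.ofReal_one]
      refine ENNReal.ofReal_le_ofReal ?_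
      rw [hh, fourierHat_modulate]
      have h2 := norm_fourierHat_mollifier_sub_one_le 0 (k - k₀)
      rw [Metric.mem_ball, dist_eq_norm] at hk
      have h3 : ‖(1 : ℂ)‖ ≤ ‖fourierHat (mollifier d 0) (k - k₀)‖ +
          ‖fourierHat (mollifier d 0) (k - k₀) - 1‖ := by
        calc ‖(1 : ℂ)‖ = ‖fourierHat (mollifier d 0) (k - k₀) -
            (fourierHat (mollifier d 0) (k - k₀) - 1)‖ := by ring_nf
          _ ≤ _ := norm_sub_le _ _
      rw [norm_one] at h3
      norm_num at h2
      nlinarith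
    · rw [Set.indicator_of_notMem hk]
      exact zero_le
  refine h1.trans ?_
  rw [← ofReal_integral_eq_lintegral_ofReal (hi'.const_mul 4) (ae_of_all _ fun k => by positivity),
    integral_const_mul]
  exact ENNReal.ofReal_le_ofReal (by linarith)

namespace LocComplexMeasure

/-- A uniform bound for `β(W · (h ⋆ h))` over modulated mollifiers `h`. -/
theorem exists_norm_integral_modulate_mollifier_le (β : LocComplexMeasure d) :
    ∃ K : ℝ, ∀ (W : Rd d → ℂ), (∀ z, ‖W z‖ ≤ 1) → ∀ k₀ : Rd d,
      ‖β.integral fun z => W z * tiltedConv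
        (fun x => Complex.exp (Complex.I * ((inner ℝ k₀ x : ℝ) : ℂ)) * mollifier d 0 x)
        (fun x => Complex.exp (Complex.I * ((inner ℝ k₀ x : ℝ) : ℂ)) * mollifier d 0 x) z‖ ≤ K := by
  obtain ⟨C, R, hC0, hR0, hC, hR⟩ := (isTestFunction_mollifier d 0).exists_bound
  -- Modulation contributes only a factor of modulus one to the tilted convolution, so size and
  -- support are those of the unmodulated mollifier.
  refine ⟨C * ∑ j, (β.part j).real (Metric.closedBall 0 (R + R)), fun W hW k₀ =>
    β.norm_integral_le_of_bound (fun z => ?_) fun z hz => ?_⟩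
  · rw [tiltedConv_modulate, norm_mul, norm_mul, norm_exp_I_mul, one_mul]
    have := norm_tiltedConv_le ((isTestFunction_mollifier d 0).integrable volume) hC z
    rw [integral_norm_mollifier, one_mul] at this
    calc _ ≤ 1 * C := mul_le_mul (hW z) this (norm_nonneg _) zero_le_one
      _ = C := one_mul C
  · rw [tiltedConv_modulate, tiltedConv_eq_zero hR hR z hz, mul_zero, mul_zero]

/-- The Bochner–Schwartz theorem, tested against functions with rapidly decaying transform. -/
theorem IsPosSemidef.exists_measure {β : LocComplexMeasure d} (hβ : β.IsPosSemidef) :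
    ∃ ν : Measure (Rd d), IsLocallyFiniteMeasure ν ∧ ∀ ρ : Rd d → ℂ, IsTestFunction ρ →
      Continuous ρ → (∃ D, ∀ k, ‖fourierHat ρ k‖ ≤ D * decayWeight d k) →
        Integrable (fourierHat ρ) ν ∧ ∫ k, fourierHat ρ k ∂ν = β.integral ρ := by
  obtain ⟨w, hw, hw1, hwlim⟩ := exists_window d
  -- A modulated `w n ⋆ w n` is the tilted self-convolution of the modulated window, so
  -- semidefiniteness supplies the required positivity.
  have hex := fun n => β.exists_measure_of_modulate_nonneg ((hw n).tiltedConv (hw n)) fun k => by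
    have := hβ _ ((hw n).modulate k)
    simp_rw [← tiltedConv_modulate]
    exact this
  choose ν hν hνρ using hex
  obtain ⟨K, hK⟩ := β.exists_norm_integral_modulate_mollifier_le
  -- For a modulated mollifier `h`, `∫ |ĥ|² dν n` equals the integral of `(w n ⋆ w n) · (h ⋆ h)`
  -- against `β`. The first factor is bounded by one, hence a bound free of `n` and `x`.
  have hball : ∀ n x, ν n (Metric.ball x 1) ≤ ENNReal.ofReal (4 * K) := by
    intro n x
    have ht := isTestFunction_mollifier d 0
    have hm := ht.modulate x
    have hmi := hm.integrable volume
    obtain ⟨C, R, hC0, hR0, hC, hR⟩ := hm.exists_bound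
    have hcont : Continuous fun y : Rd d =>
        Complex.exp (Complex.I * ((inner ℝ x y : ℝ) : ℂ)) * mollifier d 0 y :=
      (by fun_prop : Continuous fun y : Rd d =>
        Complex.exp (Complex.I * ((inner ℝ x y : ℝ) : ℂ))).mul (continuous_mollifier d 0)
    have hc2 := continuous_tiltedConv hmi hcont hC
    have hFeq := fun k => fourierHat_tiltedConv hmi hmi k
    obtain ⟨C', hC'0, hC'⟩ := exists_fourierHat_mollifier_le d 0
    have hFi : Integrable (fourierHat (tiltedConv
        (fun y => Complex.exp (Complex.I * ((inner ℝ x y : ℝ) : ℂ)) * mollifier d 0 y)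
        (fun y => Complex.exp (Complex.I * ((inner ℝ x y : ℝ) : ℂ)) * mollifier d 0 y))) := by
      have h0 : Integrable fun k => C' * decayWeight d (k - x) :=
        ((integrable_decayWeight d).comp_sub_right x).const_mul C'
      refine h0.mono' (continuous_fourierHat ((hm.tiltedConv hm).integrable _)).aestronglyMeasurable
        (ae_of_all _ fun k => ?_)
      rw [hFeq, fourierHat_modulate, norm_mul, RCLike.norm_conj]
      calc _ ≤ C' * decayWeight d (k - x) * 1 := mul_le_mul (hC' _)
            (norm_fourierHat_mollifier_le _ _) (norm_nonneg _)
              (mul_nonneg hC'0 (decayWeight_pos _).le)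
        _ = _ := mul_one _
    obtain ⟨h1, h2⟩ := hνρ n _ (hm.tiltedConv hm) hc2 hFi
    simp_rw [hFeq] at h2
    refine measure_ball_le_of_modulate_mollifier x rfl (h1.congr (ae_of_all _ hFeq)) ?_
    rw [h2]
    exact hK _ (hw1 n) x
  obtain ⟨U, ν', hU, hν', hlim⟩ := exists_vague_limit hν ENNReal.ofReal_ne_top hball
  refine ⟨ν', hν', fun ρ hρ hρc hD => ?_⟩
  have hF := continuous_fourierHat (hρ.integrable volume)
  obtain ⟨h1, h2⟩ := hlim _ hF hD
  refine ⟨h1, tendsto_nhds_unique h2 ?_⟩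
  obtain ⟨D, hD⟩ := hD
  simp_rw [fun n => (hνρ n ρ hρ hρc (integrable_of_norm_le_decayWeight hF hD)).2]
  refine Tendsto.mono_left ?_ hU
  obtain ⟨C, R, hC0, hR0, hC, hR⟩ := hρ.exists_bound
  refine β.tendsto_integral_of_bound (C := C) (R := R)
    (fun n => ((hw n).tiltedConv (hw n)).1.mul hρ.1) (fun n x => ?_)
    (fun n x hx => by rw [hR x hx, mul_zero]) fun x => ?_
  · rw [norm_mul]
    calc _ ≤ 1 * C := mul_le_mul (hw1 n x) (hC x) (norm_nonneg _) zero_le_one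
      _ = C := one_mul C
  · simpa using (hwlim x).mul_const (ρ x)

/-- Mollification is continuous for `(f, g) ↦ β(f ⋆ g)`. -/
theorem tendsto_integral_tiltedConv_mollifier (β : LocComplexMeasure d) {f g : Rd d → ℂ}
    (hf : IsTestFunction f) (hg : IsTestFunction g) :
    Tendsto (fun n => β.integral (tiltedConv (tiltedConv f (mollifier d n))
      (tiltedConv g (mollifier d n)))) atTop (𝓝 (β.integral (tiltedConv f g))) := by
  have hη := fun n => isTestFunction_mollifier d n
  have hηi := fun n => (hη n).integrable volume
  have hfi := hf.integrable volume
  have hgi := hg.integrable volume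
  obtain ⟨C, R, hC0, hR0, hC, hR⟩ := hf.exists_bound
  obtain ⟨C', R', hC'0, hR'0, hC', hR'⟩ := hg.exists_bound
  have hf' := fun n => hf.tiltedConv (hη n)
  have hg' := fun n => hg.tiltedConv (hη n)
  have hη1 : ∀ n, ∀ x, x ∉ Metric.closedBall (0 : Rd d) 1 → mollifier d n x = 0 := fun n x hx =>
    mollifier_eq_zero n x fun h => hx (Metric.closedBall_subset_closedBall (by
      rw [div_le_one (by positivity)]; linarith [(n.cast_nonneg : (0:ℝ) ≤ n)]) h)
  have hCn : ∀ n x, ‖tiltedConv g (mollifier d n) x‖ ≤ C' := fun n x => by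
    have := norm_tiltedConv_le' (hηi n) hC' x
    rwa [integral_norm_mollifier, mul_one] at this
  have hfn : ∀ n, ∫ x, ‖tiltedConv f (mollifier d n) x‖ ≤ ∫ x, ‖f x‖ := fun n => by
    have := integrable_norm_tiltedConv_le hfi (hηi n)
    rwa [integral_norm_mollifier, mul_one] at this
  refine β.tendsto_integral_of_bound (C := (∫ x, ‖f x‖) * C') (R := (R + 1) + (R' + 1))
    (fun n => ((hf' n).tiltedConv (hg' n)).1) (fun n x => ?_) (fun n x hx => ?_) fun x => ?_
  · exact (norm_tiltedConv_le ((hf' n).integrable _) (hCn n) x).trans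
      (mul_le_mul_of_nonneg_right (hfn n) hC'0)
  · exact tiltedConv_eq_zero (tiltedConv_eq_zero hR (hη1 n)) (tiltedConv_eq_zero hR' (hη1 n)) x hx
  · rw [tendsto_iff_norm_sub_tendsto_zero]
    have hlim : Tendsto (fun n => (∫ y, ‖tiltedConv f (mollifier d n) y - f y‖) * C' +
        C * ∫ y, ‖tiltedConv g (mollifier d n) y - g y‖) atTop (𝓝 (0 * C' + C * 0)) :=
      ((tendsto_integral_norm_tiltedConv_mollifier_sub hfi).mul_const C').add
        ((tendsto_integral_norm_tiltedConv_mollifier_sub hgi).const_mul C)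
    rw [zero_mul, mul_zero, add_zero] at hlim
    refine squeeze_zero (fun n => norm_nonneg _) (fun n => ?_) hlim
    have e1 := tiltedConv_sub_left ((hf' n).integrable volume) hfi (hg' n).1 (hCn n) x
    have e2 := tiltedConv_sub_right hfi (hg' n).1 hg.1 (hCn n) hC' x
    have b1 := norm_tiltedConv_le (((hf' n).integrable volume).sub hfi) (hCn n) x
    have b2 := norm_tiltedConv_le' (((hg' n).integrable volume).sub hgi) hC x
    calc _ = ‖tiltedConv (fun x => tiltedConv f (mollifier d n) x - f x)
            (tiltedConv g (mollifier d n)) x +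
          tiltedConv f (fun x => tiltedConv g (mollifier d n) x - g x) x‖ := by
          rw [e1, e2]; ring_nf
      _ ≤ _ := (norm_add_le _ _).trans (add_le_add b1 b2)

/-- The Bochner–Schwartz theorem: positive semidefinite complex measures have a Fourier
transform. -/
theorem IsPosSemidef.exists_isFourierTransform {β : LocComplexMeasure d} (hβ : β.IsPosSemidef) :
    ∃ ν : Measure (Rd d), IsFourierTransform β ν := by
  obtain ⟨ν, hν, hνρ⟩ := hβ.exists_measure
  have hη := fun n => isTestFunction_mollifier d n
  have hηi := fun n => (hη n).integrable volume
  have hηc := fun n => continuous_fourierHat (hηi n)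
  -- Replacing `f, g` by `f ⋆ η, g ⋆ η` multiplies `f̂ conj(ĝ)` by `|η̂|²`. This supplies the
  -- continuity and decay demanded by `exists_measure`, and is undone by `η̂ → 1`.
  have key : ∀ f g : Rd d → ℂ, IsTestFunction f → IsTestFunction g → ∀ n,
      Integrable (fun k => (fourierHat f k * conj (fourierHat g k)) *
        (‖fourierHat (mollifier d n) k‖ ^ 2 : ℝ)) ν ∧
      ∫ k, (fourierHat f k * conj (fourierHat g k)) *
        (‖fourierHat (mollifier d n) k‖ ^ 2 : ℝ) ∂ν =
      β.integral (tiltedConv (tiltedConv f (mollifier d n)) (tiltedConv g (mollifier d n))) := by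
    intro f g hf hg n
    have hf' := hf.tiltedConv (hη n)
    have hg' := hg.tiltedConv (hη n)
    obtain ⟨C, R, hC0, hR0, hC, hR⟩ := hg'.exists_bound
    obtain ⟨Cη, Rη, hCη0, hRη0, hCη, hRη⟩ := (hη n).exists_bound
    have hgc := continuous_tiltedConv (hg.integrable volume) (continuous_mollifier d n) hCη
    have hc := continuous_tiltedConv (hf'.integrable volume) hgc hC
    have e : ∀ k, fourierHat (tiltedConv (tiltedConv f (mollifier d n))
        (tiltedConv g (mollifier d n))) k = (fourierHat f k * conj (fourierHat g k)) *
          (‖fourierHat (mollifier d n) k‖ ^ 2 : ℝ) := fun k => by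
      rw [fourierHat_tiltedConv (hf'.integrable _) (hg'.integrable _),
        fourierHat_tiltedConv (hf.integrable _) (hηi n),
        fourierHat_tiltedConv (hg.integrable _) (hηi n), map_mul, Complex.conj_conj,
        ← Complex.normSq_eq_norm_sq, Complex.normSq_eq_conj_mul_self]
      ring
    obtain ⟨D, hD0, hD⟩ := exists_fourierHat_mollifier_le d n
    have := hνρ _ (hf'.tiltedConv hg') hc ⟨((∫ x, ‖f x‖) * ∫ x, ‖g x‖) * D, fun k => by
      rw [e, norm_mul, norm_mul, RCLike.norm_conj, Complex.norm_real, norm_pow, norm_norm]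
      refine (mul_le_mul (mul_le_mul (norm_fourierHat_le _ _) (norm_fourierHat_le _ _)
        (norm_nonneg _) (integral_nonneg fun _ => norm_nonneg _)) ?_ (by positivity)
        (mul_nonneg (integral_nonneg fun _ => norm_nonneg _)
          (integral_nonneg fun _ => norm_nonneg _))).trans_eq (mul_assoc _ D _).symm
      rw [pow_two]
      calc _ ≤ D * decayWeight d k * 1 := mul_le_mul (hD k) (norm_fourierHat_mollifier_le n k)
            (norm_nonneg _) (mul_nonneg hD0 (decayWeight_pos k).le)
        _ = _ := mul_one _⟩
    rwa [funext e] at this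
  -- Fatou's lemma applies because the regularized integrals converge. The square-integrability
  -- obtained here then provides the dominating function for the limit.
  have hL2 : ∀ f : Rd d → ℂ, IsTestFunction f → MemLp (fourierHat f) 2 ν := by
    intro f hf
    have hfc := continuous_fourierHat (hf.integrable volume)
    rw [memLp_two_iff_integrable_sq_norm hfc.aestronglyMeasurable]
    refine ⟨(hfc.norm.pow 2).aestronglyMeasurable, ?_⟩
    have hle : ∫⁻ k, ‖‖fourierHat f k‖ ^ 2‖ₑ ∂ν ≤ liminf (fun n => ∫⁻ k, ‖(fourierHat f k *
        conj (fourierHat f k)) * (‖fourierHat (mollifier d n) k‖ ^ 2 : ℝ)‖ₑ ∂ν) atTop := by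
      refine le_trans (lintegral_mono fun k => ?_) (lintegral_liminf_le fun n => ?_)
      · refine le_of_eq (Tendsto.liminf_eq ?_).symm
        have h1 := ((tendsto_fourierHat_mollifier k).norm.pow 2)
        rw [norm_one, one_pow] at h1
        have h2 : Tendsto (fun n => ‖(fourierHat f k *
            conj (fourierHat f k)) * (‖fourierHat (mollifier d n) k‖ ^ 2 : ℝ)‖ₑ) atTop
            (𝓝 ‖(fourierHat f k * conj (fourierHat f k)) * ((1 : ℝ) : ℂ)‖ₑ) :=
          (((Complex.continuous_ofReal.tendsto _).comp h1).const_mul _).enorm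
        convert h2 using 2
        rw [Complex.ofReal_one, mul_one, Complex.mul_conj, Complex.normSq_eq_norm_sq,
          ← ofReal_norm, ← ofReal_norm, Complex.norm_real]
      · exact (((hfc.mul (Complex.continuous_conj.comp hfc)).mul
          (Complex.continuous_ofReal.comp ((hηc n).norm.pow 2))).enorm).measurable
    refine hle.trans_lt ?_
    have hlim := ((β.tendsto_integral_tiltedConv_mollifier hf hf).enorm).liminf_eq
    have e : ∀ n, ∫⁻ k, ‖(fourierHat f k *
        conj (fourierHat f k)) * (‖fourierHat (mollifier d n) k‖ ^ 2 : ℝ)‖ₑ ∂ν =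
        ‖β.integral (tiltedConv (tiltedConv f (mollifier d n))
          (tiltedConv f (mollifier d n)))‖ₑ := by
      intro n
      obtain ⟨h1, h2⟩ := key f f hf hf n
      have e3 : ∀ k, (fourierHat f k *
        conj (fourierHat f k)) * (‖fourierHat (mollifier d n) k‖ ^ 2 : ℝ) =
        ((‖fourierHat f k‖ ^ 2 * ‖fourierHat (mollifier d n) k‖ ^ 2 : ℝ) : ℂ) := fun k => by
        rw [Complex.mul_conj, Complex.normSq_eq_norm_sq]; push_cast; ring
      rw [← h2, ← ofReal_norm]
      simp_rw [← ofReal_norm]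
      rw [← ofReal_integral_eq_lintegral_ofReal h1.norm (ae_of_all _ fun k => norm_nonneg _)]
      congr 1
      simp_rw [e3]
      rw [integral_complex_ofReal, Complex.norm_real, Real.norm_of_nonneg (by positivity)]
      refine integral_congr_ae (ae_of_all _ fun k => ?_)
      simp only
      rw [Complex.norm_real, Real.norm_of_nonneg (by positivity)]
    simp_rw [e]
    rw [hlim]
    exact enorm_lt_top
  have hint : ∀ f g : Rd d → ℂ, IsTestFunction f → IsTestFunction g →
      Integrable (fun k => fourierHat f k * conj (fourierHat g k)) ν := fun f g hf hg =>
    (hL2 f hf).integrable_mul (hL2 g hg).star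
  refine ⟨ν, hν, hint, fun f g hf hg => ?_⟩
  refine tendsto_nhds_unique (β.tendsto_integral_tiltedConv_mollifier hf hg) ?_
  simp_rw [← fun n => (key f g hf hg n).2]
  refine tendsto_integral_of_dominated_convergence
    (fun k => ‖fourierHat f k * conj (fourierHat g k)‖)
    (fun n => (key f g hf hg n).1.aestronglyMeasurable) (hint f g hf hg).norm
    (fun n => ae_of_all _ fun k => ?_) (ae_of_all _ fun k => ?_)
  · rw [norm_mul _ (Complex.ofReal _), Complex.norm_real, norm_pow, norm_norm]
    exact mul_le_of_le_one_right (norm_nonneg _)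
      (pow_le_one₀ (norm_nonneg _) (norm_fourierHat_mollifier_le n k))
  · have h1 := ((tendsto_fourierHat_mollifier k).norm.pow 2)
    rw [norm_one, one_pow] at h1
    have h2 := ((Complex.continuous_ofReal.tendsto _).comp h1).const_mul
      (fourierHat f k * conj (fourierHat g k))
    rw [Complex.ofReal_one, mul_one] at h2
    exact h2

end LocComplexMeasure

end BochnerSchwartz

/-! ### Simultaneous approximation in `L¹` and in spectral `L²` -/

section BartlettSpectralMeasure

variable {d : ℕ}

/-- Convergence in `L²` implies convergence of the squared norms. -/
theorem tendsto_integral_norm_sq {α : Type*} [MeasurableSpace α] {μ : Measure α}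
    {F : ℕ → α → ℂ} {f : α → ℂ} (hF : ∀ n, MemLp (F n) 2 μ) (hf : MemLp f 2 μ)
    (h : Tendsto (fun n => ∫ x, ‖F n x - f x‖ ^ 2 ∂μ) atTop (𝓝 0)) :
    Tendsto (fun n => ∫ x, ‖F n x‖ ^ 2 ∂μ) atTop (𝓝 (∫ x, ‖f x‖ ^ 2 ∂μ)) := by
  have key : ∀ {g : α → ℂ} (hg : MemLp g 2 μ), ∫ x, ‖g x‖ ^ 2 ∂μ = ‖hg.toLp g‖ ^ 2 := by
    intro g hg
    have h1 := hg.eLpNorm_eq_integral_rpow_norm two_ne_zero ENNReal.ofNat_ne_top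
    have h0 : 0 ≤ ∫ x, ‖g x‖ ^ 2 ∂μ := by positivity
    rw [Lp.norm_toLp, h1]
    simp only [ENNReal.toReal_ofNat, Real.rpow_two]
    rw [ENNReal.toReal_ofReal (by positivity), ← Real.rpow_natCast, ← Real.rpow_mul h0]
    norm_num
  simp_rw [fun n => key (hF n), key hf]
  refine (Tendsto.norm ?_).pow 2
  rw [tendsto_iff_norm_sub_tendsto_zero]
  have h2 : ∀ n, ∫ x, ‖F n x - f x‖ ^ 2 ∂μ = ‖(hF n).toLp (F n) - hf.toLp f‖ ^ 2 := fun n => by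
    rw [← MemLp.toLp_sub]
    exact key ((hF n).sub hf)
  simp_rw [h2] at h
  have h3 := (Real.continuous_sqrt.tendsto _).comp h
  rw [Real.sqrt_zero] at h3
  refine h3.congr fun n => ?_
  exact Real.sqrt_sq (norm_nonneg _)

/-- Truncations approximate integrable functions by test functions. -/
theorem exists_isTestFunction_integral_sub_le {f : Rd d → ℂ} (hf : Integrable f) {ε : ℝ}
    (hε : 0 < ε) : ∃ g : Rd d → ℂ, IsTestFunction g ∧ ∫ x, ‖g x - f x‖ < ε := by
  set f' := hf.1.mk f with hf'
  have hm : Measurable f' := hf.1.stronglyMeasurable_mk.measurable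
  set S : ℕ → Set (Rd d) := fun n => {x | ‖f' x‖ ≤ n} ∩ Metric.closedBall 0 n with hS
  have hSm : ∀ n, MeasurableSet (S n) := fun n =>
    (measurableSet_le hm.norm measurable_const).inter Metric.isClosed_closedBall.measurableSet
  have ht : ∀ n, IsTestFunction ((S n).indicator f') := fun n =>
    isTestFunction_of_bound (C := n) (R := n) (hm.indicator (hSm n)) (fun x => by
      by_cases hx : x ∈ S n
      · rw [Set.indicator_of_mem hx]; exact hx.1
      · rw [Set.indicator_of_notMem hx, norm_zero]; positivity)
      fun x hx => Set.indicator_of_notMem (fun h => hx h.2) _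
  have hlim : Tendsto (fun n => ∫ x, ‖(S n).indicator f' x - f x‖) atTop
      (𝓝 (∫ _ : Rd d, (0 : ℝ))) := by
    refine tendsto_integral_of_dominated_convergence (fun x => ‖f x‖)
      (fun n => ((ht n).1.aestronglyMeasurable.sub hf.1).norm) hf.norm (fun n => ?_) ?_
    · filter_upwards [hf.1.ae_eq_mk] with x hx
      rw [norm_norm]
      by_cases h : x ∈ S n
      · rw [Set.indicator_of_mem h, hf', ← hx, sub_self, norm_zero]; positivity
      · rw [Set.indicator_of_notMem h, zero_sub, norm_neg]
    · filter_upwards [hf.1.ae_eq_mk] with x hx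
      refine tendsto_const_nhds.congr' ?_
      obtain ⟨N, hN⟩ := exists_nat_ge (max ‖f' x‖ ‖x‖)
      filter_upwards [eventually_ge_atTop N] with n hn
      have hn' : (N : ℝ) ≤ n := by exact_mod_cast hn
      have h : x ∈ S n := ⟨((le_max_left _ _).trans hN).trans hn',
        mem_closedBall_zero_iff.2 (((le_max_right _ _).trans hN).trans hn')⟩
      rw [Set.indicator_of_mem h, hf', ← hx, sub_self, norm_zero]
  rw [integral_zero] at hlim
  obtain ⟨n, hn⟩ := (hlim.eventually (gt_mem_nhds hε)).exists
  exact ⟨_, ht n, hn⟩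

/-- Simultaneous approximation by test functions in `L¹` and, for the Fourier transforms, in
`L²(ν)`. -/
theorem exists_isTestFunction_seq {ν : Measure (Rd d)}
    (hν : ∀ n, MemLp (fourierHat (mollifier d n)) 2 ν) {f : Rd d → ℂ} (hf : Integrable f)
    (hf2 : MemLp (fourierHat f) 2 ν) : ∃ g : ℕ → Rd d → ℂ, (∀ n, IsTestFunction (g n)) ∧
      Tendsto (fun n => ∫ x, ‖g n x - f x‖) atTop (𝓝 0) ∧
      Tendsto (fun n => ∫ k, ‖fourierHat (g n) k - fourierHat f k‖ ^ 2 ∂ν) atTop (𝓝 0) := by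
  have hη := fun n => isTestFunction_mollifier d n
  have hηi := fun n => (hη n).integrable volume
  have hηc := fun n => continuous_fourierHat (hηi n)
  set A : ℕ → ℝ := fun n => ∫ k, ‖fourierHat (mollifier d n) k‖ ^ 2 ∂ν with hA
  have hA0 : ∀ n, 0 ≤ A n := fun n => by positivity
  -- The error of `φ n` costs up to `ε n ^ 2 * A n` in `L²(ν)`, and no bound on the growth of `A n`
  -- is at hand. The tolerance is chosen to compensate for it and to vanish as well.
  set ε : ℕ → ℝ := fun n => 1 / ((n + 1) * (1 + A n)) with hε
  have hε0 : ∀ n, 0 < ε n := fun n => by have := hA0 n; positivity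
  have hε1 : ∀ n, ε n ≤ 1 / ((n : ℝ) + 1) := fun n => by
    refine one_div_le_one_div_of_le (by positivity) ?_
    nlinarith [hA0 n, (n.cast_nonneg : (0 : ℝ) ≤ n)]
  have hε2 : ∀ n, ε n ^ 2 * A n ≤ 1 / ((n : ℝ) + 1) := fun n => by
    have h1 : ε n * (1 + A n) = 1 / ((n : ℝ) + 1) := by
      have := hA0 n
      simp only [hε]
      field_simp
    have h2 : ε n ≤ 1 := (hε1 n).trans (by
      rw [div_le_one (by positivity)]; linarith [(n.cast_nonneg : (0 : ℝ) ≤ n)])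
    calc ε n ^ 2 * A n = ε n * (ε n * A n) := by ring
      _ ≤ 1 * (ε n * (1 + A n)) := mul_le_mul h2
          (mul_le_mul_of_nonneg_left (by linarith) (hε0 n).le)
          (mul_nonneg (hε0 n).le (hA0 n)) zero_le_one
      _ = _ := by rw [one_mul, h1]
  choose φ hφ hφε using fun n => exists_isTestFunction_integral_sub_le hf (hε0 n)
  have hφi := fun n => (hφ n).integrable (volume : Measure (Rd d))
  have hg := fun n => (hφ n).tiltedConv (hη n)
  -- Closeness of `φ n` to `f` in `L¹` controls the transforms only uniformly. The extra factor from
  -- the mollifier, which lies in `L²(ν)`, converts this into control in `L²(ν)`.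
  refine ⟨fun n => tiltedConv (φ n) (mollifier d n), hg, ?_, ?_⟩
  · have hlim := (tendsto_one_div_add_atTop_nhds_zero_nat (𝕜 := ℝ)).add
      (tendsto_integral_norm_tiltedConv_mollifier_sub hf)
    rw [add_zero] at hlim
    refine squeeze_zero (fun n => integral_nonneg fun _ => norm_nonneg _) (fun n => ?_) hlim
    obtain ⟨C, R, hC0, hR0, hC, hR⟩ := (hη n).exists_bound
    have h1 := integrable_norm_tiltedConv_le ((hφi n).sub hf) (hηi n)
    rw [integral_norm_mollifier, mul_one] at h1
    have i1 := integrable_tiltedConv ((hφi n).sub hf) (hηi n)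
    have i2 := (integrable_tiltedConv hf (hηi n)).sub hf
    calc _ ≤ ∫ x, (‖tiltedConv (fun x => φ n x - f x) (mollifier d n) x‖ +
          ‖tiltedConv f (mollifier d n) x - f x‖) := by
          refine integral_mono (((hg n).integrable _).sub hf).norm (i1.norm.add i2.norm)
            fun x => ?_
          simp only
          rw [tiltedConv_sub_left (hφi n) hf (hη n).1 hC]
          refine le_trans (le_of_eq ?_) (norm_add_le _ _)
          ring_nf
      _ = _ := integral_add i1.norm i2.norm
      _ ≤ _ := add_le_add (h1.trans ((hφε n).le.trans (hε1 n))) le_rfl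
  · have hfc := continuous_fourierHat hf
    have hf2' : Integrable (fun k => ‖fourierHat f k‖ ^ 2) ν :=
      (memLp_two_iff_integrable_sq_norm hf2.1).1 hf2
    have hηi2 : ∀ n, Integrable (fun k => ‖fourierHat (mollifier d n) k‖ ^ 2) ν := fun n =>
      (memLp_two_iff_integrable_sq_norm (hν n).1).1 (hν n)
    have hb : ∀ n k, ‖conj (fourierHat (mollifier d n) k) - 1‖ ≤ 2 := fun n k => by
      refine (norm_sub_le _ _).trans ?_
      rw [RCLike.norm_conj, norm_one]
      linarith [norm_fourierHat_mollifier_le n k]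
    have hmeas : ∀ n, AEStronglyMeasurable (fun k => ‖fourierHat f k *
        (conj (fourierHat (mollifier d n) k) - 1)‖ ^ 2) ν := fun n =>
      ((hfc.mul ((Complex.continuous_conj.comp (hηc n)).sub continuous_const)).norm.pow
        2).aestronglyMeasurable
    have hle : ∀ n k, ‖fourierHat f k * (conj (fourierHat (mollifier d n) k) - 1)‖ ^ 2 ≤
        4 * ‖fourierHat f k‖ ^ 2 := fun n k => by
      rw [norm_mul, mul_pow, mul_comm]
      refine mul_le_mul_of_nonneg_right ?_ (by positivity)
      calc _ ≤ (2 : ℝ) ^ 2 := pow_le_pow_left₀ (norm_nonneg _) (hb n k) 2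
        _ = 4 := by norm_num
    have hi2 : ∀ n, Integrable (fun k => ‖fourierHat f k *
        (conj (fourierHat (mollifier d n) k) - 1)‖ ^ 2) ν := fun n =>
      (hf2'.const_mul 4).mono' (hmeas n) (ae_of_all _ fun k => by
        rw [Real.norm_of_nonneg (by positivity)]; exact hle n k)
    have hlim2 : Tendsto (fun n => ∫ k, ‖fourierHat f k *
        (conj (fourierHat (mollifier d n) k) - 1)‖ ^ 2 ∂ν) atTop (𝓝 (∫ _, (0 : ℝ) ∂ν)) := by
      refine tendsto_integral_of_dominated_convergence _ hmeas (hf2'.const_mul 4)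
        (fun n => ae_of_all _ fun k => by
          rw [Real.norm_of_nonneg (by positivity)]; exact hle n k) (ae_of_all _ fun k => ?_)
      have h1 := ((Complex.continuous_conj.tendsto _).comp (tendsto_fourierHat_mollifier k))
      have h2 := (((h1.sub_const 1).const_mul (fourierHat f k)).norm).pow 2
      simpa using h2
    rw [integral_zero] at hlim2
    have hlim := ((tendsto_one_div_add_atTop_nhds_zero_nat (𝕜 := ℝ)).const_mul 2).add
      (hlim2.const_mul 2)
    rw [mul_zero, add_zero] at hlim
    refine squeeze_zero (fun n => by positivity) (fun n => ?_) hlim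
    have hpt : ∀ k, ‖fourierHat (tiltedConv (φ n) (mollifier d n)) k - fourierHat f k‖ ^ 2 ≤
        2 * (ε n ^ 2 * ‖fourierHat (mollifier d n) k‖ ^ 2) +
          2 * ‖fourierHat f k * (conj (fourierHat (mollifier d n) k) - 1)‖ ^ 2 := fun k => by
      rw [fourierHat_tiltedConv (hφi n) (hηi n)]
      have e : fourierHat (φ n) k * conj (fourierHat (mollifier d n) k) - fourierHat f k =
          fourierHat (fun x => φ n x - f x) k * conj (fourierHat (mollifier d n) k) +
          fourierHat f k * (conj (fourierHat (mollifier d n) k) - 1) := by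
        rw [fourierHat_sub (hφi n) hf]; ring
      rw [e]
      have h1 : ‖fourierHat (fun x => φ n x - f x) k * conj (fourierHat (mollifier d n) k)‖ ≤
          ε n * ‖fourierHat (mollifier d n) k‖ := by
        rw [norm_mul, RCLike.norm_conj]
        exact mul_le_mul_of_nonneg_right ((norm_fourierHat_le _ _).trans (hφε n).le)
          (norm_nonneg _)
      have h2 := pow_le_pow_left₀ (norm_nonneg _) h1 2
      rw [mul_pow] at h2
      have h3 := pow_le_pow_left₀ (norm_nonneg _) (norm_add_le
        (fourierHat (fun x => φ n x - f x) k * conj (fourierHat (mollifier d n) k))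
        (fourierHat f k * (conj (fourierHat (mollifier d n) k) - 1))) 2
      have h4 := add_sq_le (a := ‖fourierHat (fun x => φ n x - f x) k *
        conj (fourierHat (mollifier d n) k)‖)
        (b := ‖fourierHat f k * (conj (fourierHat (mollifier d n) k) - 1)‖)
      linarith
    calc _ ≤ ∫ k, (2 * (ε n ^ 2 * ‖fourierHat (mollifier d n) k‖ ^ 2) +
          2 * ‖fourierHat f k * (conj (fourierHat (mollifier d n) k) - 1)‖ ^ 2) ∂ν := by
          have hi := (((hηi2 n).const_mul (ε n ^ 2)).const_mul 2).add ((hi2 n).const_mul 2)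
          refine integral_mono_of_nonneg (ae_of_all _ fun k => by positivity) hi
            (ae_of_all _ hpt)
      _ = 2 * (ε n ^ 2 * A n) + 2 * _ := by
          rw [integral_add (((hηi2 n).const_mul _).const_mul _) ((hi2 n).const_mul _),
            integral_const_mul, integral_const_mul, integral_const_mul]
      _ ≤ _ := add_le_add (mul_le_mul_of_nonneg_left (hε2 n) zero_le_two) le_rfl

end BartlettSpectralMeasure

/-! ### Existence of the Bartlett spectral measure and the spectral isometry -/

section SpectralIsometry

variable {d : ℕ}

theorem IsFourierTransform.memLp {β : LocComplexMeasure d} {ν : Measure (Rd d)}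
    (hν : IsFourierTransform β ν) {f : Rd d → ℂ} (hf : IsTestFunction f) :
    MemLp (fourierHat f) 2 ν := by
  have hfc := continuous_fourierHat (hf.integrable volume)
  rw [memLp_two_iff_integrable_sq_norm hfc.aestronglyMeasurable]
  refine (hν.integrable f f hf hf).norm.congr (ae_of_all _ fun k => ?_)
  simp only
  rw [norm_mul, RCLike.norm_conj, pow_two]

theorem IsFourierTransform.integral_tiltedConv_self {β : LocComplexMeasure d} {ν : Measure (Rd d)}
    (hν : IsFourierTransform β ν) {f : Rd d → ℂ} (hf : IsTestFunction f) :
    β.integral (tiltedConv f f) = ((∫ k, ‖fourierHat f k‖ ^ 2 ∂ν : ℝ) : ℂ) := by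
  rw [hν.integral_eq f f hf hf, ← integral_complex_ofReal]
  refine integral_congr_ae (ae_of_all _ fun k => ?_)
  simp only
  rw [Complex.mul_conj, Complex.normSq_eq_norm_sq]

/-- Fourier transforms of complex measures are translation bounded. -/
theorem IsFourierTransform.exists_measure_ball_le {β : LocComplexMeasure d} {ν : Measure (Rd d)}
    (hν : IsFourierTransform β ν) : ∃ C : ℝ, ∀ x, ν (Metric.ball x 1) ≤ ENNReal.ofReal C := by
  obtain ⟨K, hK⟩ := β.exists_norm_integral_modulate_mollifier_le
  refine ⟨4 * K, fun x => ?_⟩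
  have hm := (isTestFunction_mollifier d 0).modulate x
  refine measure_ball_le_of_modulate_mollifier x rfl (hν.integrable _ _ hm hm) ?_
  rw [← hν.integral_eq _ _ hm hm]
  have := hK (fun _ => 1) (fun _ => by simp) x
  simpa only [one_mul] using this

variable {Ω : Type*} [MeasurableSpace Ω] {Φ : Ω → LocComplexMeasure d} {P : Measure Ω}
  [IsProbabilityMeasure P] [AddAction (Rd d) Ω]
  [MeasurableConstVAdd (Rd d) Ω] [VAddInvariantMeasure (Rd d) Ω P]

/-- Semidefiniteness of the covariance measure is the nonnegativity of variances, so the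
Bochner–Schwartz theorem applies. -/
theorem exists_isBartlettSpectralMeasure (hΦ : Measurable Φ) (hinv : IsInvariantRCM Φ)
    (hsq : IsLocallySquareIntegrable P Φ) : ∃ ν, IsBartlettSpectralMeasure P Φ ν := by
  obtain ⟨β, hβ⟩ := exists_isCovarianceMeasure hΦ hinv hsq
  have hpos : β.IsPosSemidef := fun f hf =>
    ⟨_, complexVariance_nonneg (memLp_integral_of_isTestFunction hΦ hinv hsq hf),
      hβ.integral_tiltedConv_self hΦ hinv hsq hf⟩
  obtain ⟨ν, hν⟩ := hpos.exists_isFourierTransform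
  exact ⟨ν, β, hβ, hν⟩

theorem ae_integral_sub (hΦ : Measurable Φ) (hinv : IsInvariantRCM Φ)
    (hsq : IsLocallySquareIntegrable P Φ) {f g : Rd d → ℂ} (hf : Integrable f)
    (hg : Integrable g) : ∀ᵐ ω ∂P, (Φ ω).integral (fun x => f x - g x) =
      (Φ ω).integral f - (Φ ω).integral g := by
  filter_upwards [ae_integrable_part hΦ hinv hsq hf, ae_integrable_part hΦ hinv hsq hg]
    with ω h1 h2
  simp_rw [LocComplexMeasure.integral_eq_sum, ← Finset.sum_sub_distrib, ← mul_sub]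
  refine Finset.sum_congr rfl fun j _ => ?_
  rw [integral_sub (h1 j) (h2 j)]

theorem tendsto_integral_of_tendsto_integral_norm_sub {f : Rd d → ℂ} {g : ℕ → Rd d → ℂ}
    (hf : Integrable f) (hg : ∀ n, Integrable (g n))
    (h : Tendsto (fun n => ∫ x, ‖g n x - f x‖) atTop (𝓝 0)) :
    Tendsto (fun n => ∫ x, g n x) atTop (𝓝 (∫ x, f x)) := by
  rw [tendsto_iff_norm_sub_tendsto_zero]
  refine squeeze_zero (fun n => norm_nonneg _) (fun n => ?_) h
  rw [← integral_sub (hg n) hf]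
  exact norm_integral_le_integral_norm _

namespace IsBartlettSpectralMeasure

variable {ν : Measure (Rd d)}

theorem integral_norm_sq_of_isTestFunction (hΦ : Measurable Φ) (hinv : IsInvariantRCM Φ)
    (hsq : IsLocallySquareIntegrable P Φ) (hν : IsBartlettSpectralMeasure P Φ ν) {f : Rd d → ℂ}
    (hf : IsTestFunction f) : ∫ ω, ‖(Φ ω).integral f‖ ^ 2 ∂P =
      (∫ k, ‖fourierHat f k‖ ^ 2 ∂ν) + ‖intensity P Φ * ∫ x, f x‖ ^ 2 := by
  obtain ⟨β, hβ, hν⟩ := hν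
  have h1 := hν.integral_tiltedConv_self hf
  rw [hβ.integral_tiltedConv_self hΦ hinv hsq hf, Complex.ofReal_inj, complexVariance,
    integral_integral_eq_intensity_mul hΦ hinv hsq (hf.integrable _)] at h1
  linarith

/-- The upper bound in the spectral isometry, by Fatou's lemma. -/
theorem memLp_and_integral_norm_sq_le (hΦ : Measurable Φ) (hinv : IsInvariantRCM Φ)
    (hsq : IsLocallySquareIntegrable P Φ) (hν : IsBartlettSpectralMeasure P Φ ν) {f : Rd d → ℂ}
    (hf : Integrable f) (hf2 : MemLp (fourierHat f) 2 ν) :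
    MemLp (fun ω => (Φ ω).integral f) 2 P ∧ ∫ ω, ‖(Φ ω).integral f‖ ^ 2 ∂P ≤
      (∫ k, ‖fourierHat f k‖ ^ 2 ∂ν) + ‖intensity P Φ * ∫ x, f x‖ ^ 2 := by
  have hν' := hν
  obtain ⟨β, hβ, hβν⟩ := hν
  obtain ⟨g, hg, hg1, hg2⟩ := exists_isTestFunction_seq
    (fun n => hβν.memLp (isTestFunction_mollifier d n)) hf hf2
  have hgi := fun n => (hg n).integrable (volume : Measure (Rd d))
  have hX := integrable_integral hΦ hinv hsq hf
  have hXn := fun n => integrable_integral hΦ hinv hsq (hgi n)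
  obtain ⟨C, hC0, hC⟩ := integral_norm_integral_le hΦ hinv hsq
  -- The first moment bound turns `L¹` convergence of the functions into `L¹` convergence of the
  -- linear statistics. Fatou's lemma is then used along an almost surely convergent subsequence.
  have hL1 : Tendsto (fun n => eLpNorm
      ((fun ω => (Φ ω).integral (g n)) - fun ω => (Φ ω).integral f) 1 P) atTop (𝓝 0) := by
    have h0 : Tendsto (fun n => ENNReal.ofReal (C * ∫ x, ‖g n x - f x‖)) atTop (𝓝 0) := by
      have := ENNReal.tendsto_ofReal (hg1.const_mul C)
      rwa [mul_zero, ENNReal.ofReal_zero] at this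
    refine tendsto_of_tendsto_of_tendsto_of_le_of_le tendsto_const_nhds h0 (fun n => zero_le)
      fun n => ?_
    have hi := integrable_integral hΦ hinv hsq ((hgi n).sub hf)
    rw [eLpNorm_one_eq_lintegral_enorm]
    calc _ = ∫⁻ ω, ‖(Φ ω).integral (fun x => g n x - f x)‖ₑ ∂P := by
          refine lintegral_congr_ae ?_
          filter_upwards [ae_integral_sub hΦ hinv hsq (hgi n) hf] with ω hω
          rw [hω]; rfl
      _ = ENNReal.ofReal (∫ ω, ‖(Φ ω).integral (fun x => g n x - f x)‖ ∂P) :=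
          (ofReal_integral_norm_eq_lintegral_enorm hi).symm
      _ ≤ _ := ENNReal.ofReal_le_ofReal (hC _ ((hgi n).sub hf))
  obtain ⟨φ, hφ, hφlim⟩ := (tendstoInMeasure_of_tendsto_eLpNorm one_ne_zero
    (fun n => (hXn n).aestronglyMeasurable) hX.aestronglyMeasurable hL1).exists_seq_tendsto_ae
  set M := (∫ k, ‖fourierHat f k‖ ^ 2 ∂ν) + ‖intensity P Φ * ∫ x, f x‖ ^ 2 with hM
  have hM0 : 0 ≤ M := by positivity
  have hMlim : Tendsto (fun n => ∫ ω, ‖(Φ ω).integral (g n)‖ ^ 2 ∂P) atTop (𝓝 M) := by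
    simp_rw [fun n => hν'.integral_norm_sq_of_isTestFunction hΦ hinv hsq (hg n)]
    exact (tendsto_integral_norm_sq (fun n => hβν.memLp (hg n)) hf2 hg2).add
      (((tendsto_integral_of_tendsto_integral_norm_sub hf hgi hg1).const_mul _).norm.pow 2)
  have hmem := fun n => memLp_integral_of_isTestFunction hΦ hinv hsq (hg n)
  have hle : ∫⁻ ω, ENNReal.ofReal (‖(Φ ω).integral f‖ ^ 2) ∂P ≤ ENNReal.ofReal M := by
    have h1 : ∫⁻ ω, ENNReal.ofReal (‖(Φ ω).integral f‖ ^ 2) ∂P ≤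
        liminf (fun n => ∫⁻ ω, ENNReal.ofReal (‖(Φ ω).integral (g (φ n))‖ ^ 2) ∂P) atTop := by
      refine le_trans (lintegral_mono_ae ?_) (lintegral_liminf_le' fun n =>
        (((hXn (φ n)).aestronglyMeasurable.norm.aemeasurable.pow_const 2).ennreal_ofReal))
      filter_upwards [hφlim] with ω hω
      exact (ENNReal.tendsto_ofReal (hω.norm.pow 2)).liminf_eq.ge
    have h2 := (ENNReal.tendsto_ofReal (hMlim.comp hφ.tendsto_atTop)).liminf_eq
    refine h1.trans (le_of_eq (Eq.trans ?_ h2))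
    congr 1
    funext n
    exact (ofReal_integral_eq_lintegral_ofReal
      ((memLp_two_iff_integrable_sq_norm (hmem (φ n)).1).1 (hmem (φ n)))
      (ae_of_all _ fun ω => by positivity)).symm
  have hmeas : AEStronglyMeasurable (fun ω => ‖(Φ ω).integral f‖ ^ 2) P :=
    hX.aestronglyMeasurable.norm.pow 2
  have hint : Integrable (fun ω => ‖(Φ ω).integral f‖ ^ 2) P := by
    refine ⟨hmeas, ?_⟩
    rw [hasFiniteIntegral_iff_ofReal (ae_of_all _ fun ω => by positivity)]
    exact hle.trans_lt ENNReal.ofReal_lt_top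
  refine ⟨(memLp_two_iff_integrable_sq_norm hX.aestronglyMeasurable).2 hint, ?_⟩
  rw [← ofReal_integral_eq_lintegral_ofReal hint (ae_of_all _ fun ω => by positivity)] at hle
  exact (ENNReal.ofReal_le_ofReal_iff hM0).1 hle

/-- The spectral isometry: `V[Φ(f)] = ∫ |f̂|² dν`. -/
theorem complexVariance_eq (hΦ : Measurable Φ) (hinv : IsInvariantRCM Φ)
    (hsq : IsLocallySquareIntegrable P Φ) (hν : IsBartlettSpectralMeasure P Φ ν) {f : Rd d → ℂ}
    (hf : Integrable f) (hf2 : MemLp (fourierHat f) 2 ν) :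
    complexVariance P (fun ω => (Φ ω).integral f) = ∫ k, ‖fourierHat f k‖ ^ 2 ∂ν := by
  have hν' := hν
  obtain ⟨β, hβ, hβν⟩ := hν
  obtain ⟨g, hg, hg1, hg2⟩ := exists_isTestFunction_seq
    (fun n => hβν.memLp (isTestFunction_mollifier d n)) hf hf2
  have hgi := fun n => (hg n).integrable (volume : Measure (Rd d))
  have hmem := fun n => memLp_integral_of_isTestFunction hΦ hinv hsq (hg n)
  have hX := (hν'.memLp_and_integral_norm_sq_le hΦ hinv hsq hf hf2).1
  have hIlim := tendsto_integral_of_tendsto_integral_norm_sub hf hgi hg1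
  have hMlim : Tendsto (fun n => ∫ ω, ‖(Φ ω).integral (g n)‖ ^ 2 ∂P) atTop
      (𝓝 ((∫ k, ‖fourierHat f k‖ ^ 2 ∂ν) + ‖intensity P Φ * ∫ x, f x‖ ^ 2)) := by
    simp_rw [fun n => hν'.integral_norm_sq_of_isTestFunction hΦ hinv hsq (hg n)]
    exact (tendsto_integral_norm_sq (fun n => hβν.memLp (hg n)) hf2 hg2).add
      ((hIlim.const_mul _).norm.pow 2)
  -- The Fatou bound, applied to `g n - f`, gives convergence of the statistics in `L²(P)` and thus
  -- of their second moments.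
  have hXlim : Tendsto (fun n => ∫ ω, ‖(Φ ω).integral (g n)‖ ^ 2 ∂P) atTop
      (𝓝 (∫ ω, ‖(Φ ω).integral f‖ ^ 2 ∂P)) := by
    refine tendsto_integral_norm_sq hmem hX ?_
    have hlim : Tendsto (fun n => (∫ k, ‖fourierHat (g n) k - fourierHat f k‖ ^ 2 ∂ν) +
        ‖intensity P Φ * ((∫ x, g n x) - ∫ x, f x)‖ ^ 2) atTop (𝓝 (0 + ‖intensity P Φ *
          ((∫ x, f x) - ∫ x, f x)‖ ^ 2)) :=
      hg2.add (((hIlim.sub_const _).const_mul _).norm.pow 2)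
    rw [sub_self, mul_zero, norm_zero, zero_pow two_ne_zero, add_zero] at hlim
    refine squeeze_zero (fun n => by positivity) (fun n => ?_) hlim
    have e : fourierHat (fun x => g n x - f x) = fun k => fourierHat (g n) k - fourierHat f k :=
      funext fun k => fourierHat_sub (hgi n) hf k
    have hm2 : MemLp (fourierHat fun x => g n x - f x) 2 ν := by
      rw [e]; exact (hβν.memLp (hg n)).sub hf2
    have h := (hν'.memLp_and_integral_norm_sq_le hΦ hinv hsq
      (f := fun x => g n x - f x) ((hgi n).sub hf) hm2).2
    calc _ = ∫ ω, ‖(Φ ω).integral (fun x => g n x - f x)‖ ^ 2 ∂P := by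
          refine integral_congr_ae ?_
          filter_upwards [ae_integral_sub hΦ hinv hsq (hgi n) hf] with ω hω
          rw [hω]
      _ ≤ _ := h
      _ = _ := by

          rw [e, integral_sub (hgi n) hf]
  rw [complexVariance, integral_integral_eq_intensity_mul hΦ hinv hsq hf,
    tendsto_nhds_unique hXlim hMlim, add_sub_cancel_right]

end IsBartlettSpectralMeasure

end SpectralIsometry

/-! ### Integrals of dilated Fourier-smooth transforms against translation bounded measures -/

section FourierSmooth

variable {d : ℕ}

theorem enorm_sq_eq_ofReal (z : ℂ) : ‖z‖ₑ ^ 2 = ENNReal.ofReal (‖z‖ ^ 2) := by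
  rw [← ofReal_norm, ENNReal.ofReal_pow (norm_nonneg _)]

namespace IsFourierSmooth

variable {f : Rd d → ℂ} {q : ℝ}

theorem exists_norm_sq_le (hf : IsFourierSmooth f q) : ∃ c : ℝ, 0 < c ∧ ∀ k,
    ‖fourierHat f k‖ ^ 2 ≤ c * (1 + ‖k‖) ^ (-((d : ℝ) + q)) := by
  obtain ⟨c, hc, h⟩ := hf.decay
  refine ⟨c ^ 2, by positivity, fun k => ?_⟩
  refine (pow_le_pow_left₀ (norm_nonneg _) (h k) 2).trans_eq ?_
  rw [div_pow, div_eq_mul_inv, Real.rpow_neg (by positivity), ← Real.rpow_natCast,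
    ← Real.rpow_natCast (_ ^ _), ← Real.rpow_mul (by positivity)]
  norm_num

/-- The averaged tail bound holds for all exponents. -/
theorem exists_tail_le (hf : IsFourierSmooth f q) (hq : 0 < (d : ℝ) + q) :
    ∃ C : ℝ, 0 ≤ C ∧ ∀ᶠ r : ℝ in atTop, ∫⁻ k in (Metric.ball (0 : Rd d) 2)ᶜ,
        (⨆ s ∈ Metric.ball (0 : Rd d) 1, ‖fourierHat f (r • (k + s))‖ₑ ^ 2) ≤
      ENNReal.ofReal (C * r ^ (-((d : ℝ) + q))) := by
  rcases le_or_gt q 0 with h | h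
  · obtain ⟨C, hC⟩ := hf.tail h
    refine ⟨|C|, abs_nonneg C, ?_⟩
    filter_upwards [hC, eventually_gt_atTop 0] with r hr h0
    exact hr.trans (ENNReal.ofReal_le_ofReal
      (mul_le_mul_of_nonneg_right (le_abs_self C) (by positivity)))
  -- For `q > 0` the pointwise decay suffices, since `(1 + ‖k‖)^(-(d+q))` is integrable. The factor
  -- `1 / 3` comes from `1 + r ‖k + s‖ ≥ r (1 + ‖k‖) / 3`, valid for `‖k‖ ≥ 2` and `‖s‖ < 1`.
  · obtain ⟨c, hc, hfc⟩ := hf.exists_norm_sq_le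
    have hi : Integrable fun k : Rd d => (1 + ‖k‖) ^ (-((d : ℝ) + q)) :=
      integrable_one_add_norm (by simp; exact h)
    refine ⟨c * (3⁻¹ : ℝ) ^ (-((d : ℝ) + q)) * ∫ k : Rd d, (1 + ‖k‖) ^ (-((d : ℝ) + q)),
      by positivity, ?_⟩
    filter_upwards [eventually_gt_atTop 0] with r hr
    have hpt : ∀ k ∈ (Metric.ball (0 : Rd d) 2)ᶜ,
        (⨆ s ∈ Metric.ball (0 : Rd d) 1, ‖fourierHat f (r • (k + s))‖ₑ ^ 2) ≤
        ENNReal.ofReal (c * (3⁻¹ : ℝ) ^ (-((d : ℝ) + q)) * r ^ (-((d : ℝ) + q)) *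
          (1 + ‖k‖) ^ (-((d : ℝ) + q))) := by
      intro k hk
      rw [Set.mem_compl_iff, mem_ball_zero_iff, not_lt] at hk
      refine iSup₂_le fun s hs => ?_
      rw [mem_ball_zero_iff] at hs
      rw [enorm_sq_eq_ofReal]
      refine ENNReal.ofReal_le_ofReal ((hfc _).trans ?_)
      rw [mul_assoc, mul_assoc]
      refine mul_le_mul_of_nonneg_left ?_ hc.le
      rw [← Real.mul_rpow hr.le (by positivity), ← Real.mul_rpow (by positivity) (by positivity)]
      refine Real.rpow_le_rpow_of_nonpos (by positivity) ?_ (by linarith)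
      rw [norm_smul, Real.norm_of_nonneg hr.le]
      have h1 : ‖k‖ ≤ ‖k + s‖ + ‖s‖ := by
        calc ‖k‖ = ‖(k + s) - s‖ := by simp
          _ ≤ _ := norm_sub_le _ _
      nlinarith
    calc _ ≤ ∫⁻ k in (Metric.ball (0 : Rd d) 2)ᶜ, ENNReal.ofReal (c *
          (3⁻¹ : ℝ) ^ (-((d : ℝ) + q)) * r ^ (-((d : ℝ) + q)) * (1 + ‖k‖) ^ (-((d : ℝ) + q))) :=
          setLIntegral_mono' Metric.isOpen_ball.measurableSet.compl hpt
      _ ≤ ∫⁻ k, ENNReal.ofReal (c *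
          (3⁻¹ : ℝ) ^ (-((d : ℝ) + q)) * r ^ (-((d : ℝ) + q)) * (1 + ‖k‖) ^ (-((d : ℝ) + q))) :=
          setLIntegral_le_lintegral _ _
      _ = _ := by
          rw [← ofReal_integral_eq_lintegral_ofReal (hi.const_mul _)
            (ae_of_all _ fun k => by positivity), integral_const_mul]
          congr 1
          ring

theorem continuous_enorm_sq (hf : IsFourierSmooth f q) (r : ℝ) :
    Continuous fun k : Rd d => ‖fourierHat f (r • k)‖ₑ ^ 2 := by
  have h := (continuous_fourierHat hf.integrable).comp (continuous_const_smul r)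
  exact (ENNReal.continuous_pow 2).comp h.enorm

/-- The contribution of high frequencies, with a threshold that does not depend on the measure. -/
theorem exists_lintegral_compl_ball_le (hf : IsFourierSmooth f q) (hq : 0 < (d : ℝ) + q) :
    ∃ T : ℝ, 0 ≤ T ∧ ∀ᶠ r : ℝ in atTop, ∀ (ν : Measure (Rd d)) (_ : IsLocallyFiniteMeasure ν)
      (C : ℝ≥0∞), (∀ x, ν (Metric.ball x 1) ≤ C) →
      ∫⁻ k in (Metric.ball (0 : Rd d) 3)ᶜ, ‖fourierHat f (r • k)‖ₑ ^ 2 ∂ν ≤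
        C / volume (Metric.ball (0 : Rd d) 1) * ENNReal.ofReal (T * r ^ (-((d : ℝ) + q))) := by
  obtain ⟨T, hT0, hT⟩ := hf.exists_tail_le hq
  refine ⟨T, hT0, ?_⟩
  filter_upwards [hT] with r hr ν _ C hν
  have hm : ∀ R, MeasurableSet (Metric.ball (0 : Rd d) R)ᶜ := fun R =>
    Metric.isOpen_ball.measurableSet.compl
  -- The supremum runs over uncountably many `s`; it is measurable as a lower semicontinuous
  -- function.
  have hsup : Measurable fun k : Rd d =>
      ⨆ s ∈ Metric.ball (0 : Rd d) 1, ‖fourierHat f (r • (k + s))‖ₑ ^ 2 :=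
    (lowerSemicontinuous_biSup fun s _ => ((hf.continuous_enorm_sq r).comp
      (continuous_id.add continuous_const)).lowerSemicontinuous).measurable
  calc _ = ∫⁻ k, (Metric.ball (0 : Rd d) 3)ᶜ.indicator
        (fun k => ‖fourierHat f (r • k)‖ₑ ^ 2) k ∂ν := (lintegral_indicator (hm 3) _).symm
    _ ≤ C / volume (Metric.ball (0 : Rd d) 1) * ∫⁻ k, (Metric.ball (0 : Rd d) 2)ᶜ.indicator (fun k =>
        ⨆ s ∈ Metric.ball (0 : Rd d) 1, ‖fourierHat f (r • (k + s))‖ₑ ^ 2) k := by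
        refine lintegral_le_of_measure_ball_le hν
          ((hf.continuous_enorm_sq r).measurable.indicator (hm 3)) (hsup.indicator (hm 2))
          fun x y hxy => ?_
        -- Radius 3 leaves room for a shift of length below one that stays outside `B_2`, where the
        -- tail bound is available.
        by_cases hx : x ∈ (Metric.ball (0 : Rd d) 3)ᶜ
        · rw [dist_eq_norm] at hxy
          have hy : y ∈ (Metric.ball (0 : Rd d) 2)ᶜ := by
            rw [Set.mem_compl_iff, mem_ball_zero_iff, not_lt] at *
            have : ‖x‖ ≤ ‖x - y‖ + ‖y‖ := by
              calc ‖x‖ = ‖(x - y) + y‖ := by simp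
                _ ≤ _ := norm_add_le _ _
            linarith
          rw [Set.indicator_of_mem hx, Set.indicator_of_mem hy]
          refine le_trans (le_of_eq ?_) (le_iSup₂ (x - y) (mem_ball_zero_iff.2 hxy))
          rw [add_sub_cancel]
        · rw [Set.indicator_of_notMem hx]
          exact zero_le
    _ ≤ _ := by
        rw [lintegral_indicator (hm 2)]
        gcongr

/-- The threshold for `r` is fixed before `ν`, so that `ν` may afterwards be replaced by a dilate
depending on `r`. -/
theorem eventually_lintegral_lt_top (hf : IsFourierSmooth f q) (hq : 0 < (d : ℝ) + q) :
    ∀ᶠ r : ℝ in atTop, ∀ (ν : Measure (Rd d)) (_ : IsLocallyFiniteMeasure ν) (C : ℝ≥0∞), C ≠ ∞ →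
      (∀ x, ν (Metric.ball x 1) ≤ C) → ∫⁻ k, ‖fourierHat f (r • k)‖ₑ ^ 2 ∂ν < ∞ := by
  obtain ⟨T, hT0, hT⟩ := hf.exists_lintegral_compl_ball_le hq
  filter_upwards [hT] with r hr ν hνf C hC hν
  rw [← lintegral_add_compl _ (Metric.isOpen_ball (x := (0 : Rd d)) (ε := 3)).measurableSet]
  refine ENNReal.add_lt_top.2 ⟨?_, (hr ν hνf C hν).trans_lt (ENNReal.mul_lt_top
    (ENNReal.div_lt_top hC (Metric.measure_ball_pos _ _ one_pos).ne') ENNReal.ofReal_lt_top)⟩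
  refine setLIntegral_lt_top_of_le_nnreal Metric.isBounded_ball.measure_lt_top.ne
    ⟨(Real.toNNReal (∫ x, ‖f x‖)) ^ 2, fun k _ => ?_⟩
  rw [← ofReal_norm, ENNReal.coe_pow]
  exact pow_le_pow_left₀ zero_le (ENNReal.ofReal_le_ofReal (norm_fourierHat_le f _)) 2

end IsFourierSmooth

/-- Translation bounded measures have uniformly bounded mass on balls of any radius. -/
theorem exists_measure_ball_le_of_unit_ball {ν : Measure (Rd d)} {C : ℝ}
    (hν : ∀ x, ν (Metric.ball x 1) ≤ ENNReal.ofReal C) (R : ℝ) :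
    ∃ C' : ℝ, ∀ x, ν (Metric.ball x R) ≤ ENNReal.ofReal C' := by
  obtain ⟨t, ht, hcov⟩ := Metric.totallyBounded_iff.1
    (isCompact_closedBall (0 : Rd d) R).totallyBounded 1 one_pos
  refine ⟨ht.toFinset.card * |C|, fun x => ?_⟩
  have hsub : Metric.ball x R ⊆ ⋃ y ∈ ht.toFinset, Metric.ball (x + y) 1 := by
    intro z hz
    have h1 : z - x ∈ Metric.closedBall (0 : Rd d) R := by
      rw [mem_closedBall_zero_iff, ← dist_eq_norm]
      exact (Metric.mem_ball.1 hz).le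
    obtain ⟨y, hy, hzy⟩ := Set.mem_iUnion₂.1 (hcov h1)
    refine Set.mem_iUnion₂.2 ⟨y, ht.mem_toFinset.2 hy, ?_⟩
    rw [Metric.mem_ball, dist_eq_norm] at hzy ⊢
    rwa [sub_add_eq_sub_sub]
  calc ν (Metric.ball x R) ≤ ∑ y ∈ ht.toFinset, ν (Metric.ball (x + y) 1) :=
        (measure_mono hsub).trans (measure_biUnion_finset_le _ _)
    _ ≤ ∑ _y ∈ ht.toFinset, ENNReal.ofReal |C| := Finset.sum_le_sum fun y _ =>
        (hν _).trans (ENNReal.ofReal_le_ofReal (le_abs_self C))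
    _ = _ := by
        rw [Finset.sum_const, nsmul_eq_mul, ENNReal.ofReal_mul (by positivity),
          ENNReal.ofReal_natCast]

namespace IsFourierSmooth

variable {f : Rd d → ℂ} {q : ℝ}

/-- The tail bound is only available for large `r`. Writing `f̂(r k) = f̂(r' (r / r') k)` with an
admissible `r'` moves the dilation into the measure, whose push-forward is again translation
bounded. -/
theorem lintegral_enorm_sq_lt_top (hf : IsFourierSmooth f q) (hq : 0 < (d : ℝ) + q)
    {ν : Measure (Rd d)} [IsLocallyFiniteMeasure ν] {C : ℝ}
    (hν : ∀ x, ν (Metric.ball x 1) ≤ ENNReal.ofReal C) {r : ℝ} (hr : 0 < r) :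
    ∫⁻ k, ‖fourierHat f (r • k)‖ₑ ^ 2 ∂ν < ∞ := by
  obtain ⟨r', hr', h0⟩ := ((hf.eventually_lintegral_lt_top hq).and (eventually_gt_atTop 0)).exists
  obtain ⟨C', hC'⟩ := exists_measure_ball_le_of_unit_ball hν (r' / r)
  have hs : Continuous fun k : Rd d => (r / r') • k := continuous_const_smul _
  have hb : ∀ x, ν.map (fun k => (r / r') • k) (Metric.ball x 1) ≤ ENNReal.ofReal C' := fun x => by
    rw [Measure.map_apply hs.measurable Metric.isOpen_ball.measurableSet]
    refine le_trans (measure_mono fun k hk => ?_) (hC' ((r' / r) • x))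
    rw [Set.mem_preimage, Metric.mem_ball, dist_eq_norm] at hk
    rw [Metric.mem_ball, dist_eq_norm]
    have e : k - (r' / r) • x = (r' / r) • ((r / r') • k - x) := by
      rw [smul_sub, smul_smul]
      have : r' / r * (r / r') = 1 := by field_simp
      rw [this, one_smul]
    rw [e, norm_smul, Real.norm_of_nonneg (by positivity)]
    exact mul_lt_of_lt_one_right (by positivity) hk
  have hloc : IsLocallyFiniteMeasure (ν.map fun k => (r / r') • k) :=
    ⟨fun x => ⟨Metric.ball x 1, Metric.ball_mem_nhds _ one_pos,
      (hb x).trans_lt ENNReal.ofReal_lt_top⟩⟩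
  have h1 := hr' _ hloc _ ENNReal.ofReal_ne_top hb
  rw [lintegral_map (hf.continuous_enorm_sq r').measurable hs.measurable] at h1
  have e : r' * (r / r') = r := by field_simp
  simpa only [smul_smul, e] using h1

/-- The contribution of low frequencies, if `ν(B_ε) ≤ A ε^a` near `0`. -/
theorem exists_lintegral_ball_le (hf : IsFourierSmooth f q) {a : ℝ} (ha : 0 ≤ a)
    (haq : a < d + q) : ∃ K : ℝ, 0 ≤ K ∧ ∀ (ν : Measure (Rd d)) (A ε₀ : ℝ), 0 ≤ A → 0 < ε₀ →
      (∀ ε, 0 < ε → ε ≤ ε₀ → ν (Metric.ball 0 ε) ≤ ENNReal.ofReal (A * ε ^ a)) → ∀ r, 0 < r →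
      ∫⁻ k in Metric.ball (0 : Rd d) ε₀, ‖fourierHat f (r • k)‖ₑ ^ 2 ∂ν ≤
        ENNReal.ofReal (K * A * r ^ (-a)) := by
  obtain ⟨c, hc, hfc⟩ := hf.exists_norm_sq_le
  set b : ℝ := d + q with hb
  -- The gap `a < b`, which is `ϑ > 0` in the application, makes the dyadic series converge.
  have hsum : Summable fun j : ℕ => ((2 : ℝ) ^ (a - b)) ^ j :=
    summable_geometric_of_lt_one (by positivity)
      (Real.rpow_lt_one_of_one_lt_of_neg one_lt_two (by linarith))
  refine ⟨c * 2 ^ b * ∑' j : ℕ, ((2 : ℝ) ^ (a - b)) ^ j, by positivity,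
    fun ν A ε₀ hA hε₀ hν r hr => ?_⟩
  -- Dyadic domination: the decay makes the left side at most a constant times `2^(-b j)` when `2^j`
  -- is comparable to `1 + r ‖k‖`. Summing over all `j` avoids selecting one measurably in `k`.
  have hpt : ∀ k : Rd d, ‖fourierHat f (r • k)‖ₑ ^ 2 ≤ ∑' j : ℕ,
      (Metric.ball (0 : Rd d) (2 ^ j / r)).indicator
        (fun _ => ENNReal.ofReal (c * 2 ^ b * ((2 : ℝ) ^ (-b)) ^ j)) k := by
    intro k
    -- The smallest `j` with `r ‖k‖ < 2^j`; the summand 1 in the second bound covers `j = 0`.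
    obtain ⟨j, hj, hj'⟩ : ∃ j : ℕ, r * ‖k‖ < 2 ^ j ∧ (2 : ℝ) ^ j ≤ 2 * (1 + r * ‖k‖) := by
      have hex : ∃ j : ℕ, r * ‖k‖ < 2 ^ j := pow_unbounded_of_one_lt _ one_lt_two
      classical
      refine ⟨Nat.find hex, Nat.find_spec hex, ?_⟩
      have h0 : 0 ≤ r * ‖k‖ := by positivity
      rcases Nat.eq_zero_or_pos (Nat.find hex) with h | h
      · rw [h, pow_zero]; linarith
      · have h1 := Nat.find_min hex (Nat.sub_lt h one_pos)
        rw [not_lt] at h1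
        obtain ⟨m, hm⟩ := Nat.exists_eq_succ_of_ne_zero h.ne'
        rw [hm, Nat.succ_sub_one] at h1
        rw [hm, pow_succ]
        linarith
    refine le_trans ?_ (ENNReal.le_tsum j)
    have hkj : k ∈ Metric.ball (0 : Rd d) (2 ^ j / r) := by
      rw [mem_ball_zero_iff, lt_div_iff₀ hr]; linarith
    rw [Set.indicator_of_mem hkj, enorm_sq_eq_ofReal]
    refine ENNReal.ofReal_le_ofReal ((hfc _).trans ?_)
    rw [norm_smul, Real.norm_of_nonneg hr.le, mul_assoc]
    refine mul_le_mul_of_nonneg_left ?_ hc.le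
    have h2 : (1 + r * ‖k‖) ^ (-b) ≤ ((2 : ℝ) ^ j / 2) ^ (-b) :=
      Real.rpow_le_rpow_of_nonpos (by positivity) (by linarith) (by linarith)
    refine h2.trans_eq ?_
    rw [Real.div_rpow (by positivity) zero_le_two, ← Real.rpow_pow_comm zero_le_two,
      Real.rpow_neg zero_le_two, div_inv_eq_mul, mul_comm]
  -- Dyadic balls exceeding `B_ε₀` are cut off at `ε₀`, and since `a ≥ 0` the bound at `ε₀` is below
  -- the one claimed.
  have hball : ∀ j : ℕ, ν (Metric.ball (0 : Rd d) (2 ^ j / r) ∩ Metric.ball 0 ε₀) ≤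
      ENNReal.ofReal (A * (2 ^ j / r) ^ a) := by
    intro j
    rcases le_total ((2 : ℝ) ^ j / r) ε₀ with h | h
    · exact (measure_mono Set.inter_subset_left).trans (hν _ (by positivity) h)
    · refine (measure_mono Set.inter_subset_right).trans ((hν _ hε₀ le_rfl).trans
        (ENNReal.ofReal_le_ofReal (mul_le_mul_of_nonneg_left
          (Real.rpow_le_rpow hε₀.le h ha) hA)))
  calc _ ≤ ∫⁻ k in Metric.ball (0 : Rd d) ε₀, ∑' j : ℕ,
        (Metric.ball (0 : Rd d) (2 ^ j / r)).indicator
          (fun _ => ENNReal.ofReal (c * 2 ^ b * ((2 : ℝ) ^ (-b)) ^ j)) k ∂ν :=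
        lintegral_mono fun k => hpt k
    _ = ∑' j : ℕ, ENNReal.ofReal (c * 2 ^ b * ((2 : ℝ) ^ (-b)) ^ j) *
        ν (Metric.ball (0 : Rd d) (2 ^ j / r) ∩ Metric.ball 0 ε₀) := by
        rw [lintegral_tsum fun j =>
          (measurable_const.indicator Metric.isOpen_ball.measurableSet).aemeasurable]
        refine tsum_congr fun j => ?_
        rw [lintegral_indicator_const Metric.isOpen_ball.measurableSet,
          Measure.restrict_apply Metric.isOpen_ball.measurableSet]
    _ ≤ ∑' j : ℕ, ENNReal.ofReal (c * 2 ^ b * A * r ^ (-a) * ((2 : ℝ) ^ (a - b)) ^ j) := by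
        refine ENNReal.tsum_le_tsum fun j => (mul_le_mul_right (hball j) _).trans_eq ?_
        rw [← ENNReal.ofReal_mul (by positivity)]
        congr 1
        have e : (2 : ℝ) ^ (a - b) = 2 ^ a * 2 ^ (-b) := by
          rw [← Real.rpow_add two_pos, sub_eq_add_neg]
        rw [Real.div_rpow (by positivity) hr.le, Real.rpow_neg hr.le, e, mul_pow,
          ← Real.rpow_pow_comm zero_le_two]
        ring
    _ = _ := by
        rw [← ENNReal.ofReal_tsum_of_nonneg (fun j => by positivity) (hsum.mul_left _),
          tsum_mul_left]
        congr 1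
        ring

/-- The integral `∫ |f̂(r k)|² ν(dk)` if `ν(B_ε) ≤ A ε^a` near `0`. -/
theorem exists_integral_norm_sq_le (hf : IsFourierSmooth f q) {a : ℝ} (ha : 0 ≤ a)
    (haq : a < d + q) {ν : Measure (Rd d)} [IsLocallyFiniteMeasure ν] {C : ℝ}
    (hν : ∀ x, ν (Metric.ball x 1) ≤ ENNReal.ofReal C) :
    ∃ K : ℝ, 0 ≤ K ∧ ∀ A ε₀ : ℝ, 0 ≤ A → 0 < ε₀ →
      (∀ ε, 0 < ε → ε ≤ ε₀ → ν.real (Metric.ball 0 ε) ≤ A * ε ^ a) → ∃ D : ℝ, 0 ≤ D ∧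
      ∀ᶠ r : ℝ in atTop, ∫ k, ‖fourierHat f (r • k)‖ ^ 2 ∂ν ≤
        K * A * r ^ (-a) + D * r ^ (-((d : ℝ) + q)) := by
  obtain ⟨K, hK0, hK⟩ := hf.exists_lintegral_ball_le ha haq
  obtain ⟨T, hT0, hT⟩ := hf.exists_lintegral_compl_ball_le (ha.trans_lt haq)
  obtain ⟨c, hc, hfc⟩ := hf.exists_norm_sq_le
  refine ⟨K, hK0, fun A ε₀ hA hε₀ hνA => ?_⟩
  set V : ℝ≥0∞ := ENNReal.ofReal C / volume (Metric.ball (0 : Rd d) 1) with hV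
  have hVfin : V ≠ ∞ := (ENNReal.div_lt_top ENNReal.ofReal_ne_top
    (Metric.measure_ball_pos _ _ one_pos).ne').ne
  set b : ℝ := d + q with hb
  -- `D` collects the shell between the radii `ε₀` and `3`, bounded by pointwise decay, and the far
  -- field, bounded by local suprema. Unlike `K` it depends on `ε₀`.
  refine ⟨c * ε₀ ^ (-b) * ν.real (Metric.ball 0 3) + V.toReal * T, by positivity, ?_⟩
  filter_upwards [hT, eventually_gt_atTop 0] with r hr h0
  have hmid : ∫⁻ k in (Metric.ball (0 : Rd d) ε₀)ᶜ ∩ Metric.ball 0 3,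
      ‖fourierHat f (r • k)‖ₑ ^ 2 ∂ν ≤
      ENNReal.ofReal (c * ε₀ ^ (-b) * r ^ (-b) * ν.real (Metric.ball 0 3)) := by
    have hms : MeasurableSet ((Metric.ball (0 : Rd d) ε₀)ᶜ ∩ Metric.ball 0 3) :=
      Metric.isOpen_ball.measurableSet.compl.inter Metric.isOpen_ball.measurableSet
    calc _ ≤ ∫⁻ k in (Metric.ball (0 : Rd d) ε₀)ᶜ ∩ Metric.ball 0 3,
          ENNReal.ofReal (c * ε₀ ^ (-b) * r ^ (-b)) ∂ν := by
          refine setLIntegral_mono' hms fun k hk => ?_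
          have hk1 := hk.1
          rw [Set.mem_compl_iff, mem_ball_zero_iff, not_lt] at hk1
          rw [enorm_sq_eq_ofReal]
          refine ENNReal.ofReal_le_ofReal ((hfc _).trans ?_)
          rw [mul_assoc, ← Real.mul_rpow hε₀.le h0.le]
          refine mul_le_mul_of_nonneg_left (Real.rpow_le_rpow_of_nonpos (by positivity) ?_
            (by linarith)) hc.le
          rw [norm_smul, Real.norm_of_nonneg h0.le]
          nlinarith
      _ = ENNReal.ofReal (c * ε₀ ^ (-b) * r ^ (-b)) *
          ν ((Metric.ball (0 : Rd d) ε₀)ᶜ ∩ Metric.ball 0 3) := setLIntegral_const _ _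
      _ ≤ ENNReal.ofReal (c * ε₀ ^ (-b) * r ^ (-b)) * ν (Metric.ball 0 3) :=
          mul_le_mul_right (measure_mono Set.inter_subset_right) _
      _ = _ := by
          rw [ENNReal.ofReal_mul (p := c * ε₀ ^ (-b) * r ^ (-b)) (by positivity), Measure.real,
            ENNReal.ofReal_toReal Metric.isBounded_ball.measure_lt_top.ne]
  have htot : ∫⁻ k, ENNReal.ofReal (‖fourierHat f (r • k)‖ ^ 2) ∂ν ≤ ENNReal.ofReal
      (K * A * r ^ (-a) + (c * ε₀ ^ (-b) * ν.real (Metric.ball 0 3) + V.toReal * T) *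
        r ^ (-b)) := by
    simp_rw [← enorm_sq_eq_ofReal]
    have hcov : (Set.univ : Set (Rd d)) ⊆ Metric.ball 0 ε₀ ∪
        (((Metric.ball 0 ε₀)ᶜ ∩ Metric.ball 0 3) ∪ (Metric.ball 0 3)ᶜ) := fun k _ => by
      by_cases h1 : k ∈ Metric.ball (0 : Rd d) ε₀
      · exact Or.inl h1
      · by_cases h2 : k ∈ Metric.ball (0 : Rd d) 3
        · exact Or.inr (Or.inl ⟨h1, h2⟩)
        · exact Or.inr (Or.inr h2)
    have hin := hK ν A ε₀ hA hε₀ (fun ε h1 h2 => by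
      rw [← ENNReal.ofReal_toReal (a := ν _) Metric.isBounded_ball.measure_lt_top.ne]
      exact ENNReal.ofReal_le_ofReal (hνA ε h1 h2)) r h0
    have hout : ∫⁻ k in (Metric.ball (0 : Rd d) 3)ᶜ, ‖fourierHat f (r • k)‖ₑ ^ 2 ∂ν ≤
        ENNReal.ofReal (V.toReal * T * r ^ (-b)) := by
      refine (hr ν inferInstance _ hν).trans_eq ?_
      rw [mul_assoc, ENNReal.ofReal_mul ENNReal.toReal_nonneg, ENNReal.ofReal_toReal hVfin]
    calc _ = ∫⁻ k in Set.univ, ‖fourierHat f (r • k)‖ₑ ^ 2 ∂ν := (setLIntegral_univ _).symm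
      _ ≤ _ := lintegral_mono_set hcov
      _ ≤ _ := lintegral_union_le _ _ _
      _ ≤ _ := add_le_add hin ((lintegral_union_le _ _ _).trans (add_le_add hmid hout))
      _ = _ := by
        rw [← ENNReal.ofReal_add (by positivity) (by positivity),
          ← ENNReal.ofReal_add (by positivity) (by positivity)]
        congr 1
        ring
  have hc : Continuous fun k : Rd d => ‖fourierHat f (r • k)‖ ^ 2 :=
    ((continuous_fourierHat hf.integrable).comp (continuous_const_smul r)).norm.pow 2
  rw [integral_eq_lintegral_of_nonneg_ae (ae_of_all _ fun k => by positivity)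
    hc.aestronglyMeasurable]
  exact ENNReal.toReal_le_of_le_ofReal (by positivity) htot

/-- The dilated functions have square integrable Fourier transforms. -/
theorem memLp_fourierHat_spread (hf : IsFourierSmooth f q) (hq : 0 < (d : ℝ) + q)
    {ν : Measure (Rd d)} [IsLocallyFiniteMeasure ν] {C : ℝ}
    (hν : ∀ x, ν (Metric.ball x 1) ≤ ENNReal.ofReal C) {r : ℝ} (hr : 0 < r) :
    MemLp (fourierHat (spread f r)) 2 ν := by
  have e : fourierHat (spread f r) = fun k => (r : ℂ) ^ d * fourierHat f (r • k) :=
    funext fun k => fourierHat_spread f hr k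
  have hc : Continuous fun k : Rd d => fourierHat f (r • k) :=
    (continuous_fourierHat hf.integrable).comp (continuous_const_smul r)
  rw [e]
  refine MemLp.const_mul ?_ _
  rw [memLp_two_iff_integrable_sq_norm hc.aestronglyMeasurable]
  refine ⟨(hc.norm.pow 2).aestronglyMeasurable, ?_⟩
  rw [hasFiniteIntegral_iff_ofReal (ae_of_all _ fun k => by positivity)]
  simp_rw [← enorm_sq_eq_ofReal]
  exact hf.lintegral_enorm_sq_lt_top hq hν hr

end IsFourierSmooth

end FourierSmooth

/-! ### Variance rates and the mass of the spectral measure near the origin -/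

section Asymptotics

variable {d : ℕ} {Ω : Type*} [MeasurableSpace Ω] {Φ : Ω → LocComplexMeasure d} {P : Measure Ω}
  {ν : Measure (Rd d)} {f : Rd d → ℂ} {q p ϑ : ℝ}

theorem IsBartlettSpectralMeasure.isLocallyFiniteMeasure (hν : IsBartlettSpectralMeasure P Φ ν) :
    IsLocallyFiniteMeasure ν := by
  obtain ⟨β, -, h⟩ := hν
  exact h.locFinite

theorem IsBartlettSpectralMeasure.exists_measure_ball_le (hν : IsBartlettSpectralMeasure P Φ ν) :
    ∃ C : ℝ, ∀ x, ν (Metric.ball x 1) ≤ ENNReal.ofReal C := by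
  obtain ⟨β, -, h⟩ := hν
  exact h.exists_measure_ball_le

variable [IsProbabilityMeasure P] [AddAction (Rd d) Ω]
  [MeasurableConstVAdd (Rd d) Ω] [VAddInvariantMeasure (Rd d) Ω P]

/-- First moments of the parts are multiples of Lebesgue measure, so an integrable function is
almost surely integrable for every part, hence for their sum, which dominates the total variation.
-/
theorem ae_integrable_variation (hΦ : Measurable Φ) (hinv : IsInvariantRCM Φ)
    (hsq : IsLocallySquareIntegrable P Φ) (hf : Integrable f) :
    ∀ᵐ ω ∂P, Integrable f (Φ ω).variation := by
  filter_upwards [ae_integrable_part hΦ hinv hsq hf] with ω h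
  refine Integrable.mono_measure ?_ (Φ ω).variation_le_total
  rw [LocComplexMeasure.total]
  exact integrable_finsetSum_measure.2 fun j _ => h j

namespace IsBartlettSpectralMeasure

theorem memLp_integral_spread (hΦ : Measurable Φ) (hinv : IsInvariantRCM Φ)
    (hsq : IsLocallySquareIntegrable P Φ) (hν : IsBartlettSpectralMeasure P Φ ν)
    (hf : IsFourierSmooth f q) (hq : 0 < (d : ℝ) + q) {r : ℝ} (hr : 0 < r) :
    MemLp (fun ω => (Φ ω).integral (spread f r)) 2 P := by
  obtain ⟨C, hC⟩ := hν.exists_measure_ball_le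
  have := hν.isLocallyFiniteMeasure
  exact (hν.memLp_and_integral_norm_sq_le hΦ hinv hsq (integrable_spread hf.integrable hr)
    (hf.memLp_fourierHat_spread hq hC hr)).1

/-- The squared transform of `f_r` carries `r^(2d)`, one half of which cancels against the
normalization. -/
theorem complexVariance_spread_div (hΦ : Measurable Φ) (hinv : IsInvariantRCM Φ)
    (hsq : IsLocallySquareIntegrable P Φ) (hν : IsBartlettSpectralMeasure P Φ ν)
    (hf : IsFourierSmooth f q) (hq : 0 < (d : ℝ) + q) {r : ℝ} (hr : 0 < r) :
    complexVariance P (fun ω => (Φ ω).integral (spread f r)) / r ^ d =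
      r ^ d * ∫ k, ‖fourierHat f (r • k)‖ ^ 2 ∂ν := by
  obtain ⟨C, hC⟩ := hν.exists_measure_ball_le
  have := hν.isLocallyFiniteMeasure
  rw [hν.complexVariance_eq hΦ hinv hsq (integrable_spread hf.integrable hr)
    (hf.memLp_fourierHat_spread hq hC hr)]
  have e : ∀ k, ‖fourierHat (spread f r) k‖ ^ 2 = (r ^ d) ^ 2 * ‖fourierHat f (r • k)‖ ^ 2 :=
    fun k => by
      rw [fourierHat_spread f hr, norm_mul, norm_pow, Complex.norm_real, Real.norm_of_nonneg hr.le,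
        mul_pow]
  simp_rw [e]
  rw [integral_const_mul]
  field_simp

/-- The variance rate implied by a quantitative bound on the spectral measure near `0`. -/
theorem exists_complexVariance_spread_le (hΦ : Measurable Φ) (hinv : IsInvariantRCM Φ)
    (hsq : IsLocallySquareIntegrable P Φ) (hν : IsBartlettSpectralMeasure P Φ ν)
    (hf : IsFourierSmooth f (p + ϑ)) (hp : -(d : ℝ) ≤ p) (hϑ : 0 < ϑ) :
    ∃ K : ℝ, 0 ≤ K ∧ ∀ A : ℝ, 0 ≤ A →
      (∀ᶠ ε in 𝓝[>] (0 : ℝ), ‖ν.real (Metric.ball 0 ε) / ε ^ d‖ ≤ A * ‖ε ^ p‖) →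
      ∃ D : ℝ, 0 ≤ D ∧ ∀ᶠ r : ℝ in atTop,
        ‖complexVariance P (fun ω => (Φ ω).integral (spread f r)) / r ^ d‖ ≤
          (K * A + D * r ^ (-ϑ)) * ‖r ^ (-p)‖ := by
  obtain ⟨C, hC⟩ := hν.exists_measure_ball_le
  have := hν.isLocallyFiniteMeasure
  obtain ⟨K, hK0, hK⟩ := hf.exists_integral_norm_sq_le (a := d + p) (by linarith) (by linarith) hC
  refine ⟨K, hK0, fun A hA hev => ?_⟩
  obtain ⟨ε₀, hε₀, hsub⟩ := mem_nhdsGT_iff_exists_Ioc_subset.1 hev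
  obtain ⟨D, hD0, hD⟩ := hK A ε₀ hA hε₀ fun ε h0 hε => by
    have h1 : ‖ν.real (Metric.ball 0 ε) / ε ^ d‖ ≤ A * ‖ε ^ p‖ := hsub ⟨h0, hε⟩
    rw [Real.norm_of_nonneg (by positivity), Real.norm_of_nonneg (by positivity),
      div_le_iff₀ (by positivity)] at h1
    refine h1.trans_eq ?_
    rw [Real.rpow_add h0, Real.rpow_natCast]
    ring
  refine ⟨D, hD0, ?_⟩
  filter_upwards [hD, eventually_gt_atTop 0] with r hr h0
  rw [hν.complexVariance_spread_div hΦ hinv hsq hf (by linarith) h0,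
    Real.norm_of_nonneg (by positivity), Real.norm_of_nonneg (by positivity)]
  refine (mul_le_mul_of_nonneg_left hr (by positivity)).trans_eq ?_
  have e1 : r ^ (-((d : ℝ) + p)) = (r ^ d)⁻¹ * r ^ (-p) := by
    rw [neg_add, Real.rpow_add h0, Real.rpow_neg h0.le, Real.rpow_natCast]
  have e2 : r ^ (-((d : ℝ) + (p + ϑ))) = (r ^ d)⁻¹ * (r ^ (-p) * r ^ (-ϑ)) := by
    rw [neg_add, neg_add, Real.rpow_add h0, Real.rpow_add h0, Real.rpow_neg h0.le (d : ℝ),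
      Real.rpow_natCast]
  rw [e1, e2]
  field_simp

/-- If `∫ f ≠ 0`, the spectral measure near `0` is controlled by the variances. -/
theorem isBigO_measure_ball (hΦ : Measurable Φ) (hinv : IsInvariantRCM Φ)
    (hsq : IsLocallySquareIntegrable P Φ) (hν : IsBartlettSpectralMeasure P Φ ν)
    (hf : IsFourierSmooth f q) (hq : 0 < (d : ℝ) + q) (h0 : (∫ x, f x) ≠ 0) :
    ∃ δ : ℝ, 0 < δ ∧ (fun ε : ℝ => ν.real (Metric.ball 0 ε) / ε ^ d) =O[𝓝[>] (0 : ℝ)]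
      fun ε : ℝ => complexVariance P (fun ω => (Φ ω).integral (spread f (δ / ε))) /
        (δ / ε) ^ d := by
  obtain ⟨C, hC⟩ := hν.exists_measure_ball_le
  have := hν.isLocallyFiniteMeasure
  have hfc := continuous_fourierHat hf.integrable
  have hc0 : 0 < ‖fourierHat f 0‖ ^ 2 := by
    rw [fourierHat_zero]; positivity
  -- As `f̂` is continuous with `f̂(0) = ∫ f ≠ 0`, its squared modulus exceeds half its value at 0
  -- on `B_δ`. The dilation `r = δ / ε` transports this lower bound to `B_ε`.
  obtain ⟨δ, hδ, hball⟩ := Metric.eventually_nhds_iff_ball.1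
    (((hfc.norm.pow 2).tendsto (0 : Rd d)).eventually (lt_mem_nhds (half_lt_self hc0)))
  set c := ‖fourierHat f 0‖ ^ 2 / 2 with hc
  have hcpos : 0 < c := half_pos hc0
  refine ⟨δ, hδ, IsBigO.of_bound (c⁻¹ * (δ ^ d)⁻¹) ?_⟩
  filter_upwards [self_mem_nhdsWithin] with ε hε
  have hε : 0 < ε := hε
  have hr : 0 < δ / ε := div_pos hδ hε
  have hmem := (hf.memLp_fourierHat_spread hq hC hr)
  have hint : Integrable (fun k => ‖fourierHat f ((δ / ε) • k)‖ ^ 2) ν := by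
    have h1 := ((memLp_two_iff_integrable_sq_norm hmem.1).1 hmem).const_mul
      ((((δ / ε) ^ d) ^ 2)⁻¹)
    refine h1.congr (ae_of_all _ fun k => ?_)
    simp only
    rw [fourierHat_spread f hr, norm_mul, norm_pow, Complex.norm_real, Real.norm_of_nonneg hr.le,
      mul_pow, inv_mul_cancel_left₀ (pow_ne_zero 2 (pow_ne_zero d hr.ne'))]
  -- Markov's inequality: `B_ε` lies in the set where the dilated integrand is at least `c`.
  have hle : c * ν.real (Metric.ball 0 ε) ≤ ∫ k, ‖fourierHat f ((δ / ε) • k)‖ ^ 2 ∂ν := by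
    refine le_trans ?_ (mul_meas_ge_le_integral_of_nonneg (ae_of_all _ fun k => by positivity)
      hint c)
    refine mul_le_mul_of_nonneg_left (measureReal_mono (fun k hk => ?_) ?_) hcpos.le
    · refine (hball _ ?_).le
      rw [mem_ball_zero_iff] at hk ⊢
      rw [norm_smul, Real.norm_of_nonneg hr.le, div_mul_eq_mul_div, div_lt_iff₀ hε]
      exact mul_lt_mul_of_pos_left hk hδ
    · exact (hint.measure_ge_lt_top hcpos).ne
  rw [hν.complexVariance_spread_div hΦ hinv hsq hf hq hr]
  generalize (∫ k, ‖fourierHat f ((δ / ε) • k)‖ ^ 2 ∂ν) = J at hle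
  have hJ : 0 ≤ J := le_trans (by positivity) hle
  rw [Real.norm_of_nonneg (by positivity), Real.norm_of_nonneg (by positivity),
    div_le_iff₀ (by positivity)]
  have e : c⁻¹ * (δ ^ d)⁻¹ * ((δ / ε) ^ d * J) * ε ^ d = c⁻¹ * J := by
    rw [div_pow]; field_simp
  rw [e, le_inv_mul_iff₀ hcpos]
  exact hle

end IsBartlettSpectralMeasure

theorem tendsto_const_div_nhdsGT_zero {δ : ℝ} (hδ : 0 < δ) :
    Tendsto (fun ε : ℝ => δ / ε) (𝓝[>] 0) atTop := by
  simp_rw [div_eq_mul_inv]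
  exact tendsto_inv_nhdsGT_zero.const_mul_atTop hδ

theorem isBigO_const_div_rpow_neg {δ : ℝ} (hδ : 0 < δ) (p : ℝ) :
    (fun ε : ℝ => (δ / ε) ^ (-p)) =O[𝓝[>] 0] fun ε : ℝ => ε ^ p := by
  refine IsBigO.of_bound (δ ^ (-p)) ?_
  filter_upwards [self_mem_nhdsWithin] with ε hε
  have hε : 0 < ε := hε
  rw [Real.norm_of_nonneg (by positivity), Real.norm_of_nonneg (by positivity),
    Real.div_rpow hδ.le hε.le, Real.rpow_neg hε.le p, div_inv_eq_mul]

end Asymptotics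

end

/-! ### The real-space characterization of uniformity -/

theorem theoremt {d : ℕ} (hd : 0 < d) {Ω : Type*} [MeasurableSpace Ω]
    (P : Measure Ω) [IsProbabilityMeasure P]
    [AddAction (Rd d) Ω] [MeasurableConstVAdd (Rd d) Ω] [VAddInvariantMeasure (Rd d) Ω P]
    (Φ : Ω → LocComplexMeasure d) (hΦ : Measurable Φ) (hinv : IsInvariantRCM Φ)
    (hsq : IsLocallySquareIntegrable P Φ)
    (p : ℝ) (hp : -(d : ℝ) ≤ p) (ϑ : ℝ) (hϑ : 0 < ϑ)
    (f : Rd d → ℂ) (hf : IsFourierSmooth f (p + ϑ)) :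
    -- the random variables `Φ(f_r)` are well defined and square-integrable
    (∀ r : ℝ, 0 < r →
      (∀ᵐ ω ∂P, Integrable (spread f r) (Φ ω).variation) ∧
      MemLp (fun ω => (Φ ω).integral (spread f r)) 2 P) ∧
    -- `p`-uniformity and beyond `p`-uniformity give the rate of the variance
    (IsUniform P Φ p →
      (fun r : ℝ => complexVariance P (fun ω => (Φ ω).integral (spread f r)) / r ^ d)
        =O[atTop] fun r : ℝ => r ^ (-p)) ∧
    (IsBeyondUniform P Φ p →
      (fun r : ℝ => complexVariance P (fun ω => (Φ ω).integral (spread f r)) / r ^ d)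
        =o[atTop] fun r : ℝ => r ^ (-p)) ∧
    -- the converses
    ((∫ x, f x) ≠ 0 →
      ((fun r : ℝ => complexVariance P (fun ω => (Φ ω).integral (spread f r)) / r ^ d)
        =O[atTop] (fun r : ℝ => r ^ (-p)) → IsUniform P Φ p) ∧
      ((fun r : ℝ => complexVariance P (fun ω => (Φ ω).integral (spread f r)) / r ^ d)
        =o[atTop] (fun r : ℝ => r ^ (-p)) → IsBeyondUniform P Φ p)) := by
  have hq : 0 < (d : ℝ) + (p + ϑ) := by linarith
  -- This measure serves square-integrability and the converses. The direct parts work with the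
  -- measure supplied by their hypothesis, so uniqueness never enters.
  obtain ⟨ν₀, hν₀⟩ := exists_isBartlettSpectralMeasure hΦ hinv hsq
  refine ⟨fun r hr => ⟨ae_integrable_variation hΦ hinv hsq (integrable_spread hf.integrable hr),
    hν₀.memLp_integral_spread hΦ hinv hsq hf hq hr⟩, ?_, ?_, fun h0 => ?_⟩
  · rintro ⟨ν, hν, hO⟩
    obtain ⟨K, hK0, hK⟩ := hν.exists_complexVariance_spread_le hΦ hinv hsq hf hp hϑ
    obtain ⟨A, hA, hAO⟩ := hO.exists_nonneg
    obtain ⟨D, hD0, hD⟩ := hK A hA hAO.bound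
    -- For `r ≥ 1` the factor `r ^ (-ϑ)` is at most one.
    refine IsBigO.of_bound (K * A + D) ?_
    filter_upwards [hD, eventually_ge_atTop 1] with r hr h1
    refine hr.trans (mul_le_mul_of_nonneg_right (add_le_add le_rfl
      (mul_le_of_le_one_right hD0 ?_)) (norm_nonneg _))
    exact Real.rpow_le_one_of_one_le_of_nonpos h1 (by linarith)
  · rintro ⟨ν, hν, ho⟩
    obtain ⟨K, hK0, hK⟩ := hν.exists_complexVariance_spread_le hΦ hinv hsq hf hp hϑ
    refine isLittleO_iff.2 fun c hc => ?_
    -- This choice keeps `K * A` below `c / 2`; the shift `K + 1` covers `K = 0`. `D` depends on it,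
    -- but `D * r ^ (-ϑ)` still falls below `c / 2` eventually.
    obtain ⟨D, hD0, hD⟩ := hK (c / (2 * (K + 1))) (by positivity)
      (isLittleO_iff.1 ho (by positivity))
    have hlim : Tendsto (fun r : ℝ => D * r ^ (-ϑ)) atTop (𝓝 0) := by
      have := (tendsto_rpow_neg_atTop hϑ).const_mul D
      rwa [mul_zero] at this
    filter_upwards [hD, hlim.eventually (gt_mem_nhds (half_pos hc))] with r hr h1
    refine hr.trans (mul_le_mul_of_nonneg_right ?_ (norm_nonneg _))
    have h2 : K * (c / (2 * (K + 1))) ≤ c / 2 := by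
      rw [mul_div_assoc', div_le_div_iff₀ (by positivity) (by positivity)]
      nlinarith
    linarith
  -- The substitution `r = δ / ε` turns rates as `r → ∞` into rates as `ε → 0` from the right.
  · obtain ⟨δ, hδ, hO⟩ := hν₀.isBigO_measure_ball hΦ hinv hsq hf hq h0
    refine ⟨fun h => ⟨ν₀, hν₀, ?_⟩, fun h => ⟨ν₀, hν₀, ?_⟩⟩
    · exact (hO.trans (h.comp_tendsto (tendsto_const_div_nhdsGT_zero hδ))).trans
        (isBigO_const_div_rpow_neg hδ p)
    · exact (hO.trans_isLittleO (h.comp_tendsto (tendsto_const_div_nhdsGT_zero hδ))).trans_isBigO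
        (isBigO_const_div_rpow_neg hδ p)
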